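/- \textbf{Setting.} Let $\mathbb{R}^2_1$ be the plane with the metric $d_1(p,q)=|p_1-q_1|+|p_2-q_2|$. The tight span $T(X)$ of a finite metric space $(X,d)$ is the set of functions $f\colon X\to[0,\infty)$ with $f(x)+f(y)\ge d(x,y)$ for all $x,y$ and such that for each $x$ there is a $y$ with $f(x)+f(y)=d(x,y)$, with the maximum metric. Put $\triangle_{x,yz}=\frac12(d(x,y)+d(x,z)-d(y,z))$. The pendant length $\underline d(x)$ is the minimum of $\triangle_{x,yz}$ over distinct $y,z\in X\setminus\{x\}$ if $|X|\ge 3$, half the distance of the two points if $|X|=2$, and $0$ if $|X|=1$. $X$ is trim if all pendant lengths vanish. Trimming $X$ means passing to the quotient $t(X)$ of $X$ by the relation "$x=y$ or $d(x,y)=\underline d(x)+\underline d(y)$", with the metric $d(x,y)-\underline d(x)-\underline d(y)$ between different classes. For finite $X\subset\mathbb{R}^2_1$ with $|X|\ge 3$ and $a\in X$, the metric center $m_a$ of $a$ is the unique point $m$ with $d_1(a,b)=d_1(a,m)+d_1(m,b)$, $d_1(a,c)=d_1(a,m)+d_1(m,c)$, $d_1(b,c)=d_1(b,m)+d_1(m,c)$,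 where $b\neq c$ in $X\setminus\{a\}$ make $\triangle_{a,bc}$ minimal; for $|X|=2$ it is the midpoint of the two points, and for $|X|=1$ it is $a$. Put $m(X)=\{m_a:a\in X\}$, let $m^i(X)$ be the $i$-th iterate, and for $x\in X$ let $m^i(x)\in m^i(X)$ be the image of $x$ under the successive maps $a\mapsto m_a$. Let $\overline{MC_N(X)}\subset\mathbb{R}^2_1$ be the embedded trimming cylinder, the union of the points $m^i(x)$ ($x\in X$, $0\le i\le N$) and the straight segments $[m^i(x),m^{i+1}(x)]$ ($x\in X$, $0\le i<N$). A set $S\subset\mathbb{R}^2_1$ is geodesically convex if any two of its points are joined by a geodesic of $\mathbb{R}^2_1$ inside $S$. For $A\subset\mathbb{R}^2_1$, a minimal convex set over $A$ is a set that is minimal for inclusion among the closed geodesically convex sets containing $A$. \textbf{Corner-cutting algorithm} for a finite set $A$. Let $R$ be the minimal axis-parallel rectangle containing $A$, and let $P:=R$. For the bottom left, top left, top right and bottom right corner of $R$, in this order, do: let $a$ be the corner; while $a\notin A$, let $b$ be the point of $A$ on the line $y=a_y$ closest to $a$; choose $d\in A$ with $d_x$ between $a_x$ and $b_x$ (inclusive),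 $d_y>a_y$ at a bottom corner, $d_y<a_y$ at a top corner, and $|d_y-a_y|$ as small as possible; remove from $P$ the axis-parallel rectangle with opposite corners $a$ and $(b_x,d_y)$ except its points on the lines $x=b_x$ and $y=d_y$; add $(b_x,d_y)$ to $A$; replace $a$ by $(a_x,d_y)$. The output is the final $P$. \textbf{Theorem.} Let $X\subset\mathbb{R}^2_1$ be finite and non-empty. There is an $N\ge0$ such that $m^N(X)$ is trim. For every such $N$ the following hold. (1) $m^i(X)=m^N(X)$ for all $i\ge N$. (2) Embed $T(m^N(X))$ in $T(X)$ by sending $f$ to the function $x\mapsto f(m^N(x))+\sum_{i<N}d_1(m^i(x),m^{i+1}(x))$, and send a point $p$ of $\overline{MC_N(X)}$ to the function $x\mapsto d_1(p,x)$. With these identifications $$T(X)=T(m^N(X))\cup\overline{MC_N(X)},\qquad T(m^N(X))\cap\overline{MC_N(X)}=m^N(X).$$ (3) The corner-cutting algorithm, applied to $m^N(X)$, terminates, its output does not depend on the choices of $d$, and this output is a minimal convex set over $m^N(X)$. (4) For every minimal convex set $B$ over $m^N(X)$ (in particular for the output of the algorithm), $p\mapsto d_1(p,\cdot)$ is an isometry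 from $B$ onto $T(m^N(X))$ and an isometry from $B\cup\overline{MC_N(X)}$ onto $T(X)$, and $B\cap\overline{MC_N(X)}=m^N(X)$. (5) $T(X)$ is a tree (any two points are joined by a geodesic, which is the only arc between them) if and only if $m^N(X)$ is a singleton. Moreover, $T(X)$ is a tree if and only if iterated trimming $X,t(X),t(t(X)),\dots$ reaches a one-point space. -/

import Mathlib

/-! ## Geodesics and trees in metric spaces -/

/-- `γ`, restricted to `[0, d(x,y)]`, is a geodesic from `x` to `y`. -/
def IsGeodesic {α : Type*} [MetricSpace α] (γ : ℝ → α) (x y : α) : Prop :=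
  γ 0 = x ∧ γ (dist x y) = y ∧
    ∀ s ∈ Set.Icc 0 (dist x y), ∀ t ∈ Set.Icc 0 (dist x y), dist (γ s) (γ t) = |s - t|

/-- Any two points of `S` are joined by a geodesic of the ambient space that runs inside `S`. -/
def GeodesicallyConvex {α : Type*} [MetricSpace α] (S : Set α) : Prop :=
  ∀ x ∈ S, ∀ y ∈ S, ∃ γ : ℝ → α, IsGeodesic γ x y ∧ ∀ t ∈ Set.Icc 0 (dist x y), γ t ∈ S

/-- A metric tree: any two points are joined by a geodesic, and this geodesic is the only arc
(image of an injective path) between them. -/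
def IsMetricTree (α : Type*) [MetricSpace α] : Prop :=
  ∀ x y : α, ∃ γ : ℝ → α, IsGeodesic γ x y ∧
    ∀ c : ℝ → α, ContinuousOn c (Set.Icc 0 1) → Set.InjOn c (Set.Icc 0 1) → c 0 = x → c 1 = y →
      c '' Set.Icc 0 1 = γ '' Set.Icc 0 (dist x y)

/-! ## The tight span of a finite metric space -/

/-- The tight span of a finite metric space, as a set of functions; for `[Fintype α]` its metric is
the maximum metric that `α → ℝ` carries. -/
def tightSpan (α : Type*) [MetricSpace α] : Set (α → ℝ) :=
  {f | (∀ x, 0 ≤ f x) ∧ (∀ x y, dist x y ≤ f x + f y) ∧ ∀ x, ∃ y, f x + f y = dist x y}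

/-! ## Pendant lengths and trimming -/

/-- The Gromov product at `x` with respect to `y` and `z`. -/
noncomputable def gromovProduct {α : Type*} [MetricSpace α] (x y z : α) : ℝ :=
  (dist x y + dist x z - dist y z) / 2

/-- The pendant length of a point of a finite metric space: the minimal Gromov product at `x` with
respect to two distinct points different from `x`; half the distance of the two points in a
two-point space; and `0` in a one-point space (where the infimum is over the empty set). -/
noncomputable def pendant {α : Type*} [MetricSpace α] (x : α) : ℝ :=
  if Nat.card α = 2 then (⨆ y : α, dist x y) / 2
  else sInf {r | ∃ y z : α, y ≠ x ∧ z ≠ x ∧ y ≠ z ∧ r = gromovProduct x y z}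

/-- A metric space is trim (pendant-free) if all its pendant lengths vanish. -/
def IsTrim (α : Type*) [MetricSpace α] : Prop := ∀ x : α, pendant x = 0

/-- The equivalence relation by which a finite metric space is trimmed. -/
def TrimRel {α : Type*} [MetricSpace α] (x y : α) : Prop :=
  x = y ∨ dist x y = pendant x + pendant y

theorem pendant_le {α : Type*} [Fintype α] [MetricSpace α] {x y z : α}
    (hy : y ≠ x) (hz : z ≠ x) (hyz : y ≠ z) :
    2 * pendant x ≤ dist x y + dist x z - dist y z := by
  classical
  have hc : Nat.card α ≠ 2 := by
    intro h
    have h3 : ({x, y, z} : Finset α).card = 3 := Finset.card_eq_three.2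
      ⟨x, y, z, hy.symm, hz.symm, hyz, rfl⟩
    have := Finset.card_le_univ ({x, y, z} : Finset α)
    rw [Nat.card_eq_fintype_card] at h
    omega
  have hfin : {r | ∃ y z : α, y ≠ x ∧ z ≠ x ∧ y ≠ z ∧ r = gromovProduct x y z}.Finite := by
    refine (Set.finite_range (fun p : α × α => gromovProduct x p.1 p.2)).subset ?_
    rintro r ⟨u, v, -, -, -, rfl⟩
    exact ⟨(u, v), rfl⟩
  have h : pendant x ≤ gromovProduct x y z := by
    rw [pendant, if_neg hc]
    exact csInf_le hfin.bddBelow ⟨y, z, hy, hz, hyz, rfl⟩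
  unfold gromovProduct at h
  linarith

theorem pendant_add_le {α : Type*} [Fintype α] [MetricSpace α] {x y : α} (h : x ≠ y) :
    pendant x + pendant y ≤ dist x y := by
  classical
  by_cases hz : ∃ z, z ≠ x ∧ z ≠ y
  · obtain ⟨z, hx, hy⟩ := hz
    have h1 := pendant_le h.symm hx hy.symm
    have h2 := pendant_le h hy hx.symm
    rw [dist_comm y x] at h2
    linarith
  · push Not at hz
    have hu : ∀ z, z = x ∨ z = y := fun z => by
      by_cases hzx : z = x
      · exact Or.inl hzx
      · exact Or.inr (hz z hzx)
    have hc : Nat.card α = 2 := by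
      rw [Nat.card_eq_fintype_card, ← Finset.card_univ]
      have : (Finset.univ : Finset α) = {x, y} := by
        ext z; simpa using hu z
      rw [this, Finset.card_pair h]
    have : Nonempty α := ⟨x⟩
    have hx : (⨆ z : α, dist x z) ≤ dist x y := ciSup_le fun z => by
      rcases hu z with rfl | rfl
      · simp
      · exact le_rfl
    have hy : (⨆ z : α, dist y z) ≤ dist x y := ciSup_le fun z => by
      rcases hu z with rfl | rfl
      · rw [dist_comm]
      · simp
    rw [pendant, pendant, if_pos hc, if_pos hc]
    linarith

theorem trimRel_symm {α : Type*} [MetricSpace α] {x y : α} (h : TrimRel x y) : TrimRel y x := by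
  rcases h with rfl | h
  · exact Or.inl rfl
  · exact Or.inr (by rw [dist_comm, h, add_comm])

theorem trimRel_trans {α : Type*} [Fintype α] [MetricSpace α] {x y z : α}
    (h : TrimRel x y) (h' : TrimRel y z) : TrimRel x z := by
  by_cases hxz : x = z
  · exact Or.inl hxz
  by_cases hxy : x = y
  · subst hxy; exact h'
  by_cases hyz : y = z
  · subst hyz; exact h
  right
  have h1 := h.resolve_left hxy
  have h2 := h'.resolve_left hyz
  have h3 := pendant_le (x := y) hxy (Ne.symm hyz) hxz
  have h4 := pendant_add_le hxz
  rw [dist_comm y x] at h3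
  linarith

/-- The trimming relation as a setoid. -/
def trimSetoid (α : Type*) [Fintype α] [MetricSpace α] : Setoid α where
  r := TrimRel
  iseqv := ⟨fun _ => Or.inl rfl, trimRel_symm, trimRel_trans⟩

open Classical in
/-- The distance of the classes of `x` and `y` in the trimmed space. -/
noncomputable def trimDist {α : Type*} [MetricSpace α] (x y : α) : ℝ :=
  if TrimRel x y then 0 else dist x y - pendant x - pendant y

theorem trimDist_comm {α : Type*} [MetricSpace α] (x y : α) : trimDist x y = trimDist y x := by
  by_cases h : TrimRel x y
  · rw [trimDist, trimDist, if_pos h, if_pos (trimRel_symm h)]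
  · have h' : ¬ TrimRel y x := fun k => h (trimRel_symm k)
    rw [trimDist, trimDist, if_neg h, if_neg h', dist_comm x y]
    ring

theorem trimDist_congr_left {α : Type*} [Fintype α] [MetricSpace α] {x x' : α} (y : α)
    (h : TrimRel x x') : trimDist x y = trimDist x' y := by
  have hiff : TrimRel x y ↔ TrimRel x' y :=
    ⟨fun k => trimRel_trans (trimRel_symm h) k, fun k => trimRel_trans h k⟩
  by_cases hxx : x = x'
  · rw [hxx]
  by_cases hxy : TrimRel x y
  · rw [trimDist, trimDist, if_pos hxy, if_pos (hiff.1 hxy)]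
  · have hxy' := fun k => hxy (hiff.2 k)
    rw [trimDist, trimDist, if_neg hxy, if_neg hxy']
    have n1 : y ≠ x := fun k => hxy (Or.inl k.symm)
    have n2 : y ≠ x' := fun k => hxy' (Or.inl k.symm)
    have h0 := h.resolve_left hxx
    have h1 := pendant_le (x := x) (Ne.symm hxx) n1 n2.symm
    have h2 := pendant_le (x := x') hxx n2 n1.symm
    rw [dist_comm x' x] at h2
    linarith

/-- The metric of the trimmed space. -/
@[reducible] noncomputable def trimMetric (α : Type*) [Fintype α] [MetricSpace α] :
    MetricSpace (Quotient (trimSetoid α)) where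
  dist := Quotient.lift₂ trimDist fun a b a' b' ha hb => by
    rw [trimDist_congr_left b ha, trimDist_comm a' b, trimDist_congr_left a' hb, trimDist_comm]
  dist_self := by
    rintro ⟨x⟩
    exact if_pos (Or.inl rfl)
  dist_comm := by
    rintro ⟨x⟩ ⟨y⟩
    exact trimDist_comm x y
  dist_triangle := by
    rintro ⟨x⟩ ⟨y⟩ ⟨z⟩
    change trimDist x z ≤ trimDist x y + trimDist y z
    by_cases hxy : TrimRel x y
    · rw [trimDist_congr_left z hxy]
      have : trimDist x y = 0 := if_pos hxy
      linarith
    by_cases hyz : TrimRel y z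
    · rw [trimDist_comm x z, ← trimDist_congr_left x hyz, trimDist_comm y x]
      have : trimDist y z = 0 := if_pos hyz
      linarith
    have nxy : x ≠ y := fun k => hxy (Or.inl k)
    have nyz : y ≠ z := fun k => hyz (Or.inl k)
    have e1 : trimDist x y = dist x y - pendant x - pendant y := if_neg hxy
    have e2 : trimDist y z = dist y z - pendant y - pendant z := if_neg hyz
    by_cases hxz : TrimRel x z
    · have e3 : trimDist x z = 0 := if_pos hxz
      have := pendant_add_le nxy
      have := pendant_add_le nyz
      linarith
    · have nxz : x ≠ z := fun k => hxz (Or.inl k)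
      have e3 : trimDist x z = dist x z - pendant x - pendant z := if_neg hxz
      have := pendant_le (x := y) nxy nyz.symm nxz
      rw [dist_comm y x] at this
      linarith
  eq_of_dist_eq_zero := by
    rintro ⟨x⟩ ⟨y⟩ h
    change trimDist x y = 0 at h
    refine Quotient.sound ?_
    change TrimRel x y
    by_contra hxy
    rw [trimDist, if_neg hxy] at h
    exact hxy (Or.inr (by linarith))

/-- Finite metric spaces. -/
structure FinMetric where
  carrier : Type
  [fintype : Fintype carrier]
  [metric : MetricSpace carrier]

/-- One trimming step. -/
noncomputable def FinMetric.trim (S : FinMetric) : FinMetric :=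
  letI := S.fintype
  letI := S.metric
  { carrier := Quotient (trimSetoid S.carrier)
    fintype := Fintype.ofFinite _
    metric := trimMetric S.carrier }

/-! ## The Manhattan plane and metric centers -/

/-- The Manhattan plane: `ℝ²` with the metric `|x₁ - x₂| + |y₁ - y₂|`. -/
abbrev ManhattanPlane : Type := WithLp 1 (ℝ × ℝ)

/-- The point with coordinates `x` and `y`. -/
def mkPoint (x y : ℝ) : ManhattanPlane := WithLp.toLp 1 (x, y)

/-- `m` is the metric center of `a`, `b`, `c`. -/
def IsMetricCenter (a b c m : ManhattanPlane) : Prop :=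
  dist a b = dist a m + dist m b ∧ dist a c = dist a m + dist m c ∧
    dist b c = dist b m + dist m c

/-- `m` is the metric center of a triple `a, b, c` of points of `X` for which the Gromov product
at `a` is minimal. -/
def IsCenterIn (X : Finset ManhattanPlane) (a m : ManhattanPlane) : Prop :=
  ∃ b ∈ X, ∃ c ∈ X, b ≠ a ∧ c ≠ a ∧ b ≠ c ∧
    (∀ u ∈ X, ∀ v ∈ X, u ≠ a → v ≠ a → u ≠ v → gromovProduct a b c ≤ gromovProduct a u v) ∧
    IsMetricCenter a b c m

open Classical in
/-- The metric center `m_a` associated with a point `a` of `X`. In a two-point set it is the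
midpoint of the two points, in a one-point set it is `a`. -/
noncomputable def centerOf (X : Finset ManhattanPlane) (a : ManhattanPlane) : ManhattanPlane :=
  if h : ∃ b, b ≠ a ∧ X = {a, b} then midpoint ℝ a h.choose
  else if h : ∃ m, IsCenterIn X a m then h.choose
  else a

open Classical in
/-- The metric center `m(X)` of a finite set. -/
noncomputable def centerSet (X : Finset ManhattanPlane) : Finset ManhattanPlane :=
  X.image (centerOf X)

/-- The metric center sequence `mⁱ(X)`. -/
noncomputable def centerSeq (X : Finset ManhattanPlane) : ℕ → Finset ManhattanPlane
  | 0 => X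
  | i + 1 => centerSet (centerSeq X i)

/-- The trajectory `mⁱ(x)` of a point under the center projections `mⁱ(X) → mⁱ⁺¹(X)`. -/
noncomputable def centerTraj (X : Finset ManhattanPlane) (x : ManhattanPlane) : ℕ → ManhattanPlane
  | 0 => x
  | i + 1 => centerOf (centerSeq X i) (centerTraj X x i)

theorem centerTraj_mem (X : Finset ManhattanPlane) (x : ManhattanPlane) (hx : x ∈ X) (i : ℕ) :
    centerTraj X x i ∈ centerSeq X i := by
  classical
  induction i with
  | zero => exact hx
  | succ i ih => exact Finset.mem_image_of_mem _ ih

/-- The metric center cylinder up to level `k`, embedded in the plane: the graph with the vertices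
`mⁱ(x)`, `i ≤ k`, and the straight edges `[mⁱ(x), mⁱ⁺¹(x)]`, `i < k`. -/
def centerCylinder (X : Finset ManhattanPlane) (k : ℕ) : Set ManhattanPlane :=
  (⋃ x ∈ X, ⋃ i ∈ Set.Iic k, {centerTraj X x i}) ∪
    ⋃ x ∈ X, ⋃ i ∈ Set.Iio k, segment ℝ (centerTraj X x i) (centerTraj X x (i + 1))

/-- The function on `X` given by the distances to a point of the plane. -/
noncomputable def distTo (X : Finset ManhattanPlane) (p : ManhattanPlane) : X → ℝ :=
  fun x => dist p x

/-- The inclusion of the tight span of `m^N(X)` into the tight span of `X`: the value at `x` is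
the value at `m^N(x)` increased by the length of the path `x, m(x), …, m^N(x)`. -/
noncomputable def pullBack (X : Finset ManhattanPlane) (N : ℕ) (f : centerSeq X N → ℝ) : X → ℝ :=
  fun x => f ⟨centerTraj X x N, centerTraj_mem X x x.2 N⟩ +
    ∑ i ∈ Finset.range N, dist (centerTraj X x i) (centerTraj X x (i + 1))

/-- Closed, geodesically convex, containing `A`, and minimal (for inclusion) with these
properties. -/
def IsMinimalConvex (A B : Set ManhattanPlane) : Prop :=
  Minimal (fun S : Set ManhattanPlane => A ⊆ S ∧ IsClosed S ∧ GeodesicallyConvex S) B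

/-! ## The corner-cutting algorithm -/

/-- Smallest abscissa of a point of `A`. -/
noncomputable def xMin (A : Finset ManhattanPlane) : ℝ := sInf ((fun p => p.fst) '' (A : Set ManhattanPlane))
/-- Largest abscissa of a point of `A`. -/
noncomputable def xMax (A : Finset ManhattanPlane) : ℝ := sSup ((fun p => p.fst) '' (A : Set ManhattanPlane))
/-- Smallest ordinate of a point of `A`. -/
noncomputable def yMin (A : Finset ManhattanPlane) : ℝ := sInf ((fun p => p.snd) '' (A : Set ManhattanPlane))
/-- Largest ordinate of a point of `A`. -/
noncomputable def yMax (A : Finset ManhattanPlane) : ℝ := sSup ((fun p => p.snd) '' (A : Set ManhattanPlane))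

/-- The minimal axis-parallel rectangle that contains `A`. -/
def boundingRect (A : Finset ManhattanPlane) : Set ManhattanPlane :=
  {p | p.fst ∈ Set.Icc (xMin A) (xMax A) ∧ p.snd ∈ Set.Icc (yMin A) (yMax A)}

/-- The axis-parallel rectangle with opposite corners `(a_x, a_y)` and `(b_x, d_y)`, without its
two sides on the lines `x = b_x` and `y = d_y`; for the bottom left corner, where `a_x ≤ b_x` and
`a_y ≤ d_y`, this is `[a_x, b_x) × [a_y, d_y)`, and likewise for the other corners. -/
def cutBox (a b d : ManhattanPlane) : Set ManhattanPlane :=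
  {p | p.fst ∈ Set.uIcc a.fst b.fst ∧ p.fst ≠ b.fst ∧ p.snd ∈ Set.uIcc a.snd d.snd ∧ p.snd ≠ d.snd}

open Classical in
/-- `CornerRun ahead A P a A' P'`: the loop of a corner procedure, entered with the values
`A`, `P`, `a` of its variables, terminates with the values `A'`, `P'` of the first two.
`ahead y y'` is `y < y'` at the two bottom corners and `y' < y` at the two top corners. -/
inductive CornerRun (ahead : ℝ → ℝ → Prop) : Finset ManhattanPlane → Set ManhattanPlane →
    ManhattanPlane → Finset ManhattanPlane → Set ManhattanPlane → Prop
  | done (A : Finset ManhattanPlane) (P : Set ManhattanPlane) (a : ManhattanPlane) (ha : a ∈ A) :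
      CornerRun ahead A P a A P
  | cut (A : Finset ManhattanPlane) (P : Set ManhattanPlane) (a b d : ManhattanPlane)
      (A' : Finset ManhattanPlane) (P' : Set ManhattanPlane) (ha : a ∉ A)
      (hb : b ∈ A ∧ b.snd = a.snd) (hb_min : ∀ c ∈ A, c.snd = a.snd → dist a b ≤ dist a c)
      (hd : d ∈ A ∧ d.fst ∈ Set.uIcc a.fst b.fst ∧ ahead a.snd d.snd)
      (hd_min : ∀ c ∈ A, c.fst ∈ Set.uIcc a.fst b.fst → ahead a.snd c.snd →
        |d.snd - a.snd| ≤ |c.snd - a.snd|)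
      (hrun : CornerRun ahead (insert (mkPoint b.fst d.snd) A) (P \ cutBox a b d)
        (mkPoint a.fst d.snd) A' P') :
      CornerRun ahead A P a A' P'

/-- The algorithm, started with the finite set `A`, terminates with the output `B`: the procedures
of the bottom left, top left, top right and bottom right corner are run one after the other. -/
def CornerCutting (A : Finset ManhattanPlane) (B : Set ManhattanPlane) : Prop :=
  ∃ (A₁ A₂ A₃ A₄ : Finset ManhattanPlane) (P₁ P₂ P₃ : Set ManhattanPlane),
    CornerRun (fun y y' => y < y') A (boundingRect A) (mkPoint (xMin A) (yMin A)) A₁ P₁ ∧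
    CornerRun (fun y y' => y' < y) A₁ P₁ (mkPoint (xMin A) (yMax A)) A₂ P₂ ∧
    CornerRun (fun y y' => y' < y) A₂ P₂ (mkPoint (xMax A) (yMax A)) A₃ P₃ ∧
    CornerRun (fun y y' => y < y') A₃ P₃ (mkPoint (xMax A) (yMin A)) A₄ B

/-! In the Manhattan plane, m lies metrically between a and b exactly when this holds in each
coordinate (`btw_plane`). Therefore the center m_a, defined through one minimizing pair, lies
between a and every other point of X (`IsCenterIn.mbtw`), hence also between a and every center m_b.
This gives d(a,b) = d(a,m_a) + d(m_a,m_b) + d(m_b,b) for a ≠ b (`dist_eq_add_centerOf`): the pendant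
length of a is d(a,m_a), and m(X) is an isometric copy of t(X). If a ↦ m_a is injective, m(X) is
trim; otherwise the cardinality drops. So the sequence reaches a trim set.

A function in T(X) either falls below the pendant length at some a, and then it comes from a point
of [a,m_a], or it stays above all pendant lengths and descends to T(m(X)). Attaching the segments
[a,m_a] thus turns a planar model of T(m(X)) into one of T(X) (`SpanModel.union_pendantEdges`), and
iteration attaches the cylinder. The model lies in the bounding box of m^N(X), which the cylinder
meets only in m^N(X) (`inter_centerCylinder`).

Any minimal convex set B over a finite set A is a model of T(A) (`IsMinimalConvex.spanModel`).
Finitely many pairwise compatible balls centered in B have a common point in B (`exists_mem_balls`),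
which yields a nonexpansive map from T(A) into B that sends f to a point at distance at most f(a)
from each a. As functions in T(A) are minimal, equality holds and the map is isometric. Its image is
compact, contains A and is convex by Menger's theorem, so it is all of B.

The output of the corner-cutting algorithm is the orthogonal hull of the enlarged point set: all
four closed quadrants at a point must meet that set. Such a hull is convex unless the set splits
into two diagonally separated parts, and the procedures at the left corners exclude both kinds of
splitting. Conversely, a convex set that contains A and avoids the removed boxes contains each added
point, because a geodesic from d to b has to turn there; hence it contains the hull.

For the tree criterion, a singleton m^N(X) satisfies the four-point condition, which lifts to X and
then to the model of T(X); geodesic spaces with this condition are trees. Conversely, in a tree a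
point between b and c lies between o and b or between o and c. In a trim set with several points, a
point farthest from o violates this. -/

/-! ## Betweenness -/

/-- `m` lies metrically between `a` and `b`. -/
def MBtw {α : Type*} [MetricSpace α] (a m b : α) : Prop := dist a m + dist m b = dist a b

section Between
variable {α : Type*} [MetricSpace α]

theorem MBtw.symm {a m b : α} (h : MBtw a m b) : MBtw b m a := by
  unfold MBtw at *
  rw [dist_comm b m, dist_comm m a, dist_comm b a, ← h, add_comm]

theorem btw_left (a b : α) : MBtw a a b := by simp [MBtw]

theorem btw_right (a b : α) : MBtw a b b := by simp [MBtw]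

theorem btw_of_le {a m b : α} (h : dist a m + dist m b ≤ dist a b) : MBtw a m b :=
  le_antisymm h (dist_triangle _ _ _)

/-- If `m` is between `a` and `b`, and `p` between `a` and `m`, then `p` is between `a` and `b`. -/
theorem MBtw.trans_left {a m b p : α} (h : MBtw a m b) (hp : MBtw a p m) : MBtw a p b := by
  refine btw_of_le ?_
  unfold MBtw at *
  have := dist_triangle p m b
  linarith

theorem MBtw.trans_right {a m b p : α} (h : MBtw a m b) (hp : MBtw a p m) : MBtw p m b := by
  refine btw_of_le ?_
  unfold MBtw at *
  have := dist_triangle a p b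
  linarith

theorem MBtw.eq_of_swap {a m p : α} (h : MBtw a m p) (hp : MBtw a p m) : p = m := by
  unfold MBtw at *
  have := dist_comm m p
  have : dist p m = 0 := by linarith [dist_nonneg (x := p) (y := m)]
  exact dist_eq_zero.1 this

end Between

/-! ## Geodesics -/

section Geodesic
variable {α : Type*} [MetricSpace α]

theorem IsGeodesic.dist_left {γ : ℝ → α} {x y : α} (h : IsGeodesic γ x y) {t : ℝ}
    (ht : t ∈ Set.Icc 0 (dist x y)) : dist x (γ t) = t := by
  have := h.2.2 0 ⟨le_rfl, dist_nonneg⟩ t ht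
  rw [h.1] at this
  rw [this, zero_sub, abs_neg, abs_of_nonneg ht.1]

theorem IsGeodesic.dist_right {γ : ℝ → α} {x y : α} (h : IsGeodesic γ x y) {t : ℝ}
    (ht : t ∈ Set.Icc 0 (dist x y)) : dist (γ t) y = dist x y - t := by
  have := h.2.2 t ht (dist x y) ⟨dist_nonneg, le_rfl⟩
  rw [h.2.1] at this
  rw [this, abs_sub_comm, abs_of_nonneg (by linarith [ht.2])]

theorem IsGeodesic.btw {γ : ℝ → α} {x y : α} (h : IsGeodesic γ x y) {t : ℝ}
    (ht : t ∈ Set.Icc 0 (dist x y)) : MBtw x (γ t) y := by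
  unfold MBtw
  rw [h.dist_left ht, h.dist_right ht]
  ring

theorem IsGeodesic.continuousOn {γ : ℝ → α} {x y : α} (h : IsGeodesic γ x y) :
    ContinuousOn γ (Set.Icc 0 (dist x y)) := by
  have : LipschitzOnWith 1 γ (Set.Icc 0 (dist x y)) :=
    LipschitzOnWith.of_dist_le_mul fun s hs t ht => by
      rw [h.2.2 s hs t ht, Real.dist_eq]
      simp
  exact this.continuousOn

theorem IsGeodesic.injOn {γ : ℝ → α} {x y : α} (h : IsGeodesic γ x y) :
    Set.InjOn γ (Set.Icc 0 (dist x y)) := fun s hs t ht e => by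
  rw [← h.dist_left hs, ← h.dist_left ht, e]

/-- `x` and `y` are joined by a geodesic inside `S`. -/
def GeodJoined (S : Set α) (x y : α) : Prop :=
  ∃ γ : ℝ → α, IsGeodesic γ x y ∧ ∀ t ∈ Set.Icc 0 (dist x y), γ t ∈ S

theorem GeodJoined.mono {S T : Set α} (hST : S ⊆ T) {x y : α} (h : GeodJoined S x y) :
    GeodJoined T x y :=
  let ⟨γ, hγ, hS⟩ := h
  ⟨γ, hγ, fun t ht => hST (hS t ht)⟩

theorem GeodJoined.symm {S : Set α} {x y : α} (h : GeodJoined S x y) : GeodJoined S y x := by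
  obtain ⟨γ, hγ, hS⟩ := h
  have key : ∀ t ∈ Set.Icc 0 (dist y x), dist y x - t ∈ Set.Icc 0 (dist x y) := fun t ht => by
    rw [dist_comm x y]
    exact ⟨by linarith [ht.2], by linarith [ht.1]⟩
  refine ⟨fun t => γ (dist y x - t), ⟨?_, ?_, fun s hs t ht => ?_⟩, fun t ht => hS _ (key t ht)⟩
  · simp only [sub_zero]
    rw [dist_comm]
    exact hγ.2.1
  · simp only [sub_self]
    exact hγ.1
  · rw [hγ.2.2 _ (key s hs) _ (key t ht), abs_sub_comm]
    congr 1
    ring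

theorem GeodJoined.trans {S : Set α} {x y z : α} (h : GeodJoined S x z) (h' : GeodJoined S z y)
    (hb : MBtw x z y) : GeodJoined S x y := by
  obtain ⟨γ, hγ, hS⟩ := h
  obtain ⟨δ, hδ, hT⟩ := h'
  have hb' : dist x z + dist z y = dist x y := hb
  have h1 : ∀ t ∈ Set.Icc 0 (dist x y), t ≤ dist x z → t ∈ Set.Icc 0 (dist x z) :=
    fun t ht h => ⟨ht.1, h⟩
  have h2 : ∀ t ∈ Set.Icc 0 (dist x y), ¬ t ≤ dist x z → t - dist x z ∈ Set.Icc 0 (dist z y) :=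
    fun t ht h => ⟨by linarith [not_le.1 h], by linarith [ht.2]⟩
  -- The route through `z` bounds this distance from above. It cannot be smaller, since then the
  -- route from `x` to `y` through both points would be shorter than `dist x y`.
  have cross : ∀ s ∈ Set.Icc 0 (dist x y), ∀ t ∈ Set.Icc 0 (dist x y), s ≤ dist x z →
      ¬ t ≤ dist x z → dist (γ s) (δ (t - dist x z)) = |s - t| := by
    intro s hs t ht hs' ht'
    have e1 := hγ.dist_left (h1 s hs hs')
    have e2 := hγ.dist_right (h1 s hs hs')
    have e3 := hδ.dist_left (h2 t ht ht')
    have e4 := hδ.dist_right (h2 t ht ht')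
    have t1 := dist_triangle (γ s) z (δ (t - dist x z))
    have t2 := dist_triangle4 x (γ s) (δ (t - dist x z)) y
    rw [abs_sub_comm, abs_of_nonneg (by linarith [not_le.1 ht'])]
    linarith
  refine ⟨fun t => if t ≤ dist x z then γ t else δ (t - dist x z), ⟨?_, ?_, ?_⟩, ?_⟩
  · simp only [dist_nonneg, if_true]
    exact hγ.1
  · by_cases hc : dist x y ≤ dist x z
    · have : dist z y = 0 := by linarith [dist_nonneg (x := z) (y := y)]
      have e : dist x y = dist x z := by linarith
      simp only [hc, if_true]
      rw [e, hγ.2.1]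
      exact dist_eq_zero.1 this
    · simp only [hc, if_false]
      rw [← hb', add_sub_cancel_left]
      exact hδ.2.1
  · intro s hs t ht
    by_cases hs' : s ≤ dist x z <;> by_cases ht' : t ≤ dist x z <;> simp only [hs', ht', if_true, if_false]
    · exact hγ.2.2 s (h1 s hs hs') t (h1 t ht ht')
    · exact cross s hs t ht hs' ht'
    · rw [dist_comm, cross t ht s hs ht' hs', abs_sub_comm]
    · rw [hδ.2.2 _ (h2 s hs hs') _ (h2 t ht ht')]
      congr 1
      ring
  · intro t ht
    by_cases ht' : t ≤ dist x z <;> simp only [ht', if_true, if_false]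
    · exact hS t (h1 t ht ht')
    · exact hT _ (h2 t ht ht')

/-- A geodesically convex set contains, between two of its points, points at which a continuous
function takes any given intermediate value. -/
theorem GeodesicallyConvex.exists_eq {B : Set α} (hB : GeodesicallyConvex B) {g : α → ℝ}
    (hg : Continuous g) {x y : α} (hx : x ∈ B) (hy : y ∈ B) {s : ℝ} (h1 : g x ≤ s) (h2 : s ≤ g y) :
    ∃ z ∈ B, MBtw x z y ∧ g z = s := by
  obtain ⟨γ, hγ, hS⟩ := hB x hx y hy
  have hc : ContinuousOn (fun t => g (γ t)) (Set.Icc 0 (dist x y)) :=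
    hg.comp_continuousOn hγ.continuousOn
  have := intermediate_value_Icc (dist_nonneg (x := x) (y := y)) hc
  have hs : s ∈ Set.Icc (g (γ 0)) (g (γ (dist x y))) := by
    rw [hγ.1, hγ.2.1]
    exact ⟨h1, h2⟩
  obtain ⟨t, ht, e⟩ := this hs
  exact ⟨γ t, hS t ht, hγ.btw ht, e⟩

/-- Menger's theorem: a compact set that contains a point strictly between any two of its points is
geodesically convex. -/
theorem GeodesicallyConvex.of_menger {B : Set α} (hB : IsCompact B)
    (h : ∀ p ∈ B, ∀ q ∈ B, p ≠ q → ∃ z ∈ B, z ≠ p ∧ z ≠ q ∧ MBtw p z q) :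
    GeodesicallyConvex B := by
  intro p hp q hq
  -- Members of `F` are the subsets of `B` on which the distance to `p` is an isometric coordinate.
  -- A maximal one containing `p` and `q` will be the image of the geodesic.
  let F : Set (Set α) := {M | M ⊆ B ∧ ∀ s ∈ M, ∀ t ∈ M, dist s t = |dist p s - dist p t|}
  have hF0 : ({p, q} : Set α) ∈ F := by
    refine ⟨by rintro _ (rfl | rfl) <;> assumption, ?_⟩
    rintro _ (rfl | rfl) _ (rfl | rfl) <;> simp [dist_comm]
  obtain ⟨M, hpqM, hM⟩ := zorn_subset_nonempty F (fun c hc hchain hne => by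
    refine ⟨⋃₀ c, ⟨Set.sUnion_subset fun M hM => (hc hM).1, ?_⟩,
      fun M hM => Set.subset_sUnion_of_mem hM⟩
    rintro s ⟨M, hM, hs⟩ t ⟨M', hM', ht⟩
    rcases hchain.total hM hM' with h | h
    · exact (hc hM').2 s (h hs) t ht
    · exact (hc hM).2 s hs t (h ht)) {p, q} hF0
  have hpM : p ∈ M := hpqM (by simp)
  have hqM : q ∈ M := hpqM (by simp)
  have hMF : M ∈ F := hM.prop
  have hclosed : IsClosed M := by
    have hcl : closure M ∈ F := by
      refine ⟨closure_minimal hMF.1 hB.isClosed, ?_⟩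
      have hset : IsClosed {z : α × α | dist z.1 z.2 = |dist p z.1 - dist p z.2|} :=
        isClosed_eq (by fun_prop) (by fun_prop)
      have hsub : closure (M ×ˢ M) ⊆ {z : α × α | dist z.1 z.2 = |dist p z.1 - dist p z.2|} :=
        closure_minimal (fun z hz => hMF.2 _ hz.1 _ hz.2) hset
      intro s hs t ht
      have : (s, t) ∈ closure (M ×ˢ M) := by
        rw [closure_prod_eq]
        exact ⟨hs, ht⟩
      exact hsub this
    have : closure M = M := (hM.eq_of_subset hcl subset_closure).symm
    rw [← this]
    exact isClosed_closure
  have hMc : IsCompact M := hB.of_isClosed_subset hclosed hMF.1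
  have hcont : Continuous fun z => dist p z := by fun_prop
  have hT : IsCompact ((fun z => dist p z) '' M) := hMc.image hcont
  have hall : ∀ t ∈ Set.Icc 0 (dist p q), ∃ z ∈ M, dist p z = t := by
    intro t0 ht0
    by_contra hno
    push Not at hno
    -- If the value `t0` is missed, `s` and `u` are the ends of the gap around it, attained because
    -- `M` is compact. A point strictly between `zs` and `zu` could be added to `M`, against
    -- maximality.
    obtain ⟨s, ⟨⟨zs, hzs, hse⟩, hs0⟩, hsmax⟩ :=
      (hT.inter_right (isClosed_Iic (a := t0))).exists_isGreatest ⟨0, ⟨p, hpM, dist_self p⟩, ht0.1⟩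
    obtain ⟨u, ⟨⟨zu, hzu, hue⟩, hu0⟩, humin⟩ :=
      (hT.inter_right (isClosed_Ici (a := t0))).exists_isLeast ⟨_, ⟨q, hqM, rfl⟩, ht0.2⟩
    simp only at hse hue
    have hst : s < t0 := lt_of_le_of_ne hs0 fun e => hno zs hzs (hse.trans e)
    have htu : t0 < u := lt_of_le_of_ne hu0 fun e => hno zu hzu (hue.trans e.symm)
    have hne : zs ≠ zu := by
      rintro rfl
      linarith
    obtain ⟨z, hzB, hz1, hz2, hz⟩ := h zs (hMF.1 hzs) zu (hMF.1 hzu) hne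
    have hsu := hMF.2 zs hzs zu hzu
    rw [hse, hue, abs_sub_comm, abs_of_pos (by linarith)] at hsu
    have hz' : dist zs z + dist z zu = dist zs zu := hz
    have d1 : 0 < dist zs z := dist_pos.2 (Ne.symm hz1)
    have d2 : 0 < dist z zu := dist_pos.2 hz2
    have hpz : dist p z = s + dist zs z := by
      have := dist_triangle p zs z
      have := dist_triangle p z zu
      linarith
    have hmz : ∀ m ∈ M, dist m z = |dist p m - dist p z| := by
      intro m hm
      have e1 := hMF.2 m hm zs hzs
      have e2 := hMF.2 m hm zu hzu
      rw [hse] at e1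
      rw [hue] at e2
      have t1 := dist_triangle m zs z
      have t2 := dist_triangle m z zu
      have t3 := dist_triangle m zu z
      have t4 := dist_triangle m z zs
      rw [dist_comm zu z] at t3
      rw [dist_comm z zs] at t4
      rcases le_total (dist p m) t0 with hc | hc
      · have hms : dist p m ≤ s := hsmax ⟨⟨m, hm, rfl⟩, hc⟩
        rw [abs_of_nonpos (by linarith)] at e1 e2 ⊢
        linarith
      · have hmu : u ≤ dist p m := humin ⟨⟨m, hm, rfl⟩, hc⟩
        rw [abs_of_nonneg (by linarith)] at e1 e2 ⊢
        linarith
    have hins : insert z M ∈ F := by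
      refine ⟨Set.insert_subset hzB hMF.1, ?_⟩
      rintro a (rfl | ha) b (rfl | hb)
      · simp
      · rw [dist_comm, hmz b hb, abs_sub_comm]
      · exact hmz a ha
      · exact hMF.2 a ha b hb
    have heq := hM.eq_of_subset hins (Set.subset_insert z M)
    have hzM : z ∈ M := by
      rw [heq]
      exact Set.mem_insert z M
    rcases le_total (dist p z) t0 with hc | hc
    · have := hsmax ⟨⟨z, hzM, rfl⟩, hc⟩
      linarith
    · have := humin ⟨⟨z, hzM, rfl⟩, hc⟩
      linarith
  have : Nonempty α := ⟨p⟩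
  choose! γ hγM hγd using hall
  refine ⟨γ, ⟨?_, ?_, fun s hs t ht => ?_⟩, fun t ht => hMF.1 (hγM t ht)⟩
  · exact (dist_eq_zero.1 (hγd 0 ⟨le_rfl, dist_nonneg⟩)).symm
  · have hm : dist p q ∈ Set.Icc 0 (dist p q) := ⟨dist_nonneg, le_rfl⟩
    have := hMF.2 _ (hγM _ hm) q hqM
    rw [hγd _ hm, sub_self, abs_zero] at this
    exact dist_eq_zero.1 this
  · rw [hMF.2 _ (hγM s hs) _ (hγM t ht), hγd s hs, hγd t ht]

end Geodesic

/-! ## The Manhattan plane -/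

theorem plane_dist (p q : ManhattanPlane) : dist p q = |p.fst - q.fst| + |p.snd - q.snd| := by
  rw [WithLp.prod_dist_eq_of_L1, Real.dist_eq, Real.dist_eq]

theorem plane_ext {p q : ManhattanPlane} (h : p.fst = q.fst) (h' : p.snd = q.snd) : p = q := by
  apply dist_eq_zero.1
  rw [plane_dist, h, h']
  simp

@[simp] theorem mkPoint_fst (x y : ℝ) : (mkPoint x y).fst = x := rfl
@[simp] theorem mkPoint_snd (x y : ℝ) : (mkPoint x y).snd = y := rfl

theorem continuous_plane_fst : Continuous fun p : ManhattanPlane => p.fst :=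
  WithLp.continuous_fst 1 ℝ ℝ

theorem continuous_plane_snd : Continuous fun p : ManhattanPlane => p.snd :=
  WithLp.continuous_snd 1 ℝ ℝ

/-- `m` lies between the real numbers `a` and `b`. -/
def Mid (a m b : ℝ) : Prop := (a ≤ m ∧ m ≤ b) ∨ (b ≤ m ∧ m ≤ a)

theorem mid_iff_abs {a m b : ℝ} : Mid a m b ↔ |a - m| + |m - b| = |a - b| := by
  constructor
  · rintro (⟨h, h'⟩ | ⟨h, h'⟩)
    · rw [abs_of_nonpos, abs_of_nonpos, abs_of_nonpos] <;> linarith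
    · rw [abs_of_nonneg, abs_of_nonneg, abs_of_nonneg] <;> linarith
  · intro h
    unfold Mid
    rcases le_total a m with h1 | h1 <;> rcases le_total m b with h2 | h2
    · exact Or.inl ⟨h1, h2⟩
    · rw [abs_of_nonpos (by linarith : a - m ≤ 0), abs_of_nonneg (by linarith : 0 ≤ m - b)] at h
      rcases le_total a b with h3 | h3
      · rw [abs_of_nonpos (by linarith : a - b ≤ 0)] at h
        left; constructor <;> linarith
      · rw [abs_of_nonneg (by linarith : 0 ≤ a - b)] at h
        right; constructor <;> linarith
    · rw [abs_of_nonneg (by linarith : 0 ≤ a - m), abs_of_nonpos (by linarith : m - b ≤ 0)] at h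
      rcases le_total a b with h3 | h3
      · rw [abs_of_nonpos (by linarith : a - b ≤ 0)] at h
        left; constructor <;> linarith
      · rw [abs_of_nonneg (by linarith : 0 ≤ a - b)] at h
        right; constructor <;> linarith
    · exact Or.inr ⟨h2, h1⟩

/-- The distance is the sum of the coordinate distances, and equality in the summed triangle
inequality forces equality in both coordinates. -/
theorem btw_plane {a m b : ManhattanPlane} :
    MBtw a m b ↔ Mid a.fst m.fst b.fst ∧ Mid a.snd m.snd b.snd := by
  rw [mid_iff_abs, mid_iff_abs, MBtw, plane_dist, plane_dist, plane_dist]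
  constructor
  · intro h
    have h1 := abs_sub_le a.fst m.fst b.fst
    have h2 := abs_sub_le a.snd m.snd b.snd
    constructor <;> linarith
  · rintro ⟨h1, h2⟩
    linarith

/-- Betweenness in the second coordinate keeps a geodesic with both ends on one row inside that row.
-/
theorem GeodesicallyConvex.mem_of_row {B : Set ManhattanPlane} (hB : GeodesicallyConvex B)
    {x y z : ManhattanPlane} (hx : x ∈ B) (hy : y ∈ B) (h1 : x.snd = z.snd) (h2 : y.snd = z.snd)
    (h3 : x.fst ≤ z.fst) (h4 : z.fst ≤ y.fst) : z ∈ B := by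
  obtain ⟨w, hw, hb, e⟩ := hB.exists_eq continuous_plane_fst hx hy h3 h4
  have : w = z := plane_ext e (by
    rcases (btw_plane.1 hb).2 with h | h <;> linarith [h.1, h.2])
  exact this ▸ hw

theorem segment_eq_lineMap {a b p : ManhattanPlane} (hp : p ∈ segment ℝ a b) :
    ∃ t ∈ Set.Icc (0 : ℝ) 1, p.fst = a.fst + t * (b.fst - a.fst) ∧
      p.snd = a.snd + t * (b.snd - a.snd) := by
  rw [segment_eq_image_lineMap] at hp
  obtain ⟨t, ht, rfl⟩ := hp
  refine ⟨t, ht, ?_, ?_⟩ <;> simp [AffineMap.lineMap_apply] <;> ring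

theorem mem_segment_mk {a b : ManhattanPlane} {t : ℝ} (ht : t ∈ Set.Icc (0 : ℝ) 1) :
    mkPoint (a.fst + t * (b.fst - a.fst)) (a.snd + t * (b.snd - a.snd)) ∈ segment ℝ a b := by
  rw [segment_eq_image_lineMap]
  refine ⟨t, ht, plane_ext ?_ ?_⟩ <;> simp [AffineMap.lineMap_apply] <;> ring

theorem mid_lineMap {a b s t : ℝ} (hs : 0 ≤ s) (hst : s ≤ t) :
    Mid a (a + s * (b - a)) (a + t * (b - a)) := by
  rcases le_total a b with h | h
  · left; constructor <;> nlinarith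
  · right; constructor <;> nlinarith

theorem btw_of_mem_segment {a b p : ManhattanPlane} (hp : p ∈ segment ℝ a b) : MBtw a p b := by
  obtain ⟨t, ht, h1, h2⟩ := segment_eq_lineMap hp
  rw [btw_plane, h1, h2]
  constructor
  · simpa using mid_lineMap (a := a.fst) (b := b.fst) ht.1 ht.2
  · simpa using mid_lineMap (a := a.snd) (b := b.snd) ht.1 ht.2

theorem btw_or_of_mem_segment {a b p q : ManhattanPlane} (hp : p ∈ segment ℝ a b)
    (hq : q ∈ segment ℝ a b) : MBtw a p q ∨ MBtw a q p := by
  obtain ⟨s, hs, h1, h2⟩ := segment_eq_lineMap hp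
  obtain ⟨t, ht, h3, h4⟩ := segment_eq_lineMap hq
  rw [btw_plane, btw_plane, h1, h2, h3, h4]
  rcases le_total s t with h | h
  · exact Or.inl ⟨mid_lineMap hs.1 h, mid_lineMap hs.1 h⟩
  · exact Or.inr ⟨mid_lineMap ht.1 h, mid_lineMap ht.1 h⟩

/-- Straight segments are geodesics. -/
theorem geodJoined_segment (a b : ManhattanPlane) : GeodJoined (segment ℝ a b) a b := by
  rcases eq_or_ne a b with rfl | hab
  · refine ⟨fun _ => a, ⟨rfl, rfl, fun s hs t ht => ?_⟩, fun _ _ => left_mem_segment ℝ _ _⟩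
    rw [dist_self, Set.Icc_self] at hs ht
    rw [hs, ht]
    simp
  · have hD : 0 < dist a b := dist_pos.2 hab
    have hmem : ∀ t ∈ Set.Icc 0 (dist a b), t / dist a b ∈ Set.Icc (0 : ℝ) 1 := fun t ht =>
      ⟨div_nonneg ht.1 hD.le, (div_le_one hD).2 ht.2⟩
    refine ⟨fun t => mkPoint (a.fst + t / dist a b * (b.fst - a.fst))
      (a.snd + t / dist a b * (b.snd - a.snd)), ⟨?_, ?_, ?_⟩, fun t ht => mem_segment_mk (hmem t ht)⟩
    · exact plane_ext (by simp) (by simp)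
    · exact plane_ext (by simp [hD.ne']) (by simp [hD.ne'])
    · intro s _ t _
      rw [plane_dist]
      simp only [mkPoint_fst, mkPoint_snd]
      have e1 : a.fst + s / dist a b * (b.fst - a.fst) - (a.fst + t / dist a b * (b.fst - a.fst)) =
        (s - t) / dist a b * (b.fst - a.fst) := by ring
      have e2 : a.snd + s / dist a b * (b.snd - a.snd) - (a.snd + t / dist a b * (b.snd - a.snd)) =
        (s - t) / dist a b * (b.snd - a.snd) := by ring
      rw [e1, e2, abs_mul, abs_mul, ← mul_add, abs_sub_comm b.fst, abs_sub_comm b.snd,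
        ← plane_dist, abs_div, abs_of_pos hD, div_mul_cancel₀ _ hD.ne']

/-- A point at given distance from `a` on the segment from `a` to `b`. -/
theorem exists_mem_segment_dist {a b : ManhattanPlane} {r : ℝ} (h0 : 0 ≤ r) (h1 : r ≤ dist a b) :
    ∃ p ∈ segment ℝ a b, dist a p = r := by
  obtain ⟨γ, hγ, hS⟩ := geodJoined_segment a b
  exact ⟨γ r, hS r ⟨h0, h1⟩, hγ.dist_left ⟨h0, h1⟩⟩

/-- `p` lies in the smallest axis-parallel rectangle that contains `S`. -/
def InBox (S : Set ManhattanPlane) (p : ManhattanPlane) : Prop :=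
  (∃ l ∈ S, l.fst ≤ p.fst) ∧ (∃ r ∈ S, p.fst ≤ r.fst) ∧
    (∃ l ∈ S, l.snd ≤ p.snd) ∧ ∃ r ∈ S, p.snd ≤ r.snd

theorem InBox.of_mem {S : Set ManhattanPlane} {p : ManhattanPlane} (h : p ∈ S) : InBox S p :=
  ⟨⟨p, h, le_rfl⟩, ⟨p, h, le_rfl⟩, ⟨p, h, le_rfl⟩, ⟨p, h, le_rfl⟩⟩

theorem InBox.trans {S T : Set ManhattanPlane} (hST : ∀ p ∈ S, InBox T p) {p : ManhattanPlane}
    (h : InBox S p) : InBox T p := by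
  obtain ⟨⟨a, ha, ha'⟩, ⟨b, hb, hb'⟩, ⟨c, hc, hc'⟩, ⟨d, hd, hd'⟩⟩ := h
  obtain ⟨⟨e, he, he'⟩, -⟩ := hST a ha
  obtain ⟨-, ⟨f, hf, hf'⟩, -⟩ := hST b hb
  obtain ⟨-, -, ⟨g, hg, hg'⟩, -⟩ := hST c hc
  obtain ⟨-, -, -, ⟨i, hi, hi'⟩⟩ := hST d hd
  exact ⟨⟨e, he, he'.trans ha'⟩, ⟨f, hf, hb'.trans hf'⟩, ⟨g, hg, hg'.trans hc'⟩,
    ⟨i, hi, hd'.trans hi'⟩⟩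

theorem InBox.of_btw {S : Set ManhattanPlane} {a b p : ManhattanPlane} (ha : InBox S a)
    (hb : InBox S b) (h : MBtw a p b) : InBox S p := by
  have : InBox {a, b} p := by
    obtain ⟨h1, h2⟩ := btw_plane.1 h
    rcases h1 with h1 | h1 <;> rcases h2 with h2 | h2 <;> simp [InBox, h1, h2]
  refine this.trans ?_
  rintro _ (rfl | rfl) <;> assumption

/-- For fixed `a` and `m`, the solutions of `Mid a m p` form a half-line starting at `m`, or the
whole line if `m = a`; in every case an order-convex set. -/
theorem Mid.of_mid {a m l r p : ℝ} (h : Mid a m l) (h' : Mid a m r) (h1 : l ≤ p) (h2 : p ≤ r) :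
    Mid a m p := by
  unfold Mid at *
  grind

/-- If `m` is between `a` and every point of `S`, then `m` is between `a` and every point of the
bounding box of `S`. -/
theorem MBtw.of_inBox {S : Set ManhattanPlane} {a m p : ManhattanPlane} (h : ∀ b ∈ S, MBtw a m b)
    (hp : InBox S p) : MBtw a m p := by
  obtain ⟨⟨b, hb, hb'⟩, ⟨c, hc, hc'⟩, ⟨d, hd, hd'⟩, ⟨e, he, he'⟩⟩ := hp
  exact btw_plane.2 ⟨(btw_plane.1 (h b hb)).1.of_mid (btw_plane.1 (h c hc)).1 hb' hc',
    (btw_plane.1 (h d hd)).2.of_mid (btw_plane.1 (h e he)).2 hd' he'⟩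

/-! ## Metric centers -/

/-- The median `m` is one of `a`, `b`, `c`. If it is `b` or `c`, the triangle inequality suffices.
If it is `a`, then `b` and `c` lie on different sides of `a`, and the one on the side away from `x`
has Gromov product 0 with `x`. -/
theorem abs_gromov_le_or {a b c m : ℝ} (h1 : Mid a m b) (h2 : Mid a m c) (h3 : Mid b m c)
    (x : ℝ) : |a - b| + |a - x| - |b - x| ≤ 2 * |a - m| ∨
      |a - c| + |a - x| - |c - x| ≤ 2 * |a - m| := by
  rw [mid_iff_abs] at h1 h2 h3
  by_cases hb : m = b
  · left
    subst hb
    have := abs_sub_le a m x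
    have := abs_sub_le m a x
    rw [abs_sub_comm m a] at this
    linarith
  by_cases hc : m = c
  · right
    subst hc
    have := abs_sub_le a m x
    have := abs_sub_le m a x
    rw [abs_sub_comm m a] at this
    linarith
  rw [← mid_iff_abs] at h1 h2 h3
  unfold Mid at h1 h2 h3
  have hma : m = a := by grind
  subst hma
  rw [sub_self, abs_zero, mul_zero]
  rcases le_total x m with h | h <;> rcases h3 with h3 | h3
  · right
    rw [abs_of_nonpos (by linarith : m - c ≤ 0), abs_of_nonneg (by linarith : 0 ≤ m - x),
      abs_of_nonneg (by linarith : 0 ≤ c - x)]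
    linarith
  · left
    rw [abs_of_nonpos (by linarith : m - b ≤ 0), abs_of_nonneg (by linarith : 0 ≤ m - x),
      abs_of_nonneg (by linarith : 0 ≤ b - x)]
    linarith
  · left
    rw [abs_of_nonneg (by linarith : 0 ≤ m - b), abs_of_nonpos (by linarith : m - x ≤ 0),
      abs_of_nonpos (by linarith : b - x ≤ 0)]
    linarith
  · right
    rw [abs_of_nonneg (by linarith : 0 ≤ m - c), abs_of_nonpos (by linarith : m - x ≤ 0),
      abs_of_nonpos (by linarith : c - x ≤ 0)]
    linarith

/-- Seen from `a`, the point `b` is at or beyond `m` while `x` is not, so the paths to `b` and `x`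
separate before `m`. -/
theorem abs_gromov_lt {a b m x : ℝ} (h1 : Mid a m b) (h2 : ¬ Mid a m x) :
    |a - b| + |a - x| - |b - x| < 2 * |a - m| := by
  unfold Mid at *
  push Not at h2
  rcases h1 with h1 | h1
  · have hx : x < m := h2.1 h1.1
    rw [abs_of_nonpos (by linarith : a - b ≤ 0), abs_of_nonneg (by linarith : 0 ≤ b - x),
      abs_of_nonpos (by linarith : a - m ≤ 0)]
    have := le_abs_self (a - x)
    rcases le_total a x with h | h
    · rw [abs_of_nonpos (by linarith : a - x ≤ 0)]
      linarith
    · rw [abs_of_nonneg (by linarith : 0 ≤ a - x)]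
      have : a ≠ m := fun e => by linarith [h2.2 (by linarith)]
      have : a < m := lt_of_le_of_ne h1.1 this
      linarith
  · have hx : m < x := by
      by_contra hc
      linarith [h2.2 (not_lt.1 hc)]
    rw [abs_of_nonneg (by linarith : 0 ≤ a - b), abs_of_nonpos (by linarith : b - x ≤ 0),
      abs_of_nonneg (by linarith : 0 ≤ a - m)]
    rcases le_total a x with h | h
    · rw [abs_of_nonpos (by linarith : a - x ≤ 0)]
      have : a ≠ m := fun e => by linarith [h2.1 (by linarith)]
      have : m < a := lt_of_le_of_ne h1.2 this.symm
      linarith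
    · rw [abs_of_nonneg (by linarith : 0 ≤ a - x)]
      linarith

theorem IsMetricCenter.mbtw {a b c m : ManhattanPlane} (h : IsMetricCenter a b c m) :
    MBtw a m b ∧ MBtw a m c ∧ MBtw b m c := ⟨h.1.symm, h.2.1.symm, h.2.2.symm⟩

theorem IsMetricCenter.dist_eq {a b c m : ManhattanPlane} (h : IsMetricCenter a b c m) :
    dist a m = gromovProduct a b c := by
  obtain ⟨h1, h2, h3⟩ := h
  rw [gromovProduct, h1, h2, h3, dist_comm m b]
  ring

theorem exists_mid (a b c : ℝ) : ∃ m, Mid a m b ∧ Mid a m c ∧ Mid b m c := by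
  -- The median of the three numbers.
  refine ⟨max (min b c) (min a (max b c)), ?_⟩
  unfold Mid
  grind

theorem exists_isMetricCenter (a b c : ManhattanPlane) : ∃ m, IsMetricCenter a b c m := by
  obtain ⟨x, hx1, hx2, hx3⟩ := exists_mid a.fst b.fst c.fst
  obtain ⟨y, hy1, hy2, hy3⟩ := exists_mid a.snd b.snd c.snd
  refine ⟨mkPoint x y, ?_, ?_, ?_⟩
  · exact Eq.symm (btw_plane (m := mkPoint x y) |>.2 ⟨hx1, hy1⟩)
  · exact Eq.symm (btw_plane (m := mkPoint x y) |>.2 ⟨hx2, hy2⟩)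
  · exact Eq.symm (btw_plane (m := mkPoint x y) |>.2 ⟨hx3, hy3⟩)

theorem gromovProduct_plane (a b c : ManhattanPlane) : 2 * gromovProduct a b c =
    (|a.fst - b.fst| + |a.fst - c.fst| - |b.fst - c.fst|) +
      (|a.snd - b.snd| + |a.snd - c.snd| - |b.snd - c.snd|) := by
  rw [gromovProduct, plane_dist, plane_dist, plane_dist]
  ring

/-- If `m` were not between `a` and `x`, this would fail in some coordinate. The contributions of
that coordinate to the products of `x` with `b` and with `c` are then both too small
(`abs_gromov_lt`), and the other coordinate does not compensate for at least one of them
(`abs_gromov_le_or`). So one of the two pairs contradicts the minimality of `b`, `c`. -/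
theorem IsCenterIn.mbtw {X : Finset ManhattanPlane} {a m x : ManhattanPlane}
    (h : IsCenterIn X a m) (hx : x ∈ X) (hxa : x ≠ a) : MBtw a m x := by
  obtain ⟨b, hb, c, hc, hba, hca, -, hmin, hm⟩ := h
  have hdist := hm.dist_eq
  rw [plane_dist] at hdist
  obtain ⟨h1, h2, h3⟩ := hm.mbtw
  have hb' := fun h => hmin b hb x hx hba hxa h
  have hc' := fun h => hmin c hc x hx hca hxa h
  have eb := gromovProduct_plane a b x
  have ec := gromovProduct_plane a c x
  rw [btw_plane] at h1 h2 h3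
  by_contra hno
  have hbx : b ≠ x := by
    rintro rfl
    exact hno (btw_plane.2 h1)
  have hcx : c ≠ x := by
    rintro rfl
    exact hno (btw_plane.2 h2)
  replace hb' := hb' hbx
  replace hc' := hc' hcx
  rw [btw_plane, not_and_or] at hno
  rcases hno with hno | hno
  · have k1 := abs_gromov_lt h1.1 hno
    have k2 := abs_gromov_lt h2.1 hno
    rcases abs_gromov_le_or h1.2 h2.2 h3.2 x.snd with k | k <;> linarith
  · have k1 := abs_gromov_lt h1.2 hno
    have k2 := abs_gromov_lt h2.2 hno
    rcases abs_gromov_le_or h1.1 h2.1 h3.1 x.fst with k | k <;> linarith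

theorem centerOf_pair {X : Finset ManhattanPlane} {a b : ManhattanPlane} (hba : b ≠ a)
    (h : ∀ x, x ∈ X ↔ x = a ∨ x = b) : centerOf X a = midpoint ℝ a b := by
  classical
  have hex : ∃ c, c ≠ a ∧ X = {a, c} :=
    ⟨b, hba, by ext x; simp [h]⟩
  have e : centerOf X a = midpoint ℝ a hex.choose := by
    unfold centerOf
    exact dif_pos hex
  have h1 := hex.choose_spec
  have h2 : hex.choose ∈ X := by
    have := Finset.ext_iff.1 h1.2 hex.choose
    rw [this]
    simp
  rw [e, ((h _).1 h2).resolve_left h1.1]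

theorem centerOf_singleton (a : ManhattanPlane) : centerOf {a} a = a := by
  classical
  unfold centerOf
  rw [dif_neg, dif_neg]
  · rintro ⟨m, b, hb, -, -, hba, -⟩
    exact hba (Finset.mem_singleton.1 hb)
  · rintro ⟨b, hb, h⟩
    have : b ∈ ({a} : Finset ManhattanPlane) := by
      rw [h]
      simp
    exact hb (Finset.mem_singleton.1 this)

theorem exists_isCenterIn {X : Finset ManhattanPlane} (hX : 3 ≤ X.card) {a : ManhattanPlane}
    (ha : a ∈ X) : ∃ m, IsCenterIn X a m := by
  classical
  let T := (X ×ˢ X).filter fun p => p.1 ≠ a ∧ p.2 ≠ a ∧ p.1 ≠ p.2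
  have hT : T.Nonempty := by
    have : 1 < (X.erase a).card := by
      rw [Finset.card_erase_of_mem ha]
      omega
    obtain ⟨b, hb, c, hc, hbc⟩ := Finset.one_lt_card.1 this
    rw [Finset.mem_erase] at hb hc
    exact ⟨(b, c), by simp [T, hb, hc, hbc]⟩
  obtain ⟨⟨b, c⟩, hbc, hmin⟩ := T.exists_min_image (fun p => gromovProduct a p.1 p.2) hT
  simp only [T, Finset.mem_filter, Finset.mem_product] at hbc hmin
  obtain ⟨m, hm⟩ := exists_isMetricCenter a b c
  exact ⟨m, b, hbc.1.1, c, hbc.1.2, hbc.2.1, hbc.2.2.1, hbc.2.2.2,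
    fun u hu v hv hua hva huv => hmin (u, v) ⟨⟨hu, hv⟩, hua, hva, huv⟩, hm⟩

theorem isCenterIn_centerOf {X : Finset ManhattanPlane} (hX : 3 ≤ X.card) {a : ManhattanPlane}
    (ha : a ∈ X) : IsCenterIn X a (centerOf X a) := by
  classical
  have h := exists_isCenterIn hX ha
  have h' : ¬ ∃ b, b ≠ a ∧ X = {a, b} := by
    rintro ⟨b, hb, rfl⟩
    have := Finset.card_le_two (a := a) (b := b)
    omega
  have e : centerOf X a = h.choose := by
    unfold centerOf
    rw [dif_neg, dif_pos h]
    convert h'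
  rw [e]
  exact h.choose_spec

theorem mbtw_midpoint (a b : ManhattanPlane) : MBtw a (midpoint ℝ a b) b :=
  btw_of_mem_segment (midpoint_mem_segment a b)

theorem card_cases {X : Finset ManhattanPlane} {a : ManhattanPlane} (ha : a ∈ X) :
    X = {a} ∨ (∃ b, b ≠ a ∧ ∀ x, x ∈ X ↔ x = a ∨ x = b) ∨ 3 ≤ X.card := by
  classical
  rcases Nat.lt_or_ge 2 X.card with h | h
  · exact Or.inr (Or.inr h)
  · have hpos := Finset.card_pos.2 ⟨a, ha⟩
    rcases Nat.lt_or_ge X.card 2 with h1 | h1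
    · left
      obtain ⟨b, rfl⟩ := Finset.card_eq_one.1 (by omega : X.card = 1)
      rw [Finset.mem_singleton.1 ha]
    · right; left
      obtain ⟨b, c, hbc, rfl⟩ := Finset.card_eq_two.1 (by omega : X.card = 2)
      rw [Finset.mem_insert, Finset.mem_singleton] at ha
      rcases ha with rfl | rfl
      · exact ⟨c, hbc.symm, by simp⟩
      · exact ⟨b, hbc, by simp [or_comm]⟩

theorem centerOf_mbtw {X : Finset ManhattanPlane} {a b : ManhattanPlane} (ha : a ∈ X)
    (hb : b ∈ X) (hba : b ≠ a) : MBtw a (centerOf X a) b := by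
  classical
  rcases card_cases ha with rfl | ⟨c, hc, h⟩ | h
  · exact absurd (Finset.mem_singleton.1 hb) hba
  · obtain rfl := ((h b).1 hb).resolve_left hba
    rw [centerOf_pair hba h]
    exact mbtw_midpoint a b
  · exact (isCenterIn_centerOf h ha).mbtw hb hba

theorem centerOf_mbtw_centerOf {X : Finset ManhattanPlane} {a b : ManhattanPlane} (ha : a ∈ X)
    (hb : b ∈ X) : MBtw a (centerOf X a) (centerOf X b) := by
  classical
  by_cases hba : b = a
  · rw [hba]
    exact btw_right _ _
  rcases card_cases ha with rfl | ⟨c, hc, h⟩ | h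
  · exact absurd (Finset.mem_singleton.1 hb) hba
  · obtain rfl := ((h b).1 hb).resolve_left hba
    rw [centerOf_pair hba h, centerOf_pair (Ne.symm hba) (by simpa [or_comm] using h),
      midpoint_comm]
    exact btw_right _ _
  -- With a third point `c`, the center of `b` lies in the box of `b` and `c`, and the center of `a`
  -- is between `a` and both of these corners.
  · obtain ⟨c, hc, hca, hcb⟩ : ∃ c ∈ X, c ≠ a ∧ c ≠ b := by
      have : 0 < ((X.erase a).erase b).card := by
        rw [Finset.card_erase_of_mem (Finset.mem_erase.2 ⟨hba, hb⟩), Finset.card_erase_of_mem ha]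
        omega
      obtain ⟨c, hc⟩ := Finset.card_pos.1 this
      rw [Finset.mem_erase, Finset.mem_erase] at hc
      exact ⟨c, hc.2.2, hc.2.1, hc.1⟩
    have hbox : InBox {b, c} (centerOf X b) :=
      InBox.of_btw (InBox.of_mem (by simp)) (InBox.of_mem (by simp)) (centerOf_mbtw hb hc hcb)
    refine MBtw.of_inBox ?_ hbox
    rintro _ (rfl | rfl)
    · exact centerOf_mbtw ha hb hba
    · exact centerOf_mbtw ha hc hca

/-- A path from `a` to `b` may be taken through both centers: first use that the center of `b` is
between `b` and `a`, then that the center of `a` is between `a` and the center of `b`. -/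
theorem dist_eq_add_centerOf {X : Finset ManhattanPlane} {a b : ManhattanPlane} (ha : a ∈ X)
    (hb : b ∈ X) (hab : a ≠ b) : dist a b =
      dist a (centerOf X a) + dist (centerOf X a) (centerOf X b) + dist b (centerOf X b) := by
  have h1 : _ = _ := centerOf_mbtw hb ha hab
  have h2 : _ = _ := centerOf_mbtw_centerOf ha hb
  rw [dist_comm b a, dist_comm _ a] at h1
  linarith

theorem exists_gromovProduct_eq {X : Finset ManhattanPlane} (hX : 3 ≤ X.card) {a : ManhattanPlane}
    (ha : a ∈ X) : ∃ b ∈ X, ∃ c ∈ X, b ≠ a ∧ c ≠ a ∧ b ≠ c ∧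
      gromovProduct a b c = dist a (centerOf X a) := by
  obtain ⟨b, hb, c, hc, hba, hca, hbc, -, hm⟩ := isCenterIn_centerOf hX ha
  exact ⟨b, hb, c, hc, hba, hca, hbc, hm.dist_eq.symm⟩

/-- The pendant length is the distance to the metric center. -/
theorem pendant_eq_dist {X : Finset ManhattanPlane} (a : X) :
    pendant a = dist (a : ManhattanPlane) (centerOf X a) := by
  classical
  obtain ⟨a, ha⟩ := a
  rcases card_cases ha with rfl | ⟨c, hc, h⟩ | h
  · rw [centerOf_singleton, dist_self, pendant, if_neg (by simp)]
    have : {r | ∃ y z : ({a} : Finset ManhattanPlane), y ≠ ⟨a, ha⟩ ∧ z ≠ ⟨a, ha⟩ ∧ y ≠ z ∧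
        r = gromovProduct ⟨a, ha⟩ y z} = ∅ := by
      ext r
      simp only [Set.mem_ofPred_eq, Set.mem_empty_iff_false, iff_false]
      rintro ⟨⟨y, hy⟩, -, h, -⟩
      exact h (Subtype.ext (Finset.mem_singleton.1 hy))
    rw [this, Real.sInf_empty]
  · have hcm : c ∈ X := (h c).2 (Or.inr rfl)
    have hcard : X.card = 2 := Finset.card_eq_two.2
      ⟨a, c, hc.symm, by ext x; simp [h]⟩
    rw [centerOf_pair hc h, pendant, if_pos, dist_left_midpoint]
    · have : (⨆ y : X, dist (⟨a, ha⟩ : X) y) = dist a c := by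
        apply le_antisymm
        · have : Nonempty X := ⟨⟨a, ha⟩⟩
          refine ciSup_le ?_
          rintro ⟨y, hy⟩
          rcases (h y).1 hy with rfl | rfl
          · simp
          · exact le_rfl
        · exact le_ciSup (f := fun y => dist (⟨a, ha⟩ : X) y)
            (Set.finite_range _).bddAbove ⟨c, hcm⟩
      rw [this]
      norm_num
      ring
    · rw [Nat.card_eq_fintype_card, Fintype.card_coe, hcard]
  · obtain ⟨b, hb, c, hc, hba, hca, hbc, hmin, hm⟩ := isCenterIn_centerOf h ha
    rw [pendant, if_neg, hm.dist_eq]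
    · refine IsLeast.csInf_eq ⟨⟨⟨b, hb⟩, ⟨c, hc⟩, ?_, ?_, ?_, rfl⟩, ?_⟩
      · exact fun e => hba (congrArg Subtype.val e)
      · exact fun e => hca (congrArg Subtype.val e)
      · exact fun e => hbc (congrArg Subtype.val e)
      · rintro _ ⟨⟨y, hy⟩, ⟨z, hz⟩, h1, h2, h3, rfl⟩
        exact hmin y hy z hz (fun e => h1 (Subtype.ext e)) (fun e => h2 (Subtype.ext e))
          (fun e => h3 (Subtype.ext e))
    · rw [Nat.card_eq_fintype_card, Fintype.card_coe]
      omega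

theorem two_mul_dist_centerOf_le {X : Finset ManhattanPlane} {a b c : ManhattanPlane} (ha : a ∈ X)
    (hb : b ∈ X) (hc : c ∈ X) (hba : b ≠ a) (hca : c ≠ a) (hbc : b ≠ c) :
    2 * dist a (centerOf X a) ≤ dist a b + dist a c - dist b c := by
  have := pendant_le (x := (⟨a, ha⟩ : X)) (y := ⟨b, hb⟩) (z := ⟨c, hc⟩)
    (fun e => hba (congrArg Subtype.val e)) (fun e => hca (congrArg Subtype.val e))
    (fun e => hbc (congrArg Subtype.val e))
  rwa [pendant_eq_dist] at this

theorem isTrim_iff {X : Finset ManhattanPlane} : IsTrim X ↔ ∀ a ∈ X, centerOf X a = a := by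
  constructor
  · intro h a ha
    have := h ⟨a, ha⟩
    rw [pendant_eq_dist] at this
    exact (dist_eq_zero.1 this).symm
  · rintro h ⟨a, ha⟩
    rw [pendant_eq_dist, h a ha, dist_self]

/-! ### The center projection and the stabilization of the center sequence -/

theorem mem_centerSet {X : Finset ManhattanPlane} {p : ManhattanPlane} :
    p ∈ centerSet X ↔ ∃ a ∈ X, centerOf X a = p := by
  classical
  exact Finset.mem_image

theorem centerOf_mem {X : Finset ManhattanPlane} {a : ManhattanPlane} (ha : a ∈ X) :
    centerOf X a ∈ centerSet X := mem_centerSet.2 ⟨a, ha, rfl⟩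

theorem centerSet_eq_self {X : Finset ManhattanPlane} (h : IsTrim X) : centerSet X = X := by
  rw [isTrim_iff] at h
  ext p
  rw [mem_centerSet]
  constructor
  · rintro ⟨a, ha, rfl⟩
    rwa [h a ha]
  · exact fun hp => ⟨p, hp, h p hp⟩

theorem centerSeq_eq_of_le {X : Finset ManhattanPlane} {N : ℕ} (h : IsTrim (centerSeq X N)) {i : ℕ}
    (hi : N ≤ i) : centerSeq X i = centerSeq X N := by
  induction i, hi using Nat.le_induction with
  | base => rfl
  | succ i _ ih =>
    change centerSet (centerSeq X i) = _
    rw [ih, centerSet_eq_self h]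

/-- By `dist_eq_add_centerOf`, passing to the centers lowers each Gromov product at `a` by exactly
the pendant length of `a`. A minimizing pair for `a` survives as two distinct points under
injectivity, and its product becomes 0. Two-point sets do not occur, as both points have the same
midpoint. -/
theorem centerSet_isTrim_of_injOn {X : Finset ManhattanPlane}
    (h : Set.InjOn (centerOf X) (X : Set ManhattanPlane)) : IsTrim (centerSet X) := by
  classical
  rw [isTrim_iff]
  intro p hp
  obtain ⟨a, ha, rfl⟩ := mem_centerSet.1 hp
  rcases card_cases ha with rfl | ⟨c, hc, e⟩ | h3
  · have : centerSet {a} = {a} := by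
      ext p
      simp [mem_centerSet, centerOf_singleton, eq_comm]
    rw [this, centerOf_singleton, centerOf_singleton]
  · exfalso
    refine hc (h (by simp [e]) ha ?_)
    rw [centerOf_pair hc e, centerOf_pair (Ne.symm hc) (by simpa [or_comm] using e),
      midpoint_comm]
  · obtain ⟨b, hb, c, hc, hba, hca, hbc, hg⟩ := exists_gromovProduct_eq h3 ha
    have key := two_mul_dist_centerOf_le (centerOf_mem ha) (centerOf_mem hb) (centerOf_mem hc)
      (h.ne hb ha hba) (h.ne hc ha hca) (h.ne hb hc hbc)
    have e1 := dist_eq_add_centerOf ha hb hba.symm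
    have e2 := dist_eq_add_centerOf ha hc hca.symm
    have e3 := dist_eq_add_centerOf hb hc hbc
    rw [gromovProduct] at hg
    have h0 : dist (centerOf X a) (centerOf (centerSet X) (centerOf X a)) ≤ 0 := by linarith
    exact (dist_le_zero.1 h0).symm

/-- As long as no term is trim, every projection must identify points, so the cardinality decreases
forever. -/
theorem exists_isTrim_centerSeq (X : Finset ManhattanPlane) : ∃ N, IsTrim (centerSeq X N) := by
  classical
  by_contra hno
  push Not at hno
  have key : ∀ n, (centerSeq X n).card + n ≤ X.card := by
    intro n
    induction n with
    | zero => exact le_rfl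
    | succ n ih =>
      have : (centerSeq X (n + 1)).card < (centerSeq X n).card := by
        refine lt_of_le_of_ne Finset.card_image_le fun e => hno (n + 1) ?_
        exact centerSet_isTrim_of_injOn (Finset.card_image_iff.1 e)
      omega
  have := key (X.card + 1)
  omega

theorem centerSeq_nonempty {X : Finset ManhattanPlane} (hX : X.Nonempty) (n : ℕ) :
    (centerSeq X n).Nonempty := by
  induction n with
  | zero => exact hX
  | succ n ih =>
    obtain ⟨a, ha⟩ := ih
    exact ⟨_, centerOf_mem ha⟩

theorem inBox_of_mem_centerSet {X : Finset ManhattanPlane} {p : ManhattanPlane}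
    (hp : p ∈ centerSet X) : InBox X p := by
  obtain ⟨a, ha, rfl⟩ := mem_centerSet.1 hp
  by_cases h : ∃ b ∈ X, b ≠ a
  · obtain ⟨b, hb, hba⟩ := h
    exact InBox.of_btw (InBox.of_mem ha) (InBox.of_mem hb) (centerOf_mbtw ha hb hba)
  · push Not at h
    have : X = {a} := Finset.eq_singleton_iff_unique_mem.2 ⟨ha, h⟩
    subst this
    rw [centerOf_singleton]
    exact InBox.of_mem ha

/-- This passes from the centers to their whole bounding box, where any model of the tight span of
the center set lives. -/
theorem centerOf_mbtw_of_inBox {X : Finset ManhattanPlane} {a p : ManhattanPlane} (ha : a ∈ X)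
    (hp : InBox (centerSet X) p) : MBtw a (centerOf X a) p := by
  refine MBtw.of_inBox (fun b hb => ?_) hp
  obtain ⟨c, hc, rfl⟩ := mem_centerSet.1 (Finset.mem_coe.1 hb)
  exact centerOf_mbtw_centerOf ha hc

theorem centerOf_mbtw_of_mem_segment {X : Finset ManhattanPlane} {a b p : ManhattanPlane}
    (ha : a ∈ X) (hb : b ∈ X) (hba : b ≠ a) (hp : p ∈ segment ℝ b (centerOf X b)) :
    MBtw a (centerOf X a) p := by
  refine MBtw.of_inBox (S := {b, centerOf X b}) ?_ (InBox.of_btw (InBox.of_mem (by simp))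
    (InBox.of_mem (by simp)) (btw_of_mem_segment hp))
  rintro _ (rfl | rfl)
  · exact centerOf_mbtw ha hb hba
  · exact centerOf_mbtw_centerOf ha hb

/-! ## Planar models of tight spans -/

/-- `B` is a geodesically convex planar model of the tight span of `Z`. -/
structure SpanModel (Z : Finset ManhattanPlane) (B : Set ManhattanPlane) : Prop where
  subset : ∀ a ∈ Z, a ∈ B
  inBox : ∀ p ∈ B, InBox Z p
  -- Makes `distTo Z` an isometry on `B`: at this `x` the two distance functions differ by the full
  -- distance of `p` and `q`.
  mbtw : ∀ p ∈ B, ∀ q ∈ B, ∃ x ∈ Z, MBtw x p q ∨ MBtw x q p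
  image : distTo Z '' B = tightSpan Z
  convex : GeodesicallyConvex B

/-- The pendant edges of `Z`. -/
def pendantEdges (Z : Finset ManhattanPlane) : Set ManhattanPlane :=
  ⋃ a ∈ Z, segment ℝ a (centerOf Z a)

theorem mem_pendantEdges {Z : Finset ManhattanPlane} {p : ManhattanPlane} :
    p ∈ pendantEdges Z ↔ ∃ a ∈ Z, p ∈ segment ℝ a (centerOf Z a) := by
  simp [pendantEdges]

theorem mem_tightSpan_distTo {Z : Finset ManhattanPlane} {p : ManhattanPlane}
    (h : ∀ x ∈ Z, ∃ y ∈ Z, MBtw x p y) : distTo Z p ∈ tightSpan Z := by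
  refine ⟨fun x => dist_nonneg, fun x y => ?_, fun ⟨x, hx⟩ => ?_⟩
  · rw [Subtype.dist_eq, distTo, distTo]
    exact dist_triangle_left _ _ _
  obtain ⟨y, hy, hb⟩ := h x hx
  refine ⟨⟨y, hy⟩, ?_⟩
  rw [distTo, distTo, dist_comm p x]
  exact hb

theorem exists_mbtw_of_mem_tightSpan {Z : Finset ManhattanPlane} {p : ManhattanPlane}
    (h : distTo Z p ∈ tightSpan Z) {x : ManhattanPlane} (hx : x ∈ Z) : ∃ y ∈ Z, MBtw x p y := by
  obtain ⟨⟨y, hy⟩, e⟩ := h.2.2 ⟨x, hx⟩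
  refine ⟨y, hy, ?_⟩
  rw [distTo, distTo, dist_comm p x] at e
  exact e

/-- Functions of the tight span that fall short of a pendant length come from a pendant edge. -/
theorem tightSpan_eq_of_lt {Z : Finset ManhattanPlane} {f : Z → ℝ} (hf : f ∈ tightSpan Z)
    {a : ManhattanPlane} (ha : a ∈ Z) (h : f ⟨a, ha⟩ < dist a (centerOf Z a)) :
    ∃ p ∈ segment ℝ a (centerOf Z a), distTo Z p = f := by
  obtain ⟨p, hp, hpd⟩ := exists_mem_segment_dist (hf.1 ⟨a, ha⟩) h.le
  refine ⟨p, hp, funext fun ⟨x, hx⟩ => ?_⟩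
  rw [distTo]
  by_cases hxa : x = a
  · subst hxa
    rw [dist_comm, hpd]
  have hb := centerOf_mbtw ha hx hxa
  have h1 : _ = _ := hb.trans_left (btw_of_mem_segment hp)
  have h0 : dist a (centerOf Z a) ≤ dist a x := by
    have : _ = _ := hb
    linarith [dist_nonneg (x := centerOf Z a) (y := x)]
  have h2 := hf.2.1 ⟨a, ha⟩ ⟨x, hx⟩
  rw [Subtype.dist_eq] at h2
  simp only at h2
  -- The partner of `x` must be `a`: for any other `z`, adding the inequalities for the pairs `a`,
  -- `x` and `a`, `z` shows that `f` at `a` is at least the pendant length.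
  obtain ⟨⟨z, hz⟩, e⟩ := hf.2.2 ⟨x, hx⟩
  rw [Subtype.dist_eq] at e
  simp only at e
  by_cases hza : z = a
  · subst hza
    rw [dist_comm x z] at e
    linarith
  by_cases hzx : x = z
  · subst hzx
    rw [dist_self] at e
    linarith
  have h3 := hf.2.1 ⟨a, ha⟩ ⟨z, hz⟩
  rw [Subtype.dist_eq] at h3
  simp only at h3
  have := two_mul_dist_centerOf_le ha hx hz hxa hza hzx
  linarith

/-- By symmetry in `a` and `b`, the function minus the pendant length is constant on the fibres of
the center projection. Points with the same center have distances to a third point `y` that differ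
only by their pendant lengths, so the partner of `a` also controls the value at `b`. -/
theorem tightSpan_sub_le {Z : Finset ManhattanPlane} {f : Z → ℝ} (hf : f ∈ tightSpan Z)
    (h : ∀ x : Z, dist (x : ManhattanPlane) (centerOf Z x) ≤ f x) {a b : ManhattanPlane}
    (ha : a ∈ Z) (hb : b ∈ Z) (e : centerOf Z a = centerOf Z b) :
    f ⟨a, ha⟩ - dist a (centerOf Z a) ≤ f ⟨b, hb⟩ - dist b (centerOf Z b) := by
  by_cases hab : a = b
  · subst hab
    exact le_rfl
  have h1 := h ⟨a, ha⟩
  have h2 := h ⟨b, hb⟩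
  simp only at h1 h2
  obtain ⟨⟨y, hy⟩, he⟩ := hf.2.2 ⟨a, ha⟩
  rw [Subtype.dist_eq] at he
  simp only at he
  have hd := dist_eq_add_centerOf ha hb hab
  rw [e, dist_self, ← e] at hd
  by_cases hya : y = a
  · subst hya
    rw [dist_self] at he
    have := hf.1 ⟨y, ha⟩
    have := dist_nonneg (x := y) (y := centerOf Z y)
    linarith
  by_cases hyb : y = b
  · subst hyb
    rw [← e] at h2
    rw [e] at *
    linarith
  have h3 := hf.2.1 ⟨b, hb⟩ ⟨y, hy⟩
  rw [Subtype.dist_eq] at h3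
  simp only at h3
  have d1 := dist_eq_add_centerOf ha hy (Ne.symm hya)
  have d2 := dist_eq_add_centerOf hb hy (Ne.symm hyb)
  rw [← e] at d2 ⊢
  linarith

/-- Functions of the tight span with all values above the pendant lengths come from the tight span
of the metric center. -/
theorem exists_tightSpan_centerSet {Z : Finset ManhattanPlane} {f : Z → ℝ} (hf : f ∈ tightSpan Z)
    (h : ∀ x : Z, dist (x : ManhattanPlane) (centerOf Z x) ≤ f x) :
    ∃ g ∈ tightSpan (centerSet Z), ∀ x : Z,
      f x = g ⟨centerOf Z x, centerOf_mem x.2⟩ + dist (x : ManhattanPlane) (centerOf Z x) := by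
  have hex : ∀ p : centerSet Z, ∃ a ∈ Z, centerOf Z a = p := fun p => mem_centerSet.1 p.2
  choose s hs hsp using hex
  -- Independent of the chosen section `s`, by `tightSpan_sub_le`.
  let g : centerSet Z → ℝ := fun p => f ⟨s p, hs p⟩ - dist (s p) (centerOf Z (s p))
  have hg : ∀ x : Z, f x = g ⟨centerOf Z x, centerOf_mem x.2⟩ +
      dist (x : ManhattanPlane) (centerOf Z x) := by
    rintro ⟨x, hx⟩
    have e := hsp ⟨centerOf Z x, centerOf_mem hx⟩
    have h1 := tightSpan_sub_le hf h (hs ⟨centerOf Z x, centerOf_mem hx⟩) hx e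
    have h2 := tightSpan_sub_le hf h hx (hs ⟨centerOf Z x, centerOf_mem hx⟩) e.symm
    simp only [g]
    linarith
  refine ⟨g, ⟨fun p => ?_, ?_, ?_⟩, hg⟩
  · have := h ⟨s p, hs p⟩
    simp only [g]
    simp only at this
    linarith
  · intro p q
    rw [Subtype.dist_eq]
    have hp := h ⟨s p, hs p⟩
    have hq := h ⟨s q, hs q⟩
    simp only [g]
    simp only at hp hq
    by_cases hpq : p = q
    · subst hpq
      rw [dist_self]
      linarith
    · have hne : s p ≠ s q := fun e => hpq (Subtype.ext (by rw [← hsp p, ← hsp q, e]))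
      have := dist_eq_add_centerOf (hs p) (hs q) hne
      have h3 := hf.2.1 ⟨s p, hs p⟩ ⟨s q, hs q⟩
      rw [Subtype.dist_eq] at h3
      simp only at h3
      rw [hsp p, hsp q] at this ⊢
      linarith
  · intro p
    obtain ⟨⟨y, hy⟩, e⟩ := hf.2.2 ⟨s p, hs p⟩
    rw [Subtype.dist_eq] at e
    simp only at e
    refine ⟨⟨centerOf Z y, centerOf_mem hy⟩, ?_⟩
    rw [Subtype.dist_eq]
    have hgp : g p = f ⟨s p, hs p⟩ - dist (s p) (centerOf Z (s p)) := rfl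
    have hgy := hg ⟨y, hy⟩
    simp only at hgy
    have hp := h ⟨s p, hs p⟩
    simp only at hp
    -- A self-partner means `f` vanishes there, so the pendant length vanishes too and `p` is its
    -- own partner for `g`.
    by_cases hyp : y = s p
    · subst hyp
      rw [dist_self] at e
      have e1 : f ⟨s p, hs p⟩ = 0 := by linarith
      have e2 : dist (s p) (centerOf Z (s p)) = 0 :=
        le_antisymm (by linarith) dist_nonneg
      rw [e1, e2] at hgy hgp
      simp only [hsp p, dist_self]
      simp only [hsp p] at hgy
      linarith
    · have := dist_eq_add_centerOf (hs p) hy (Ne.symm hyp)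
      rw [hsp p] at this hgp
      simp only
      linarith

/-- Attaching the pendant edges to a model of the tight span of the metric center gives a model of
the tight span. -/
theorem SpanModel.union_pendantEdges {Z : Finset ManhattanPlane} {B : Set ManhattanPlane}
    (h : SpanModel (centerSet Z) B) : SpanModel Z (B ∪ pendantEdges Z) := by
  have hB : ∀ {a p}, a ∈ Z → p ∈ B → MBtw a (centerOf Z a) p := fun ha hp =>
    centerOf_mbtw_of_inBox ha (h.inBox _ hp)
  have hcB : ∀ {a}, a ∈ Z → centerOf Z a ∈ B := fun ha => h.subset _ (centerOf_mem ha)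
  have hlift : ∀ {a p q}, a ∈ Z → p ∈ B → q ∈ B → MBtw (centerOf Z a) p q → MBtw a p q := by
    intro a p q ha hp hq hb
    have e1 : _ = _ := hB ha hp
    have e2 : _ = _ := hB ha hq
    have e3 : _ = _ := hb
    refine (?_ : _ = _)
    linarith
  have hedge : ∀ {a p q}, a ∈ Z → p ∈ segment ℝ a (centerOf Z a) → q ∈ B → MBtw a p q :=
    fun ha hp hq => (hB ha hq).trans_left (btw_of_mem_segment hp)
  have hedge2 : ∀ {a b p q}, a ∈ Z → b ∈ Z → p ∈ segment ℝ a (centerOf Z a) →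
      q ∈ segment ℝ b (centerOf Z b) → a ≠ b → MBtw a p q := fun ha hb hp hq hab =>
    (centerOf_mbtw_of_mem_segment ha hb hab.symm hq).trans_left (btw_of_mem_segment hp)
  have hjoin : ∀ {a p}, a ∈ Z → p ∈ segment ℝ a (centerOf Z a) →
      GeodJoined (B ∪ pendantEdges Z) p (centerOf Z a) := fun {a p} ha hp =>
    (geodJoined_segment p (centerOf Z a)).mono fun q hq => Or.inr (mem_pendantEdges.2
      ⟨a, ha, (convex_segment a _).segment_subset hp (right_mem_segment ℝ _ _) hq⟩)
  have hjoinB : ∀ {a p q}, a ∈ Z → p ∈ segment ℝ a (centerOf Z a) → q ∈ B →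
      GeodJoined (B ∪ pendantEdges Z) p q := fun {a p q} ha hp hq =>
    (hjoin ha hp).trans (GeodJoined.mono Set.subset_union_left (h.convex _ (hcB ha) _ hq))
      ((hB ha hq).trans_right (btw_of_mem_segment hp))
  have hne : ∀ {a}, a ∈ Z → (∃ b ∈ Z, b ≠ a) ∨ Z = {a} := fun {a} ha => by
    by_cases hb : ∃ b ∈ Z, b ≠ a
    · exact Or.inl hb
    · push Not at hb
      exact Or.inr (Finset.eq_singleton_iff_unique_mem.2 ⟨ha, hb⟩)
  refine ⟨fun a ha => Or.inr (mem_pendantEdges.2 ⟨a, ha, left_mem_segment ℝ _ _⟩), ?_, ?_, ?_, ?_⟩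
  · rintro p (hp | hp)
    · exact (h.inBox p hp).trans fun q hq => inBox_of_mem_centerSet hq
    · obtain ⟨a, ha, hp⟩ := mem_pendantEdges.1 hp
      exact InBox.of_btw (InBox.of_mem ha) (inBox_of_mem_centerSet (centerOf_mem ha))
        (btw_of_mem_segment hp)
  · rintro p (hp | hp) q (hq | hq)
    · obtain ⟨x, hx, hb⟩ := h.mbtw p hp q hq
      obtain ⟨a, ha, rfl⟩ := mem_centerSet.1 hx
      exact ⟨a, ha, hb.imp (hlift ha hp hq) (hlift ha hq hp)⟩
    · obtain ⟨a, ha, hq⟩ := mem_pendantEdges.1 hq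
      exact ⟨a, ha, Or.inr (hedge ha hq hp)⟩
    · obtain ⟨a, ha, hp⟩ := mem_pendantEdges.1 hp
      exact ⟨a, ha, Or.inl (hedge ha hp hq)⟩
    · obtain ⟨a, ha, hp⟩ := mem_pendantEdges.1 hp
      obtain ⟨b, hb, hq⟩ := mem_pendantEdges.1 hq
      by_cases hab : a = b
      · subst hab
        exact ⟨a, ha, btw_or_of_mem_segment hp hq⟩
      · exact ⟨a, ha, Or.inl (hedge2 ha hb hp hq hab)⟩
  · apply Set.Subset.antisymm
    · rintro _ ⟨p, hp | hp, rfl⟩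
      · refine mem_tightSpan_distTo fun x hx => ?_
        have hmem : distTo (centerSet Z) p ∈ tightSpan (centerSet Z) :=
          h.image ▸ Set.mem_image_of_mem _ hp
        obtain ⟨y, hy, hb⟩ := exists_mbtw_of_mem_tightSpan hmem (centerOf_mem hx)
        obtain ⟨y, hyZ, rfl⟩ := mem_centerSet.1 hy
        -- Here the partner found downstairs comes from `x` itself, so `p` is the center of `x`,
        -- which is between `x` and any other point of `Z`.
        by_cases hxy : x = y
        · subst hxy
          have hpx : p = centerOf Z x := by
            have e : _ = _ := hb
            rw [dist_self, dist_comm p] at e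
            exact (dist_eq_zero.1 (by linarith)).symm
          subst hpx
          rcases hne hx with ⟨z, hz, hzx⟩ | rfl
          · exact ⟨z, hz, centerOf_mbtw hx hz hzx⟩
          · exact ⟨x, hx, by rw [centerOf_singleton]; exact btw_left _ _⟩
        · refine ⟨y, hyZ, ?_⟩
          have e0 := dist_eq_add_centerOf hx hyZ hxy
          have e1 : _ = _ := hB hx hp
          have e2 : _ = _ := hB hyZ hp
          have e3 : _ = _ := hb
          refine (?_ : _ = _)
          rw [dist_comm p y]
          rw [dist_comm p] at e3
          linarith
      · obtain ⟨a, ha, hp⟩ := mem_pendantEdges.1 hp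
        refine mem_tightSpan_distTo fun x hx => ?_
        have key : ∀ b ∈ Z, b ≠ a → MBtw a p b := fun b hb hba =>
          (centerOf_mbtw ha hb hba).trans_left (btw_of_mem_segment hp)
        by_cases hxa : x = a
        · subst hxa
          rcases hne hx with ⟨z, hz, hzx⟩ | rfl
          · exact ⟨z, hz, key z hz hzx⟩
          · rw [centerOf_singleton, segment_same] at hp
            rw [Set.mem_singleton_iff.1 hp]
            exact ⟨x, hx, btw_left _ _⟩
        · exact ⟨a, ha, (key x hx hxa).symm⟩
    · intro f hf
      -- Either `f` falls short of a pendant length and lies on a pendant edge, or it descends to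
      -- the tight span of the center set.
      by_cases hlt : ∃ x : Z, f x < dist (x : ManhattanPlane) (centerOf Z x)
      · obtain ⟨⟨a, ha⟩, hlt⟩ := hlt
        obtain ⟨p, hp, e⟩ := tightSpan_eq_of_lt hf ha hlt
        exact ⟨p, Or.inr (mem_pendantEdges.2 ⟨a, ha, hp⟩), e⟩
      · push Not at hlt
        obtain ⟨g, hg, hfg⟩ := exists_tightSpan_centerSet hf hlt
        rw [← h.image] at hg
        obtain ⟨p, hp, rfl⟩ := hg
        refine ⟨p, Or.inl hp, funext fun x => ?_⟩
        have e : _ = _ := hB x.2 hp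
        rw [hfg x, distTo, distTo, dist_comm p x, ← e, dist_comm p, add_comm]
  · rintro p (hp | hp) q (hq | hq)
    · exact GeodJoined.mono Set.subset_union_left (h.convex p hp q hq)
    · obtain ⟨a, ha, hq⟩ := mem_pendantEdges.1 hq
      exact (hjoinB ha hq hp).symm
    · obtain ⟨a, ha, hp⟩ := mem_pendantEdges.1 hp
      exact hjoinB ha hp hq
    · obtain ⟨a, ha, hp'⟩ := mem_pendantEdges.1 hp
      obtain ⟨b, hb, hq'⟩ := mem_pendantEdges.1 hq
      by_cases hab : a = b
      · subst hab
        exact (geodJoined_segment p q).mono fun r hr => Or.inr (mem_pendantEdges.2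
          ⟨a, ha, (convex_segment a _).segment_subset hp' hq' hr⟩)
      · exact (hjoin ha hp').trans (hjoinB hb hq' (hcB ha)).symm
          ((centerOf_mbtw_of_mem_segment ha hb (Ne.symm hab) hq').trans_right
            (btw_of_mem_segment hp'))

/-! ## The cylinder -/

theorem centerCylinder_zero (X : Finset ManhattanPlane) : centerCylinder X 0 = X := by
  ext p
  simp [centerCylinder, centerTraj]

theorem exists_centerTraj_eq {X : Finset ManhattanPlane} {N : ℕ} {a : ManhattanPlane}
    (ha : a ∈ centerSeq X N) : ∃ x ∈ X, centerTraj X x N = a := by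
  induction N generalizing a with
  | zero => exact ⟨a, ha, rfl⟩
  | succ N ih =>
    obtain ⟨b, hb, rfl⟩ := mem_centerSet.1 ha
    obtain ⟨x, hx, rfl⟩ := ih hb
    exact ⟨x, hx, rfl⟩

theorem centerCylinder_succ (X : Finset ManhattanPlane) (N : ℕ) :
    centerCylinder X (N + 1) = centerCylinder X N ∪ pendantEdges (centerSeq X N) := by
  ext p
  simp only [centerCylinder, Set.mem_union, Set.mem_iUnion, Set.mem_Iic, Set.mem_Iio,
    Set.mem_singleton_iff, mem_pendantEdges, exists_prop]
  constructor
  · rintro (⟨x, hx, i, hi, rfl⟩ | ⟨x, hx, i, hi, hp⟩)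
    · rcases Nat.lt_or_ge i (N + 1) with h | h
      · exact Or.inl (Or.inl ⟨x, hx, i, by omega, rfl⟩)
      · obtain rfl : i = N + 1 := by omega
        exact Or.inr ⟨_, centerTraj_mem X x hx N, right_mem_segment ℝ _ _⟩
    · rcases Nat.lt_or_ge i N with h | h
      · exact Or.inl (Or.inr ⟨x, hx, i, h, hp⟩)
      · obtain rfl : i = N := by omega
        exact Or.inr ⟨_, centerTraj_mem X x hx i, hp⟩
  · rintro ((⟨x, hx, i, hi, rfl⟩ | ⟨x, hx, i, hi, hp⟩) | ⟨a, ha, hp⟩)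
    · exact Or.inl ⟨x, hx, i, by omega, rfl⟩
    · exact Or.inr ⟨x, hx, i, by omega, hp⟩
    · obtain ⟨x, hx, rfl⟩ := exists_centerTraj_eq ha
      exact Or.inr ⟨x, hx, N, by omega, hp⟩

theorem centerSeq_subset_centerCylinder (X : Finset ManhattanPlane) (N : ℕ) :
    ∀ a ∈ centerSeq X N, a ∈ centerCylinder X N := by
  intro a ha
  obtain ⟨x, hx, rfl⟩ := exists_centerTraj_eq ha
  simp only [centerCylinder, Set.mem_union, Set.mem_iUnion, Set.mem_Iic, Set.mem_singleton_iff]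
  exact Or.inl ⟨x, hx, N, le_rfl, rfl⟩

/-- The cylinder is attached from the inside outwards: the pendant edges of the last level first,
which gives a model one level earlier, and so on back to `X`. -/
theorem SpanModel.union_centerCylinder {X : Finset ManhattanPlane} {N : ℕ}
    {B : Set ManhattanPlane} (h : SpanModel (centerSeq X N) B) :
    SpanModel X (B ∪ centerCylinder X N) := by
  induction N generalizing B with
  | zero =>
    rw [centerCylinder_zero, Set.union_eq_left.2 (show (X : Set ManhattanPlane) ⊆ B from h.subset)]
    exact h
  | succ N ih =>
    have := ih (SpanModel.union_pendantEdges (Z := centerSeq X N) h)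
    rwa [centerCylinder_succ, Set.union_comm (centerCylinder X N), ← Set.union_assoc]

/-- If `p` on a pendant edge at `a` lies in the box of the centers, then `p` is between `a` and its
center and the center is between `a` and `p`; so they coincide. -/
theorem inter_centerCylinder {X : Finset ManhattanPlane} {N : ℕ} {B : Set ManhattanPlane}
    (h1 : ∀ a ∈ centerSeq X N, a ∈ B) (h2 : ∀ p ∈ B, InBox (centerSeq X N) p) :
    B ∩ centerCylinder X N = centerSeq X N := by
  apply Set.Subset.antisymm
  · rintro p ⟨hpB, hp⟩
    -- Only the box condition passes to earlier levels, since the boxes of the center sets decrease;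
    -- `B` need not contain the earlier sets.
    clear h1
    induction N with
    | zero => rwa [centerCylinder_zero] at hp
    | succ N ih =>
      have hedge : ∀ a ∈ centerSeq X N, p ∈ segment ℝ a (centerOf (centerSeq X N) a) →
          p ∈ (centerSeq X (N + 1) : Set ManhattanPlane) := by
        intro a ha hp
        have e := (centerOf_mbtw_of_inBox (X := centerSeq X N) ha (h2 p hpB)).eq_of_swap
          (btw_of_mem_segment hp)
        rw [e]
        exact centerOf_mem ha
      rw [centerCylinder_succ] at hp
      rcases hp with hp | hp
      · have := ih (fun q hq => (h2 q hq).trans fun r hr =>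
          inBox_of_mem_centerSet (X := centerSeq X N) hr) hp
        exact hedge p this (left_mem_segment ℝ _ _)
      · obtain ⟨a, ha, hp⟩ := mem_pendantEdges.1 hp
        exact hedge a ha hp
  · exact fun a ha => ⟨h1 a ha, centerSeq_subset_centerCylinder X N a ha⟩

/-- The trajectory of `x` followed by a last piece to `p` realizes the distance, because at each
level the center is between the current point and the box of the next set. -/
theorem dist_centerTraj {X : Finset ManhattanPlane} {N : ℕ} {p : ManhattanPlane}
    (hp : InBox (centerSeq X N) p) {x : ManhattanPlane} (hx : x ∈ X) :
    dist p x = dist p (centerTraj X x N) +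
      ∑ i ∈ Finset.range N, dist (centerTraj X x i) (centerTraj X x (i + 1)) := by
  induction N with
  | zero => simp [centerTraj]
  | succ N ih =>
    have e : _ = _ := centerOf_mbtw_of_inBox (centerTraj_mem X x hx N) hp
    have := ih (hp.trans fun r hr => inBox_of_mem_centerSet (X := centerSeq X N) hr)
    rw [this, Finset.sum_range_succ, dist_comm p, ← e, dist_comm p]
    change _ = dist (centerOf (centerSeq X N) (centerTraj X x N)) p + (_ +
      dist (centerTraj X x N) (centerOf (centerSeq X N) (centerTraj X x N)))
    ring

theorem pullBack_distTo {X : Finset ManhattanPlane} {N : ℕ} {p : ManhattanPlane}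
    (hp : InBox (centerSeq X N) p) : pullBack X N (distTo (centerSeq X N) p) = distTo X p := by
  funext x
  exact (dist_centerTraj hp x.2).symm

theorem SpanModel.dist_distTo {Z : Finset ManhattanPlane} {B : Set ManhattanPlane}
    (h : SpanModel Z B) {p q : ManhattanPlane} (hp : p ∈ B) (hq : q ∈ B) :
    dist (distTo Z p) (distTo Z q) = dist p q := by
  apply le_antisymm
  · refine (dist_pi_le_iff dist_nonneg).2 fun x => ?_
    rw [Real.dist_eq]
    exact abs_dist_sub_le p q x
  · obtain ⟨x, hx, hb⟩ := h.mbtw p hp q hq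
    refine le_trans ?_ (dist_le_pi_dist (distTo Z p) (distTo Z q) ⟨x, hx⟩)
    rw [Real.dist_eq, distTo, distTo, dist_comm p x, dist_comm q x]
    rcases hb with hb | hb
    · have e : _ = _ := hb
      rw [← e, abs_sub_comm]
      exact le_trans (by simp) (le_abs_self _)
    · have e : _ = _ := hb
      rw [← e, dist_comm p q]
      exact le_trans (by simp) (le_abs_self _)

theorem SpanModel.injOn {Z : Finset ManhattanPlane} {B : Set ManhattanPlane}
    (h : SpanModel Z B) : Set.InjOn (distTo Z) B := fun p hp q hq e => by
  rw [← dist_eq_zero, ← h.dist_distTo hp hq, e, dist_self]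

/-- The isometry of a planar model onto the tight span. -/
theorem SpanModel.exists_isometryEquiv {Z : Finset ManhattanPlane} {B : Set ManhattanPlane}
    (h : SpanModel Z B) : ∃ φ : B ≃ᵢ tightSpan Z, ∀ p : B, (φ p : Z → ℝ) = distTo Z p := by
  let f : B → tightSpan Z := fun p => ⟨distTo Z p, h.image ▸ Set.mem_image_of_mem _ p.2⟩
  have hf : Isometry f := Isometry.of_dist_eq fun p q => h.dist_distTo p.2 q.2
  have hs : Function.Surjective f := by
    rintro ⟨g, hg⟩
    obtain ⟨p, hp, e⟩ := h.image.symm ▸ hg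
    exact ⟨⟨p, hp⟩, Subtype.ext e⟩
  exact ⟨⟨Equiv.ofBijective f ⟨hf.injective, hs⟩, hf⟩, fun p => rfl⟩

/-- Both pieces are images of planar sets under the same map `distTo X`, which is injective on the
model of the tight span of `X`. The decomposition is therefore read off in the plane. -/
theorem SpanModel.tightSpan_eq {X : Finset ManhattanPlane} {N : ℕ}
    {B : Set ManhattanPlane} (h : SpanModel (centerSeq X N) B) :
    tightSpan X = pullBack X N '' tightSpan (centerSeq X N) ∪ distTo X '' centerCylinder X N ∧
    pullBack X N '' tightSpan (centerSeq X N) ∩ distTo X '' centerCylinder X N =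
      distTo X '' (centerSeq X N : Set ManhattanPlane) := by
  have hX := h.union_centerCylinder
  have e : pullBack X N '' tightSpan (centerSeq X N) = distTo X '' B := by
    rw [← h.image, Set.image_image]
    exact Set.image_congr fun p hp => pullBack_distTo (h.inBox p hp)
  rw [e]
  constructor
  · rw [← hX.image, Set.image_union]
  · rw [← inter_centerCylinder h.subset h.inBox]
    exact (hX.injOn.image_inter Set.subset_union_left Set.subset_union_right).symm

/-! ## Hyperconvexity of closed geodesically convex sets -/

theorem Finset.exists_pos_le {ι : Type*} (T : Finset ι) (f : ι → ℝ) (h : ∀ a ∈ T, 0 < f a) :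
    ∃ ε > 0, ∀ a ∈ T, ε ≤ f a := by
  rcases T.eq_empty_or_nonempty with rfl | hT
  · exact ⟨1, one_pos, by simp⟩
  · obtain ⟨a, ha, hmin⟩ := T.exists_min_image f hT
    exact ⟨f a, h a ha, hmin⟩

/-- Coordinates `u`, `v` in which the distance is the Manhattan distance. -/
structure ManhattanCoord (u v : ManhattanPlane → ℝ) : Prop where
  continuous_left : Continuous u
  continuous_right : Continuous v
  dist_eq : ∀ p q, dist p q = |u p - u q| + |v p - v q|

theorem ManhattanCoord.mbtw_iff {u v : ManhattanPlane → ℝ} (h : ManhattanCoord u v)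
    {a m b : ManhattanPlane} : MBtw a m b ↔ Mid (u a) (u m) (u b) ∧ Mid (v a) (v m) (v b) := by
  rw [mid_iff_abs, mid_iff_abs, MBtw, h.dist_eq, h.dist_eq, h.dist_eq]
  constructor
  · intro h
    have h1 := abs_sub_le (u a) (u m) (u b)
    have h2 := abs_sub_le (v a) (v m) (v b)
    constructor <;> linarith
  · rintro ⟨h1, h2⟩
    linarith

theorem ManhattanCoord.std : ManhattanCoord (fun p => p.fst) (fun p => p.snd) :=
  ⟨continuous_plane_fst, continuous_plane_snd, plane_dist⟩

theorem ManhattanCoord.swap {u v : ManhattanPlane → ℝ} (h : ManhattanCoord u v) :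
    ManhattanCoord v u :=
  ⟨h.2, h.1, fun p q => by rw [h.3, add_comm]⟩

theorem ManhattanCoord.neg_right {u v : ManhattanPlane → ℝ} (h : ManhattanCoord u v) :
    ManhattanCoord u (fun p => -v p) :=
  ⟨h.1, h.2.neg, fun p q => by rw [h.3, ← neg_sub' , abs_neg]⟩

theorem ManhattanCoord.neg_left {u v : ManhattanPlane → ℝ} (h : ManhattanCoord u v) :
    ManhattanCoord (fun p => -u p) v := h.swap.neg_right.swap

/-- A sufficiently short initial piece of the geodesic to any single point of `T` stays in the box
from `p` to each of the finitely many points of `T`. -/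
theorem ManhattanCoord.exists_step_quadrant {u v : ManhattanPlane → ℝ} (h : ManhattanCoord u v)
    {B : Set ManhattanPlane} (hB : GeodesicallyConvex B) {p : ManhattanPlane} (hp : p ∈ B)
    {T : Finset ManhattanPlane} (hTB : ∀ a ∈ T, a ∈ B) (hT : T.Nonempty)
    (hu : ∀ a ∈ T, u p < u a) (hv : ∀ a ∈ T, v p < v a) {η : ℝ} (hη : 0 < η) :
    ∃ q ∈ B, 0 < dist p q ∧ dist p q ≤ η ∧ ∀ a ∈ T, MBtw p q a := by
  obtain ⟨ε, hε, hle⟩ := T.exists_pos_le (fun a => u a - u p) fun a ha => sub_pos.2 (hu a ha)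
  obtain ⟨ε', hε', hle'⟩ := T.exists_pos_le (fun a => v a - v p) fun a ha => sub_pos.2 (hv a ha)
  obtain ⟨a, ha⟩ := hT
  obtain ⟨γ, hγ, hS⟩ := hB p hp a (hTB a ha)
  have hd := h.dist_eq p a
  have h1 := hle a ha
  have h2 := hle' a ha
  rw [abs_sub_comm, abs_of_nonneg (by linarith : 0 ≤ u a - u p), abs_sub_comm (v p),
    abs_of_nonneg (by linarith : 0 ≤ v a - v p)] at hd
  let t := min η (min ε ε')
  have ht0 : 0 < t := lt_min hη (lt_min hε hε')
  have htη : t ≤ η := min_le_left _ _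
  have htε : t ≤ ε := (min_le_right _ _).trans (min_le_left _ _)
  have htε' : t ≤ ε' := (min_le_right _ _).trans (min_le_right _ _)
  have ht : t ∈ Set.Icc 0 (dist p a) := ⟨ht0.le, by linarith⟩
  have hdl := hγ.dist_left ht
  have hb := h.mbtw_iff.1 (hγ.btw ht)
  have hd' := h.dist_eq p (γ t)
  have hu0 : u p ≤ u (γ t) := by
    rcases hb.1 with k | k <;> linarith [k.1, k.2]
  have hv0 : v p ≤ v (γ t) := by
    rcases hb.2 with k | k <;> linarith [k.1, k.2]
  rw [abs_sub_comm, abs_of_nonneg (by linarith : 0 ≤ u (γ t) - u p), abs_sub_comm (v p),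
    abs_of_nonneg (by linarith : 0 ≤ v (γ t) - v p)] at hd'
  refine ⟨γ t, hS t ht, by linarith, by linarith, fun b hb => h.mbtw_iff.2 ⟨?_, ?_⟩⟩
  · have := hle b hb
    exact Or.inl ⟨hu0, by linarith⟩
  · have := hle' b hb
    exact Or.inl ⟨hv0, by linarith⟩

/-- If `T` is not contained in one open quadrant, it has points `a` and `b` weakly on the two sides
of the line `v = v p`. Geodesics to them reach the line `u = u p + s` at points `z` and `w` on the
respective sides, and a geodesic from `w` to `z` contains the point obtained from `p` by a pure
`u`-step. -/
theorem ManhattanCoord.exists_step_halfplane {u v : ManhattanPlane → ℝ} (h : ManhattanCoord u v)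
    {B : Set ManhattanPlane} (hB : GeodesicallyConvex B) {p : ManhattanPlane} (hp : p ∈ B)
    {T : Finset ManhattanPlane} (hTB : ∀ a ∈ T, a ∈ B) (hT : T.Nonempty)
    (hu : ∀ a ∈ T, u p < u a) {η : ℝ} (hη : 0 < η) :
    ∃ q ∈ B, 0 < dist p q ∧ dist p q ≤ η ∧ ∀ a ∈ T, MBtw p q a := by
  by_cases h1 : ∀ a ∈ T, v p < v a
  · exact h.exists_step_quadrant hB hp hTB hT hu h1 hη
  by_cases h2 : ∀ a ∈ T, v a < v p
  · exact h.neg_right.exists_step_quadrant hB hp hTB hT hu (fun a ha => neg_lt_neg (h2 a ha)) hη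
  push Not at h1 h2
  obtain ⟨b, hb, hbv⟩ := h1
  obtain ⟨a, ha, hav⟩ := h2
  obtain ⟨ε, hε, hle⟩ := T.exists_pos_le (fun a => u a - u p) fun a ha => sub_pos.2 (hu a ha)
  let s := min η ε
  have hs0 : 0 < s := lt_min hη hε
  have hsη : s ≤ η := min_le_left _ _
  have hsε : s ≤ ε := min_le_right _ _
  obtain ⟨z, hz, hzb, hzu⟩ := hB.exists_eq h.continuous_left hp (hTB a ha)
    (s := u p + s) (by linarith) (by linarith [hle a ha])
  obtain ⟨w, hw, hwb, hwu⟩ := hB.exists_eq h.continuous_left hp (hTB b hb)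
    (s := u p + s) (by linarith) (by linarith [hle b hb])
  have hzv : v p ≤ v z := by
    rcases (h.mbtw_iff.1 hzb).2 with k | k <;> linarith [k.1, k.2]
  have hwv : v w ≤ v p := by
    rcases (h.mbtw_iff.1 hwb).2 with k | k <;> linarith [k.1, k.2]
  obtain ⟨q, hq, hqb, hqv⟩ := hB.exists_eq h.continuous_right hw hz hwv hzv
  have hqu : u q = u p + s := by
    rcases (h.mbtw_iff.1 hqb).1 with k | k <;> linarith [k.1, k.2]
  have hd : dist p q = s := by
    rw [h.dist_eq, hqu, hqv, sub_self, abs_zero, add_zero, sub_add_cancel_left, abs_neg,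
      abs_of_pos hs0]
  refine ⟨q, hq, by linarith, by linarith, fun c hc => h.mbtw_iff.2 ⟨?_, ?_⟩⟩
  · rw [hqu]
    exact Or.inl ⟨by linarith, by linarith [hle c hc]⟩
  · rw [hqv, mid_iff_abs]
    simp

/-- Opposite closed quadrants at `p` cannot both contain points of `T`, and `p` itself is not in `T`
(the case `a = b`). This leaves `T` inside an open half-plane bounded by an axis-parallel line
through `p`. -/
theorem exists_common_side {p : ManhattanPlane} {T : Finset ManhattanPlane}
    (h : ∀ a ∈ T, ∀ b ∈ T, ¬ MBtw a p b) :
    (∀ a ∈ T, p.fst < a.fst) ∨ (∀ a ∈ T, a.fst < p.fst) ∨ (∀ a ∈ T, p.snd < a.snd) ∨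
      (∀ a ∈ T, a.snd < p.snd) := by
  by_contra hno
  push Not at hno
  obtain ⟨⟨a, ha, ha'⟩, ⟨b, hb, hb'⟩, ⟨c, hc, hc'⟩, ⟨d, hd, hd'⟩⟩ := hno
  have hab := h a ha b hb
  have hac := h a ha c hc
  have had := h a ha d hd
  have hbc := h b hb c hc
  have hbd := h b hb d hd
  simp only [btw_plane, Mid] at hab hac had hbc hbd
  grind

theorem exists_step {B : Set ManhattanPlane} (hB : GeodesicallyConvex B) {p : ManhattanPlane}
    (hp : p ∈ B) {T : Finset ManhattanPlane} (hTB : ∀ a ∈ T, a ∈ B) (hT : T.Nonempty)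
    (h : ∀ a ∈ T, ∀ b ∈ T, ¬ MBtw a p b) {η : ℝ} (hη : 0 < η) :
    ∃ q ∈ B, 0 < dist p q ∧ dist p q ≤ η ∧ ∀ a ∈ T, MBtw p q a := by
  have std := ManhattanCoord.std
  rcases exists_common_side h with k | k | k | k
  · exact std.exists_step_halfplane hB hp hTB hT k hη
  · exact std.neg_left.exists_step_halfplane hB hp hTB hT (fun a ha => neg_lt_neg (k a ha)) hη
  · exact std.swap.exists_step_halfplane hB hp hTB hT k hη
  · exact std.swap.neg_left.exists_step_halfplane hB hp hTB hT (fun a ha => neg_lt_neg (k a ha)) hη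

/-- Finitely many pairwise intersecting balls centered in a closed geodesically convex set of the
plane have a common point in this set. -/
theorem exists_mem_balls {B : Set ManhattanPlane} (hB : GeodesicallyConvex B) (hBc : IsClosed B)
    {ι : Type*} {s : Finset ι} (hs : s.Nonempty) {c : ι → ManhattanPlane} {r : ι → ℝ}
    (hc : ∀ i ∈ s, c i ∈ B) (hr : ∀ i ∈ s, ∀ j ∈ s, dist (c i) (c j) ≤ r i + r j) :
    ∃ p ∈ B, ∀ i ∈ s, dist p (c i) ≤ r i := by
  classical
  -- The largest amount by which a point misses one of the balls. It attains its minimum on `B`; if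
  -- the minimum were positive, a small step in `B` towards all the balls missed by most would lower
  -- it.
  let g : ManhattanPlane → ℝ := fun p => s.sup' hs fun i => dist p (c i) - r i
  have hg : Continuous g := Continuous.finset_sup'_apply hs fun i _ => by fun_prop
  have hge : ∀ p, ∀ i ∈ s, dist p (c i) - r i ≤ g p := fun p i hi =>
    Finset.le_sup' (fun i => dist p (c i) - r i) hi
  obtain ⟨i₀, hi₀⟩ := hs
  have hK : IsCompact (B ∩ Metric.closedBall (c i₀) (g (c i₀) + r i₀)) :=
    (isCompact_closedBall _ _).inter_left hBc
  have h0 : c i₀ ∈ B ∩ Metric.closedBall (c i₀) (g (c i₀) + r i₀) := by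
    refine ⟨hc i₀ hi₀, ?_⟩
    have := hge (c i₀) i₀ hi₀
    rw [dist_self] at this
    rw [Metric.mem_closedBall, dist_self]
    linarith
  obtain ⟨p, ⟨hpB, -⟩, hpmin⟩ := hK.exists_isMinOn ⟨_, h0⟩ hg.continuousOn
  have hmin : ∀ q ∈ B, g p ≤ g q := by
    intro q hq
    by_cases hqK : q ∈ Metric.closedBall (c i₀) (g (c i₀) + r i₀)
    · exact hpmin ⟨hq, hqK⟩
    · rw [Metric.mem_closedBall, not_le] at hqK
      have h1 : g p ≤ g (c i₀) := hpmin h0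
      have := hge q i₀ hi₀
      linarith
  by_cases hM : g p ≤ 0
  · exact ⟨p, hpB, fun i hi => by linarith [hge p i hi]⟩
  exfalso
  rw [not_le] at hM
  let T := s.filter fun i => dist p (c i) - r i = g p
  have hT : T.Nonempty := by
    obtain ⟨i, hi, e⟩ := Finset.exists_mem_eq_sup' (⟨i₀, hi₀⟩ : s.Nonempty)
      fun i => dist p (c i) - r i
    exact ⟨i, Finset.mem_filter.2 ⟨hi, e.symm⟩⟩
  obtain ⟨η, hη, hηle⟩ := (s.filter fun i => dist p (c i) - r i ≠ g p).exists_pos_le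
    (fun i => g p - (dist p (c i) - r i)) (fun i hi => by
      rw [Finset.mem_filter] at hi
      exact sub_pos.2 (lt_of_le_of_ne (hge p i hi.1) hi.2))
  -- The point `p` is not between two centers of the worst balls, as their radii sum to at least the
  -- distance of the centers. The other excesses are below the maximum by at least `η` and grow by
  -- at most `η / 2`.
  obtain ⟨q, hq, hq0, hqη, hqb⟩ := exists_step hB hpB (T := T.image c) (η := η / 2)
    (by
      intro a ha
      obtain ⟨i, hi, rfl⟩ := Finset.mem_image.1 ha
      exact hc i (Finset.mem_filter.1 hi).1)
    (hT.image c)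
    (by
      intro a ha b hb hab
      obtain ⟨i, hi, rfl⟩ := Finset.mem_image.1 ha
      obtain ⟨j, hj, rfl⟩ := Finset.mem_image.1 hb
      rw [Finset.mem_filter] at hi hj
      have e : _ = _ := hab
      rw [dist_comm (c i) p] at e
      linarith [hr i hi.1 j hj.1, hi.2, hj.2])
    (half_pos hη)
  refine absurd (hmin q hq) (not_le.2 ((Finset.sup'_lt_iff _).2 fun i hi => ?_))
  by_cases hiT : dist p (c i) - r i = g p
  · have e : _ = _ := hqb (c i) (Finset.mem_image_of_mem c (Finset.mem_filter.2 ⟨hi, hiT⟩))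
    linarith
  · have := hηle i (Finset.mem_filter.2 ⟨hi, hiT⟩)
    have := dist_triangle q p (c i)
    rw [dist_comm q p] at this
    linarith

/-! ## The tight span as a metric space -/

theorem isCompact_tightSpan (α : Type*) [Fintype α] [MetricSpace α] :
    IsCompact (tightSpan α) := by
  have hK : IsCompact (Set.univ.pi fun x : α => Set.Icc (0 : ℝ) (∑ y, dist x y)) :=
    isCompact_univ_pi fun x => isCompact_Icc
  refine hK.of_isClosed_subset ?_ ?_
  · have : tightSpan α = (⋂ x, {f : α → ℝ | 0 ≤ f x}) ∩ (⋂ x, ⋂ y, {f | dist x y ≤ f x + f y}) ∩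
        ⋂ x, ⋃ y, {f | f x + f y = dist x y} := by
      ext f
      simp [tightSpan, and_assoc]
    rw [this]
    refine IsClosed.inter (IsClosed.inter ?_ ?_) ?_
    · exact isClosed_iInter fun x => isClosed_le (by fun_prop) (by fun_prop)
    · exact isClosed_iInter fun x => isClosed_iInter fun y =>
        isClosed_le (by fun_prop) (by fun_prop)
    · exact isClosed_iInter fun x => isClosed_iUnion_of_finite fun y =>
        isClosed_eq (by fun_prop) (by fun_prop)
  · intro f hf x _
    refine ⟨hf.1 x, ?_⟩
    obtain ⟨y, hy⟩ := hf.2.2 x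
    have := Finset.single_le_sum (f := fun y => dist x y) (fun y _ => dist_nonneg)
      (Finset.mem_univ y)
    linarith [hf.1 y]

/-- Minimize the sum of the values among the admissible functions below `h`. If some `x` had no
partner, the value at `x` could still be lowered. -/
theorem exists_tightSpan_le {α : Type*} [Fintype α] [MetricSpace α] {h : α → ℝ}
    (hh : ∀ x y, dist x y ≤ h x + h y) : ∃ f ∈ tightSpan α, ∀ x, f x ≤ h x := by
  classical
  let K : Set (α → ℝ) := (Set.univ.pi fun x : α => Set.Icc (0 : ℝ) (h x)) ∩
    ⋂ x, ⋂ y, {f | dist x y ≤ f x + f y}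
  have hK : IsCompact K := (isCompact_univ_pi fun x => isCompact_Icc).inter_right
    (isClosed_iInter fun x => isClosed_iInter fun y => isClosed_le (by fun_prop) (by fun_prop))
  have hmem : ∀ f, f ∈ K ↔ (∀ x, 0 ≤ f x ∧ f x ≤ h x) ∧ ∀ x y, dist x y ≤ f x + f y := by
    intro f
    simp [K, Pi.le_def, forall_and]
  have h0 : h ∈ K := (hmem h).2 ⟨fun x => ⟨by
    have := hh x x
    rw [dist_self] at this
    linarith, le_rfl⟩, hh⟩
  obtain ⟨f, hf, hmin⟩ := hK.exists_isMinOn ⟨h, h0⟩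
    (f := fun f => ∑ x, f x) (by fun_prop)
  obtain ⟨hf1, hf2⟩ := (hmem f).1 hf
  refine ⟨f, ⟨fun x => (hf1 x).1, hf2, fun x => ?_⟩, fun x => (hf1 x).2⟩
  by_contra hno
  push Not at hno
  -- The choice `y = x` is included, so `ε` is at most twice the value at `x` and lowering by `ε /
  -- 2` keeps it nonnegative.
  obtain ⟨ε, hε, hle⟩ := Finset.univ.exists_pos_le (fun y => f x + f y - dist x y)
    fun y _ => sub_pos.2 (lt_of_le_of_ne (hf2 x y) (hno y).symm)
  have hx := hle x (Finset.mem_univ _)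
  rw [dist_self] at hx
  have hf' : Function.update f x (f x - ε / 2) ∈ K := by
    refine (hmem _).2 ⟨fun y => ?_, fun y z => ?_⟩
    · by_cases hyx : y = x
      · subst hyx
        rw [Function.update_self]
        exact ⟨by linarith, by linarith [hf1 y]⟩
      · rw [Function.update_of_ne hyx]
        exact hf1 y
    · by_cases hyx : y = x <;> by_cases hzx : z = x
      · subst hyx hzx
        rw [Function.update_self, dist_self]
        linarith
      · subst hyx
        rw [Function.update_self, Function.update_of_ne hzx]
        linarith [hle z (Finset.mem_univ _)]
      · subst hzx
        rw [Function.update_self, Function.update_of_ne hyx, dist_comm]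
        linarith [hle y (Finset.mem_univ _)]
      · rw [Function.update_of_ne hyx, Function.update_of_ne hzx]
        exact hf2 y z
  have hlt : ∑ y, Function.update f x (f x - ε / 2) y < ∑ y, f y := by
    refine Finset.sum_lt_sum (fun y _ => ?_) ⟨x, Finset.mem_univ _, ?_⟩
    · by_cases hyx : y = x
      · subst hyx
        rw [Function.update_self]
        linarith
      · rw [Function.update_of_ne hyx]
    · rw [Function.update_self]
      linarith
  exact absurd (hmin hf') (not_le.2 hlt)

/-- Any two points of the tight span have a midpoint. -/
theorem exists_tightSpan_midpoint {α : Type*} [Fintype α] [MetricSpace α] {f g : α → ℝ}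
    (hf : f ∈ tightSpan α) (hg : g ∈ tightSpan α) :
    ∃ h ∈ tightSpan α, dist f h ≤ dist f g / 2 ∧ dist h g ≤ dist f g / 2 := by
  obtain ⟨h, hh, hle⟩ := exists_tightSpan_le (h := fun x => (f x + g x) / 2) fun x y => by
    linarith [hf.2.1 x y, hg.2.1 x y]
  have hd : ∀ x, |f x - g x| ≤ dist f g := fun x => by
    rw [← Real.dist_eq]
    exact dist_le_pi_dist f g x
  have hD : 0 ≤ dist f g := dist_nonneg
  -- An upper bound for `h` relative to `k` gives the lower bound as well: at the partner `y` of `x`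
  -- for `k`, the value of `h` cannot be too large, so at `x` it cannot be too small.
  have key : ∀ k ∈ tightSpan α, (∀ x, h x ≤ k x + dist f g / 2) → ∀ x, |k x - h x| ≤ dist f g / 2 := by
    intro k hk hle x
    obtain ⟨y, hy⟩ := hk.2.2 x
    have := hh.2.1 x y
    rw [abs_le]
    constructor <;> linarith [hle x, hle y]
  refine ⟨h, hh, (dist_pi_le_iff (by linarith)).2 fun x => ?_,
    (dist_pi_le_iff (by linarith)).2 fun x => ?_⟩
  · rw [Real.dist_eq]
    exact key f hf (fun x => by linarith [hle x, (abs_le.1 (hd x)).1]) x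
  · rw [Real.dist_eq, abs_sub_comm]
    exact key g hg (fun x => by linarith [hle x, (abs_le.1 (hd x)).2]) x

theorem exists_dist_eq_of_nonempty {α : Type*} [Fintype α] [Nonempty α] (f g : α → ℝ) :
    ∃ x, |f x - g x| = dist f g := by
  by_contra hno
  push Not at hno
  have hlt : ∀ x, dist (f x) (g x) < dist f g := fun x =>
    lt_of_le_of_ne (dist_le_pi_dist f g x) (by rw [Real.dist_eq]; exact hno x)
  have x₀ := Classical.arbitrary α
  have hpos : 0 < dist f g := lt_of_le_of_lt dist_nonneg (hlt x₀)
  exact lt_irrefl _ ((dist_pi_lt_iff hpos).2 hlt)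

/-! ## Minimal convex sets -/

/-- To extend by one function `h`, a point is needed in the balls around the points `a` with radius
`h a` and around the old images with radius the distance to `h`. Their compatibility is the
induction hypothesis together with the tight span inequality, so `exists_mem_balls` applies. -/
theorem exists_nonexpansive_finset {A : Finset ManhattanPlane} (hA : A.Nonempty)
    {B : Set ManhattanPlane} (hB : GeodesicallyConvex B) (hBc : IsClosed B)
    (hAB : ∀ a ∈ A, a ∈ B) (F : Finset (tightSpan A)) :
    ∃ σ : tightSpan A → ManhattanPlane, (∀ f ∈ F, σ f ∈ B ∧ ∀ a : A, dist (σ f) a ≤ f.1 a) ∧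
      ∀ f ∈ F, ∀ g ∈ F, dist (σ f) (σ g) ≤ dist f g := by
  classical
  induction F using Finset.induction_on with
  | empty => exact ⟨fun _ => hA.choose, by simp, by simp⟩
  | insert h F hF ih =>
    obtain ⟨σ, h1, h2⟩ := ih
    have hfg : ∀ g : tightSpan A, ∀ a : A, g.1 a ≤ h.1 a + dist h g := by
      intro g a
      have := dist_le_pi_dist h.1 g.1 a
      rw [Real.dist_eq] at this
      have e : dist h g = dist h.1 g.1 := rfl
      linarith [(abs_le.1 this).1]
    obtain ⟨p, hp, hpd⟩ := exists_mem_balls hB hBc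
      (s := (Finset.univ : Finset A).disjSum F)
      (c := Sum.elim (fun a => (a : ManhattanPlane)) σ)
      (r := Sum.elim h.1 fun g => dist h g)
      ⟨Sum.inl ⟨_, hA.choose_spec⟩, by simp⟩
      (by
        rintro (a | g) hi
        · exact hAB a a.2
        · exact (h1 g (by simpa using hi)).1)
      (by
        rintro (a | g) hi (b | k) hj
        · exact h.2.2.1 a b
        · simp only [Sum.elim_inl, Sum.elim_inr]
          rw [dist_comm]
          exact ((h1 k (by simpa using hj)).2 a).trans (hfg k a)
        · simp only [Sum.elim_inl, Sum.elim_inr]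
          rw [add_comm]
          exact ((h1 g (by simpa using hi)).2 b).trans (hfg g b)
        · simp only [Sum.elim_inr]
          exact (h2 g (by simpa using hi) k (by simpa using hj)).trans (dist_triangle_left _ _ _))
    have hpA : ∀ a : A, dist p a ≤ h.1 a := fun a => hpd (Sum.inl a) (by simp)
    have hpF : ∀ g ∈ F, dist p (σ g) ≤ dist h g := fun g hg => hpd (Sum.inr g) (by simpa using hg)
    have hne : ∀ g ∈ F, g ≠ h := fun g hg e => hF (e ▸ hg)
    refine ⟨Function.update σ h p, fun f hf => ?_, fun f hf g hg => ?_⟩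
    · rcases Finset.mem_insert.1 hf with rfl | hf
      · rw [Function.update_self]
        exact ⟨hp, hpA⟩
      · rw [Function.update_of_ne (hne f hf)]
        exact h1 f hf
    · rcases Finset.mem_insert.1 hf with rfl | hf' <;> rcases Finset.mem_insert.1 hg with rfl | hg'
      · simp
      · rw [Function.update_self, Function.update_of_ne (hne g hg')]
        exact hpF g hg'
      · rw [Function.update_self, Function.update_of_ne (hne f hf'), dist_comm, dist_comm f]
        exact hpF f hf'
      · rw [Function.update_of_ne (hne f hf'), Function.update_of_ne (hne g hg')]
        exact h2 f hf' g hg'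

open Filter Topology in
/-- The tight span of a finite set maps nonexpansively into any closed geodesically convex set of
the plane that contains the finite set. -/
theorem exists_nonexpansive {A : Finset ManhattanPlane} (hA : A.Nonempty)
    {B : Set ManhattanPlane} (hB : GeodesicallyConvex B) (hBc : IsClosed B)
    (hAB : ∀ a ∈ A, a ∈ B) :
    ∃ σ : tightSpan A → ManhattanPlane, (∀ f, σ f ∈ B ∧ ∀ a : A, dist (σ f) a ≤ f.1 a) ∧
      ∀ f g, dist (σ f) (σ g) ≤ dist f g := by
  classical
  choose τ hτ1 hτ2 using exists_nonexpansive_finset hA hB hBc hAB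
  -- Along `U` each function eventually belongs to the finite set `F`. Its images then stay in a
  -- compact part of `B` and converge, and the inequalities pass to the limit.
  let U : Ultrafilter (Finset (tightSpan A)) := Ultrafilter.of atTop
  have hU : ↑U ≤ (atTop : Filter (Finset (tightSpan A))) := Ultrafilter.of_le _
  have hev : ∀ f, ∀ᶠ F in (U : Filter (Finset (tightSpan A))), f ∈ F := fun f =>
    hU ((eventually_ge_atTop {f}).mono fun F hF => hF (Finset.mem_singleton_self f))
  obtain ⟨a₀, ha₀⟩ := hA
  have hlim : ∀ f, ∃ p, p ∈ B ∧ Tendsto (fun F => τ F f) U (𝓝 p) := by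
    intro f
    have hK : IsCompact (B ∩ Metric.closedBall a₀ (f.1 ⟨a₀, ha₀⟩)) :=
      (isCompact_closedBall _ _).inter_left hBc
    obtain ⟨p, hp, hle⟩ := hK.ultrafilter_le_nhds (U.map fun F => τ F f) (by
      rw [le_principal_iff]
      exact (hev f).mono fun F hF => ⟨(hτ1 F f hF).1, (hτ1 F f hF).2 ⟨a₀, ha₀⟩⟩)
    exact ⟨p, hp.1, hle⟩
  choose σ hσB hσ using hlim
  refine ⟨σ, fun f => ⟨hσB f, fun a => ?_⟩, fun f g => ?_⟩
  · exact le_of_tendsto ((hσ f).dist tendsto_const_nhds) ((hev f).mono fun F hF => (hτ1 F f hF).2 a)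
  · exact le_of_tendsto ((hσ f).dist (hσ g)) (((hev f).and (hev g)).mono fun F hF =>
      hτ2 F f hF.1 g hF.2)

theorem isClosed_inBox (A : Finset ManhattanPlane) :
    IsClosed {p | InBox (A : Set ManhattanPlane) p} := by
  have : {p | InBox (A : Set ManhattanPlane) p} =
      (⋃ a ∈ (A : Set ManhattanPlane), {p | a.fst ≤ p.fst}) ∩
      ((⋃ a ∈ (A : Set ManhattanPlane), {p | p.fst ≤ a.fst}) ∩
      ((⋃ a ∈ (A : Set ManhattanPlane), {p | a.snd ≤ p.snd}) ∩
      (⋃ a ∈ (A : Set ManhattanPlane), {p | p.snd ≤ a.snd}))) := by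
    ext p
    simp [InBox]
  rw [this]
  have hf := A.finite_toSet
  have c1 := continuous_plane_fst
  have c2 := continuous_plane_snd
  refine IsClosed.inter ?_ (IsClosed.inter ?_ (IsClosed.inter ?_ ?_))
  · exact hf.isClosed_biUnion fun a _ => isClosed_le continuous_const c1
  · exact hf.isClosed_biUnion fun a _ => isClosed_le c1 continuous_const
  · exact hf.isClosed_biUnion fun a _ => isClosed_le continuous_const c2
  · exact hf.isClosed_biUnion fun a _ => isClosed_le c2 continuous_const

/-- Intersecting with the bounding box preserves closedness, convexity and the points of `A`. -/
theorem IsMinimalConvex.inBox {A : Finset ManhattanPlane} {B : Set ManhattanPlane}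
    (h : IsMinimalConvex A B) : ∀ p ∈ B, InBox A p := by
  obtain ⟨⟨hAB, hBc, hB⟩, hmin⟩ := h
  have := hmin (y := B ∩ {p | InBox (A : Set ManhattanPlane) p})
    ⟨fun a ha => ⟨hAB ha, InBox.of_mem ha⟩, hBc.inter (isClosed_inBox A), fun p hp q hq => by
      obtain ⟨γ, hγ, hS⟩ := hB p hp.1 q hq.1
      exact ⟨γ, hγ, fun t ht => ⟨hS t ht, InBox.of_btw hp.2 hq.2 (hγ.btw ht)⟩⟩⟩
    Set.inter_subset_left
  exact fun p hp => (this hp).2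

/-- A minimal convex set over `A` is a model of the tight span of `A`. -/
theorem IsMinimalConvex.spanModel {A : Finset ManhattanPlane} (hA : A.Nonempty)
    {B : Set ManhattanPlane} (h : IsMinimalConvex A B) : SpanModel A B := by
  have hbox := h.inBox
  obtain ⟨⟨hAB, hBc, hB⟩, hmin⟩ := h
  obtain ⟨σ, h1, h2⟩ := exists_nonexpansive hA hB hBc hAB
  have : Nonempty A := hA.coe_sort
  -- The distances from `σ f` are at most the values of `f`, and the triangle inequality at a
  -- partner of `x` leaves no room for a smaller value.
  have hσ : ∀ f, distTo A (σ f) = f.1 := by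
    intro f
    funext x
    obtain ⟨y, hy⟩ := f.2.2.2 x
    have e1 := (h1 f).2 x
    have e2 := (h1 f).2 y
    have e3 := dist_triangle_left (x : ManhattanPlane) y (σ f)
    rw [Subtype.dist_eq] at hy
    rw [distTo]
    linarith
  have hiso : ∀ f g, dist (σ f) (σ g) = dist f g := by
    intro f g
    apply le_antisymm (h2 f g)
    have : dist f g = dist (distTo A (σ f)) (distTo A (σ g)) := by
      rw [hσ, hσ]
      rfl
    rw [this]
    refine (dist_pi_le_iff dist_nonneg).2 fun x => ?_
    rw [Real.dist_eq]
    exact abs_dist_sub_le _ _ _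
  have hcs : CompactSpace (tightSpan A) := isCompact_iff_compactSpace.1 (isCompact_tightSpan A)
  have hcomp : IsCompact (Set.range σ) := isCompact_range (Isometry.of_dist_eq hiso).continuous
  have hconv : GeodesicallyConvex (Set.range σ) := by
    refine GeodesicallyConvex.of_menger hcomp ?_
    rintro _ ⟨f, rfl⟩ _ ⟨g, rfl⟩ hne
    obtain ⟨k, hk, hfk, hkg⟩ := exists_tightSpan_midpoint f.2 g.2
    have e1 : dist (σ f) (σ ⟨k, hk⟩) ≤ dist (σ f) (σ g) / 2 := by
      rw [hiso, hiso]
      exact hfk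
    have e2 : dist (σ ⟨k, hk⟩) (σ g) ≤ dist (σ f) (σ g) / 2 := by
      rw [hiso, hiso]
      exact hkg
    have hpos := dist_pos.2 hne
    refine ⟨_, ⟨⟨k, hk⟩, rfl⟩, ?_, ?_, btw_of_le (by linarith)⟩
    · intro e
      rw [e] at e2
      linarith
    · intro e
      rw [e] at e1
      linarith
  have hAr : (A : Set ManhattanPlane) ⊆ Set.range σ := by
    intro a ha
    refine ⟨⟨distTo A a, mem_tightSpan_distTo fun x hx => ⟨a, ha, btw_right _ _⟩⟩, ?_⟩
    have := (h1 ⟨distTo A a, mem_tightSpan_distTo fun x hx => ⟨a, ha, btw_right _ _⟩⟩).2 ⟨a, ha⟩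
    simp only [distTo, dist_self] at this
    exact dist_le_zero.1 this
  have hsub : Set.range σ ⊆ B := by
    rintro _ ⟨f, rfl⟩
    exact (h1 f).1
  have hBσ : B = Set.range σ :=
    Set.Subset.antisymm (hmin ⟨hAr, hcomp.isClosed, hconv⟩ hsub) hsub
  refine ⟨hAB, hbox, ?_, ?_, hB⟩
  · rw [hBσ]
    rintro _ ⟨f, rfl⟩ _ ⟨g, rfl⟩
    obtain ⟨x, hx⟩ := exists_dist_eq_of_nonempty f.1 g.1
    refine ⟨x, x.2, ?_⟩
    have e : |f.1 x - g.1 x| = dist (σ f) (σ g) := by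
      rw [hx, hiso]
      rfl
    rw [← hσ f, ← hσ g, distTo, distTo, dist_comm _ (x : ManhattanPlane),
      dist_comm _ (x : ManhattanPlane)] at e
    rcases abs_cases (dist (x : ManhattanPlane) (σ f) - dist (x : ManhattanPlane) (σ g)) with
      ⟨k, -⟩ | ⟨k, -⟩
    · right
      refine (?_ : _ = _)
      rw [dist_comm (σ g)]
      linarith
    · left
      refine (?_ : _ = _)
      linarith
  · rw [hBσ, ← Set.range_comp]
    ext f
    constructor
    · rintro ⟨g, rfl⟩
      simp only [Function.comp_apply, hσ]
      exact g.2
    · exact fun hf => ⟨⟨f, hf⟩, hσ _⟩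

/-! ## Quadrants and orthogonal hulls -/

/-- The points whose quadrant in the direction opposite to `(σ, τ)` meets `S`. -/
def quadHull (σ τ : ℝ) (S : Finset ManhattanPlane) : Set ManhattanPlane :=
  {p | ∃ c ∈ S, σ * c.fst ≤ σ * p.fst ∧ τ * c.snd ≤ τ * p.snd}

/-- `σ` is a sign. -/
def IsSign (σ : ℝ) : Prop := σ = 1 ∨ σ = -1

theorem isSign_one : IsSign 1 := Or.inl rfl
theorem isSign_neg_one : IsSign (-1) := Or.inr rfl

theorem IsSign.neg {σ : ℝ} (h : IsSign σ) : IsSign (-σ) := by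
  rcases h with rfl | rfl
  · exact Or.inr rfl
  · exact Or.inl (by norm_num)

theorem IsSign.eq_of_mul {σ x y : ℝ} (h : IsSign σ) (e : σ * x = σ * y) : x = y := by
  rcases h with rfl | rfl <;> linarith

theorem quadHull_trans {σ τ : ℝ} {S T : Finset ManhattanPlane}
    (h : (S : Set ManhattanPlane) ⊆ quadHull σ τ T) : quadHull σ τ S ⊆ quadHull σ τ T := by
  rintro p ⟨c, hc, h1, h2⟩
  obtain ⟨d, hd, h3, h4⟩ := h hc
  exact ⟨d, hd, h3.trans h1, h4.trans h2⟩

theorem quadHull_mono {σ τ : ℝ} {S T : Finset ManhattanPlane} (h : S ⊆ T) :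
    quadHull σ τ S ⊆ quadHull σ τ T :=
  fun _ ⟨c, hc, h'⟩ => ⟨c, h hc, h'⟩

theorem subset_quadHull (σ τ : ℝ) (S : Finset ManhattanPlane) :
    (S : Set ManhattanPlane) ⊆ quadHull σ τ S := fun p hp => ⟨p, hp, le_rfl, le_rfl⟩

theorem isClosed_quadHull (σ τ : ℝ) (S : Finset ManhattanPlane) : IsClosed (quadHull σ τ S) := by
  have : quadHull σ τ S = ⋃ c ∈ (S : Set ManhattanPlane),
      ({p | σ * c.fst ≤ σ * p.fst} ∩ {p | τ * c.snd ≤ τ * p.snd}) := by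
    ext p
    simp only [quadHull, Set.mem_ofPred_eq, Set.mem_iUnion, Set.mem_inter_iff, exists_prop,
      Finset.mem_coe]
  rw [this]
  have c1 := continuous_plane_fst
  have c2 := continuous_plane_snd
  exact S.finite_toSet.isClosed_biUnion fun c _ =>
    (isClosed_le continuous_const (continuous_const.mul c1)).inter
      (isClosed_le continuous_const (continuous_const.mul c2))

/-- The orthogonal hull: all four closed quadrants at the point meet `S`. -/
def orthHull (S : Finset ManhattanPlane) : Set ManhattanPlane :=
  {p | ∀ σ τ, IsSign σ → IsSign τ → p ∈ quadHull σ τ S}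

theorem mem_orthHull_iff {σ τ : ℝ} (hσ : IsSign σ) (hτ : IsSign τ) {S : Finset ManhattanPlane}
    {p : ManhattanPlane} : p ∈ orthHull S ↔ p ∈ quadHull σ τ S ∧ p ∈ quadHull σ (-τ) S ∧
      p ∈ quadHull (-σ) τ S ∧ p ∈ quadHull (-σ) (-τ) S := by
  constructor
  · exact fun h => ⟨h _ _ hσ hτ, h _ _ hσ hτ.neg, h _ _ hσ.neg hτ, h _ _ hσ.neg hτ.neg⟩
  · rintro ⟨h1, h2, h3, h4⟩ σ' τ' hσ' hτ'
    rcases hσ with rfl | rfl <;> rcases hτ with rfl | rfl <;> rcases hσ' with rfl | rfl <;>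
      rcases hτ' with rfl | rfl <;> (try simp only [neg_neg] at *) <;> assumption

theorem subset_orthHull (S : Finset ManhattanPlane) : (S : Set ManhattanPlane) ⊆ orthHull S :=
  fun _ hp σ τ _ _ => subset_quadHull σ τ S hp

theorem isClosed_orthHull (S : Finset ManhattanPlane) : IsClosed (orthHull S) := by
  have : orthHull S = (quadHull 1 1 S ∩ quadHull 1 (-1) S) ∩
      (quadHull (-1) 1 S ∩ quadHull (-1) (-1) S) := by
    ext p
    rw [mem_orthHull_iff isSign_one isSign_one]
    simp [and_assoc]
  rw [this]
  exact ((isClosed_quadHull _ _ _).inter (isClosed_quadHull _ _ _)).inter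
    ((isClosed_quadHull _ _ _).inter (isClosed_quadHull _ _ _))

theorem inBox_of_mem_orthHull {S : Finset ManhattanPlane} {p : ManhattanPlane}
    (hp : p ∈ orthHull S) : InBox S p := by
  obtain ⟨a, ha, ha1, ha2⟩ := hp 1 1 isSign_one isSign_one
  obtain ⟨b, hb, hb1, hb2⟩ := hp (-1) (-1) isSign_neg_one isSign_neg_one
  exact ⟨⟨a, ha, by linarith⟩, ⟨b, hb, by linarith⟩, ⟨a, ha, by linarith⟩, ⟨b, hb, by linarith⟩⟩

/-- Geodesically convex sets contain the orthogonal hulls of their finite subsets. -/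
theorem GeodesicallyConvex.orthHull_subset {C : Set ManhattanPlane} (hC : GeodesicallyConvex C)
    {S : Finset ManhattanPlane} (hS : (S : Set ManhattanPlane) ⊆ C) : orthHull S ⊆ C := by
  intro p hp
  obtain ⟨c₁, h1, h1x, h1y⟩ := hp 1 1 isSign_one isSign_one
  obtain ⟨c₂, h2, h2x, h2y⟩ := hp 1 (-1) isSign_one isSign_neg_one
  obtain ⟨c₃, h3, h3x, h3y⟩ := hp (-1) (-1) isSign_neg_one isSign_neg_one
  obtain ⟨c₄, h4, h4x, h4y⟩ := hp (-1) 1 isSign_neg_one isSign_one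
  -- The geodesic joining the two left witnesses crosses the row of `p` weakly to the left of `p`,
  -- the one joining the two right witnesses weakly to the right; the row segment between the
  -- crossings contains `p`.
  obtain ⟨z, hz, hzb, hzy⟩ := hC.exists_eq continuous_plane_snd (hS h1) (hS h2) (s := p.snd)
    (by linarith) (by linarith)
  obtain ⟨w, hw, hwb, hwy⟩ := hC.exists_eq continuous_plane_snd (hS h4) (hS h3) (s := p.snd)
    (by linarith) (by linarith)
  refine hC.mem_of_row hz hw hzy hwy ?_ ?_
  · rcases (btw_plane.1 hzb).1 with k | k <;> linarith [k.1, k.2]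
  · rcases (btw_plane.1 hwb).1 with k | k <;> linarith [k.1, k.2]

/-! ### Splittings, the obstruction to the convexity of an orthogonal hull -/

/-- `side` separates `S` into two parts, one of them strictly to the left of the other and strictly
below it for `ε = 1`, strictly above it for `ε = -1`. -/
def SplitBy (ε : ℝ) (side : ManhattanPlane → Prop) (S : Finset ManhattanPlane) : Prop :=
  ∀ s ∈ S, ∀ t ∈ S, side s → ¬ side t → s.fst < t.fst ∧ ε * s.snd < ε * t.snd

/-- `S` splits into two non-empty parts. -/
def Splits (ε : ℝ) (S : Finset ManhattanPlane) : Prop :=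
  ∃ side, (∃ s ∈ S, side s) ∧ (∃ s ∈ S, ¬ side s) ∧ SplitBy ε side S

theorem SplitBy.iff_of_fst {ε : ℝ} {side : ManhattanPlane → Prop} {S : Finset ManhattanPlane}
    (h : SplitBy ε side S) {s t : ManhattanPlane} (hs : s ∈ S) (ht : t ∈ S)
    (e : s.fst = t.fst) : side s ↔ side t := by
  constructor
  · intro k
    by_contra hno
    exact absurd (h s hs t ht k hno).1 (by rw [e]; exact lt_irrefl _)
  · intro k
    by_contra hno
    exact absurd (h t ht s hs k hno).1 (by rw [e]; exact lt_irrefl _)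

theorem SplitBy.iff_of_snd {ε : ℝ} {side : ManhattanPlane → Prop} {S : Finset ManhattanPlane}
    (h : SplitBy ε side S) {s t : ManhattanPlane} (hs : s ∈ S) (ht : t ∈ S)
    (e : s.snd = t.snd) : side s ↔ side t := by
  constructor
  · intro k
    by_contra hno
    exact absurd (h s hs t ht k hno).2 (by rw [e]; exact lt_irrefl _)
  · intro k
    by_contra hno
    exact absurd (h t ht s hs k hno).2 (by rw [e]; exact lt_irrefl _)

/-- A point in the column of `b` is on the same side as `b`, so omitting it empties neither part. -/
theorem Splits.of_insert {ε : ℝ} {S : Finset ManhattanPlane} {w b : ManhattanPlane} (hb : b ∈ S)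
    (e : w.fst = b.fst) (h : Splits ε (insert w S)) : Splits ε S := by
  obtain ⟨side, ⟨s, hs, hs'⟩, ⟨t, ht, ht'⟩, h⟩ := h
  have hwb := h.iff_of_fst (Finset.mem_insert_self w S) (Finset.mem_insert_of_mem hb) e
  refine ⟨side, ?_, ?_, fun s hs t ht => h s (Finset.mem_insert_of_mem hs) t
    (Finset.mem_insert_of_mem ht)⟩
  · rcases Finset.mem_insert.1 hs with rfl | hs
    · exact ⟨b, hb, hwb.1 hs'⟩
    · exact ⟨s, hs, hs'⟩
  · rcases Finset.mem_insert.1 ht with rfl | ht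
    · exact ⟨b, hb, fun k => ht' (hwb.2 k)⟩
    · exact ⟨t, ht, ht'⟩

theorem Splits.of_sign {σ τ : ℝ} (hσ : IsSign σ) {S : Finset ManhattanPlane}
    {side : ManhattanPlane → Prop} (h1 : ∃ s ∈ S, side s) (h2 : ∃ s ∈ S, ¬ side s)
    (h : ∀ s ∈ S, ∀ t ∈ S, side s → ¬ side t →
      σ * s.fst < σ * t.fst ∧ τ * s.snd < τ * t.snd) : Splits (σ * τ) S := by
  rcases hσ with rfl | rfl
  · exact ⟨side, h1, h2, fun s hs t ht k k' => by simpa using h s hs t ht k k'⟩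
  · refine ⟨fun s => ¬ side s, h2, ?_, fun s hs t ht k k' => ?_⟩
    · obtain ⟨s, hs, k⟩ := h1
      exact ⟨s, hs, not_not.2 k⟩
    · have := h t ht s hs (not_not.1 k') k
      constructor <;> linarith [this.1, this.2]

/-- Moving along the row of `p` towards `q`, but not past the column of `c`, the two rear quadrants
keep the witnesses of `p`, one forward quadrant contains `c`, and the other contains a witness of
`q`. -/
theorem orthHull_step_horizontal {σ τ : ℝ} (hσ : IsSign σ) (hτ : IsSign τ)
    {S : Finset ManhattanPlane} {p q c : ManhattanPlane} (hp : p ∈ orthHull S)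
    (hq : q ∈ orthHull S) (hx : σ * p.fst < σ * q.fst) (hy : τ * p.snd ≤ τ * q.snd) (hc : c ∈ S)
    (hcx : σ * p.fst < σ * c.fst) (hcy : τ * c.snd ≤ τ * p.snd) :
    ∃ z ∈ orthHull S, z ≠ p ∧ z ≠ q ∧ MBtw p z q := by
  obtain ⟨x, hxx⟩ : ∃ x, σ * x = min (σ * c.fst) ((σ * p.fst + σ * q.fst) / 2) :=
    ⟨σ * min (σ * c.fst) ((σ * p.fst + σ * q.fst) / 2), by rcases hσ with rfl | rfl <;> ring⟩
  have h1 : σ * p.fst < σ * x := hxx ▸ lt_min hcx (by linarith)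
  have h2 : σ * x ≤ σ * c.fst := hxx ▸ min_le_left _ _
  have h3 : σ * x < σ * q.fst := lt_of_le_of_lt (hxx ▸ min_le_right _ _) (by linarith)
  rw [mem_orthHull_iff hσ hτ] at hp hq
  refine ⟨mkPoint x p.snd, (mem_orthHull_iff hσ hτ).2 ⟨?_, ?_, ?_, ?_⟩, ?_, ?_, ?_⟩
  · obtain ⟨e, he, h4, h5⟩ := hp.1
    exact ⟨e, he, h4.trans h1.le, h5⟩
  · obtain ⟨e, he, h4, h5⟩ := hp.2.1
    exact ⟨e, he, h4.trans h1.le, h5⟩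
  · exact ⟨c, hc, by simp only [mkPoint_fst]; linarith, hcy⟩
  · obtain ⟨e, he, h4, h5⟩ := hq.2.2.2
    exact ⟨e, he, by simp only [mkPoint_fst]; linarith, by simp only [mkPoint_snd]; linarith⟩
  · intro e
    rw [← e] at h1
    simp at h1
  · intro e
    rw [← e] at h3
    simp at h3
  · rw [btw_plane]
    simp only [mkPoint_fst, mkPoint_snd]
    refine ⟨?_, ?_⟩
    · rcases hσ with rfl | rfl
      · left; constructor <;> linarith
      · right; constructor <;> linarith
    · rw [mid_iff_abs]
      simp

theorem orthHull_step_vertical {σ τ : ℝ} (hσ : IsSign σ) (hτ : IsSign τ)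
    {S : Finset ManhattanPlane} {p q c : ManhattanPlane} (hp : p ∈ orthHull S)
    (hq : q ∈ orthHull S) (hx : σ * p.fst ≤ σ * q.fst) (hy : τ * p.snd < τ * q.snd) (hc : c ∈ S)
    (hcx : σ * c.fst ≤ σ * p.fst) (hcy : τ * p.snd < τ * c.snd) :
    ∃ z ∈ orthHull S, z ≠ p ∧ z ≠ q ∧ MBtw p z q := by
  obtain ⟨y, hyy⟩ : ∃ y, τ * y = min (τ * c.snd) ((τ * p.snd + τ * q.snd) / 2) :=
    ⟨τ * min (τ * c.snd) ((τ * p.snd + τ * q.snd) / 2), by rcases hτ with rfl | rfl <;> ring⟩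
  have h1 : τ * p.snd < τ * y := hyy ▸ lt_min hcy (by linarith)
  have h2 : τ * y ≤ τ * c.snd := hyy ▸ min_le_left _ _
  have h3 : τ * y < τ * q.snd := lt_of_le_of_lt (hyy ▸ min_le_right _ _) (by linarith)
  rw [mem_orthHull_iff hσ hτ] at hp hq
  refine ⟨mkPoint p.fst y, (mem_orthHull_iff hσ hτ).2 ⟨?_, ?_, ?_, ?_⟩, ?_, ?_, ?_⟩
  · obtain ⟨e, he, h4, h5⟩ := hp.1
    exact ⟨e, he, h4, h5.trans h1.le⟩
  · exact ⟨c, hc, hcx, by simp only [mkPoint_snd]; linarith⟩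
  · obtain ⟨e, he, h4, h5⟩ := hp.2.2.1
    exact ⟨e, he, h4, h5.trans h1.le⟩
  · obtain ⟨e, he, h4, h5⟩ := hq.2.2.2
    exact ⟨e, he, by simp only [mkPoint_fst]; linarith, by simp only [mkPoint_snd]; linarith⟩
  · intro e
    rw [← e] at h1
    simp at h1
  · intro e
    rw [← e] at h3
    simp at h3
  · rw [btw_plane]
    simp only [mkPoint_fst, mkPoint_snd]
    refine ⟨?_, ?_⟩
    · rw [mid_iff_abs]
      simp
    · rcases hτ with rfl | rfl
      · left; constructor <;> linarith
      · right; constructor <;> linarith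

theorem exists_sign (x y : ℝ) : ∃ σ, IsSign σ ∧ σ * x ≤ σ * y := by
  rcases le_total x y with h | h
  · exact ⟨1, isSign_one, by linarith⟩
  · exact ⟨-1, isSign_neg_one, by linarith⟩

theorem isCompact_inBox {S : Finset ManhattanPlane} :
    IsCompact {p | InBox (S : Set ManhattanPlane) p} := by
  obtain ⟨M, hM⟩ : ∃ M : ℝ, ∀ a ∈ S, |a.fst| ≤ M ∧ |a.snd| ≤ M := by
    refine ⟨∑ a ∈ S, (|a.fst| + |a.snd|), fun a ha => ?_⟩
    have := Finset.single_le_sum (f := fun a : ManhattanPlane => |a.fst| + |a.snd|)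
      (fun a _ => add_nonneg (abs_nonneg _) (abs_nonneg _)) ha
    constructor <;> linarith [abs_nonneg a.fst, abs_nonneg a.snd]
  refine (isCompact_closedBall (mkPoint 0 0) (M + M)).of_isClosed_subset (isClosed_inBox S) ?_
  rintro p ⟨⟨a, ha, ha'⟩, ⟨b, hb, hb'⟩, ⟨c, hc, hc'⟩, ⟨d, hd, hd'⟩⟩
  rw [Metric.mem_closedBall, plane_dist]
  simp only [mkPoint_fst, mkPoint_snd, sub_zero]
  have h1 := abs_le.1 (hM a ha).1
  have h2 := abs_le.1 (hM b hb).1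
  have h3 := abs_le.1 (hM c hc).2
  have h4 := abs_le.1 (hM d hd).2
  exact add_le_add (abs_le.2 ⟨by linarith, by linarith⟩) (abs_le.2 ⟨by linarith, by linarith⟩)

/-- The orthogonal hull of a set without splittings is geodesically convex. -/
theorem geodesicallyConvex_orthHull {S : Finset ManhattanPlane} (h1 : ¬ Splits 1 S)
    (h2 : ¬ Splits (-1) S) : GeodesicallyConvex (orthHull S) := by
  refine GeodesicallyConvex.of_menger (isCompact_inBox.of_isClosed_subset (isClosed_orthHull S)
    fun p hp => inBox_of_mem_orthHull hp) ?_
  intro p hp q hq hpq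
  obtain ⟨σ, hσ, hx⟩ := exists_sign p.fst q.fst
  obtain ⟨τ, hτ, hy⟩ := exists_sign p.snd q.snd
  have hp' := (mem_orthHull_iff hσ hτ).1 hp
  have hq' := (mem_orthHull_iff hσ hτ).1 hq
  by_cases hx0 : σ * p.fst = σ * q.fst
  · have hy0 : τ * p.snd ≠ τ * q.snd := fun e => hpq (plane_ext (hσ.eq_of_mul hx0) (hτ.eq_of_mul e))
    have hy1 := lt_of_le_of_ne hy hy0
    obtain ⟨c, hc, hc1, hc2⟩ := hq'.2.1
    exact orthHull_step_vertical hσ hτ hp hq hx hy1 hc (by linarith) (by linarith)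
  have hx1 := lt_of_le_of_ne hx hx0
  by_cases hy0 : τ * p.snd = τ * q.snd
  · obtain ⟨c, hc, hc1, hc2⟩ := hq'.2.2.1
    exact orthHull_step_horizontal hσ hτ hp hq hx1 hy hc (by linarith) (by linarith)
  have hy1 := lt_of_le_of_ne hy hy0
  -- If neither a horizontal nor a vertical step from `p` is possible, the column of `p` divides `S`
  -- into two parts that the row of `p` divides in the same way: a splitting of sign `σ * τ`.
  by_contra hno
  have k1 : ∀ c ∈ S, σ * p.fst < σ * c.fst → τ * p.snd < τ * c.snd := fun c hc hcx => by
    by_contra hcy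
    exact hno (orthHull_step_horizontal hσ hτ hp hq hx1 hy hc hcx (not_lt.1 hcy))
  have k2 : ∀ c ∈ S, σ * c.fst ≤ σ * p.fst → τ * c.snd ≤ τ * p.snd := fun c hc hcx => by
    by_contra hcy
    exact hno (orthHull_step_vertical hσ hτ hp hq hx hy1 hc hcx (not_le.1 hcy))
  have hs : Splits (σ * τ) S := by
    refine Splits.of_sign hσ (side := fun s => σ * s.fst ≤ σ * p.fst) ?_ ?_ ?_
    · obtain ⟨c, hc, hc1, hc2⟩ := hp'.1
      exact ⟨c, hc, hc1⟩
    · obtain ⟨c, hc, hc1, hc2⟩ := hq'.2.2.2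
      exact ⟨c, hc, by linarith⟩
    · intro s hs t ht hs' ht'
      rw [not_le] at ht'
      exact ⟨lt_of_le_of_lt hs' ht', lt_of_le_of_lt (k2 s hs hs') (k1 t ht ht')⟩
  rcases hσ with rfl | rfl <;> rcases hτ with rfl | rfl <;> norm_num at hs <;> contradiction

/-! ## The corner procedure -/

/-- The box cut off in one step of the corner procedure. -/
def signedBox (σ τ : ℝ) (a b d : ManhattanPlane) : Set ManhattanPlane :=
  {p | σ * a.fst ≤ σ * p.fst ∧ σ * p.fst < σ * b.fst ∧ τ * a.snd ≤ τ * p.snd ∧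
    τ * p.snd < τ * d.snd}

/-- The invariants of the corner procedure at a corner of type `(σ, τ)`. -/
structure CornerInv (σ τ : ℝ) (A : Finset ManhattanPlane) (a : ManhattanPlane) : Prop where
  bound : ∀ c ∈ A, σ * a.fst ≤ σ * c.fst
  -- The rows already passed hold no point closer to the corner column than the first point of the
  -- current row.
  below : ∀ c ∈ A, τ * c.snd ≤ τ * a.snd → ∃ r ∈ A, r.snd = a.snd ∧ σ * r.fst ≤ σ * c.fst

/-- The choices `b` and `d` made in one step of the corner procedure. -/
structure CutStep (σ τ : ℝ) (A : Finset ManhattanPlane) (a b d : ManhattanPlane) : Prop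
    extends CornerInv σ τ A a where
  b_mem : b ∈ A
  b_row : b.snd = a.snd
  b_min : ∀ c ∈ A, c.snd = a.snd → σ * b.fst ≤ σ * c.fst
  d_mem : d ∈ A
  d_le : σ * d.fst ≤ σ * b.fst
  d_lt : τ * a.snd < τ * d.snd
  d_min : ∀ c ∈ A, σ * c.fst ≤ σ * b.fst → τ * a.snd < τ * c.snd → τ * d.snd ≤ τ * c.snd

/-- Points up to the current row are handled by the invariant and the choice of `b`, points between
the rows of `a` and `d` by the choice of `d`. In particular the removed box contains no point of
`A`. -/
theorem CutStep.empty {σ τ : ℝ} {A : Finset ManhattanPlane} {a b d : ManhattanPlane}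
    (h : CutStep σ τ A a b d) : ∀ c ∈ A, τ * c.snd < τ * d.snd → σ * b.fst ≤ σ * c.fst := by
  intro c hc hcd
  rcases le_or_gt (τ * c.snd) (τ * a.snd) with k | k
  · obtain ⟨r, hr, e, hrc⟩ := h.below c hc k
    exact (h.b_min r hr e).trans hrc
  · by_contra hno
    exact absurd (h.d_min c hc (not_le.1 hno).le k) (not_le.2 hcd)

theorem CutStep.next {σ τ : ℝ} (hτ : IsSign τ) {A : Finset ManhattanPlane}
    {a b d : ManhattanPlane} (h : CutStep σ τ A a b d) :
    CornerInv σ τ (insert (mkPoint b.fst d.snd) A) (mkPoint a.fst d.snd) := by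
  constructor
  · intro c hc
    rcases Finset.mem_insert.1 hc with rfl | hc
    · exact h.bound b h.b_mem
    · exact h.bound c hc
  · intro c hc hcd
    simp only [mkPoint_snd] at hcd
    rcases Finset.mem_insert.1 hc with rfl | hc'
    · exact ⟨_, hc, rfl, le_rfl⟩
    · rcases hcd.lt_or_eq with k | k
      · exact ⟨_, Finset.mem_insert_self _ _, rfl, h.empty c hc' k⟩
      · exact ⟨c, hc, hτ.eq_of_mul k, le_rfl⟩

/-- The corner procedure in signed coordinates. -/
inductive SignedRun (σ τ : ℝ) : Finset ManhattanPlane → Set ManhattanPlane →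
    ManhattanPlane → Finset ManhattanPlane → Set ManhattanPlane → Prop
  | done (A : Finset ManhattanPlane) (P : Set ManhattanPlane) (a : ManhattanPlane) (ha : a ∈ A) :
      SignedRun σ τ A P a A P
  | cut (A : Finset ManhattanPlane) (P : Set ManhattanPlane) (a b d : ManhattanPlane)
      (A' : Finset ManhattanPlane) (P' : Set ManhattanPlane) (ha : a ∉ A)
      (h : CutStep σ τ A a b d)
      (hrun : SignedRun σ τ (insert (mkPoint b.fst d.snd) A) (P \ signedBox σ τ a b d)
        (mkPoint a.fst d.snd) A' P') :
      SignedRun σ τ A P a A' P'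

theorem mem_uIcc_sign {σ x a b : ℝ} (hσ : IsSign σ) (h : σ * a ≤ σ * b) :
    x ∈ Set.uIcc a b ↔ σ * a ≤ σ * x ∧ σ * x ≤ σ * b := by
  rcases hσ with rfl | rfl
  · rw [Set.uIcc_of_le (by linarith), Set.mem_Icc]
    simp
  · rw [Set.uIcc_of_ge (by linarith), Set.mem_Icc]
    constructor <;> rintro ⟨h1, h2⟩ <;> constructor <;> linarith

theorem abs_sub_le_sign {σ x y a : ℝ} (hσ : IsSign σ) (h1 : σ * a ≤ σ * x) (h2 : σ * a ≤ σ * y) :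
    |x - a| ≤ |y - a| ↔ σ * x ≤ σ * y := by
  rcases hσ with rfl | rfl
  · rw [abs_of_nonneg (by linarith), abs_of_nonneg (by linarith)]
    constructor <;> intro <;> linarith
  · rw [abs_of_nonpos (by linarith), abs_of_nonpos (by linarith)]
    constructor <;> intro <;> linarith

theorem cutBox_eq {σ τ : ℝ} (hσ : IsSign σ) (hτ : IsSign τ) {a b d : ManhattanPlane}
    (h1 : σ * a.fst ≤ σ * b.fst) (h2 : τ * a.snd ≤ τ * d.snd) :
    cutBox a b d = signedBox σ τ a b d := by
  ext p
  simp only [cutBox, signedBox, Set.mem_ofPred_eq]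
  rw [mem_uIcc_sign hσ h1, mem_uIcc_sign hτ h2]
  constructor
  · rintro ⟨⟨h3, h4⟩, h5, ⟨h6, h7⟩, h8⟩
    exact ⟨h3, lt_of_le_of_ne h4 fun e => h5 (hσ.eq_of_mul e), h6,
      lt_of_le_of_ne h7 fun e => h8 (hτ.eq_of_mul e)⟩
  · rintro ⟨h3, h4, h5, h6⟩
    exact ⟨⟨h3, h4.le⟩, fun e => h4.ne (by rw [e]), ⟨h5, h6.le⟩, fun e => h6.ne (by rw [e])⟩

theorem dist_le_iff_of_row {σ : ℝ} (hσ : IsSign σ) {a b c : ManhattanPlane} (hb : b.snd = a.snd)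
    (hc : c.snd = a.snd) (h1 : σ * a.fst ≤ σ * b.fst) (h2 : σ * a.fst ≤ σ * c.fst) :
    dist a b ≤ dist a c ↔ σ * b.fst ≤ σ * c.fst := by
  rw [plane_dist, plane_dist, hb, hc, sub_self, abs_zero, add_zero, add_zero, abs_sub_comm,
    abs_sub_comm a.fst, abs_sub_le_sign hσ h1 h2]

theorem CornerRun.signedRun {ahead : ℝ → ℝ → Prop} {σ τ : ℝ} (hσ : IsSign σ) (hτ : IsSign τ)
    (hah : ∀ y y', ahead y y' ↔ τ * y < τ * y') {A A' : Finset ManhattanPlane}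
    {P P' : Set ManhattanPlane} {a : ManhattanPlane} (h : CornerRun ahead A P a A' P')
    (hinv : CornerInv σ τ A a) : SignedRun σ τ A P a A' P' := by
  induction h with
  | done A P a ha => exact SignedRun.done A P a ha
  | cut A P a b d A' P' ha hb hb_min hd hd_min hrun ih =>
    have hab := hinv.bound b hb.1
    have hu : ∀ x, x ∈ Set.uIcc a.fst b.fst ↔ _ := fun x => mem_uIcc_sign hσ hab
    have had := (hah _ _).1 hd.2.2
    have step : CutStep σ τ A a b d := by
      refine ⟨hinv, hb.1, hb.2, fun c hc e => ?_, hd.1, ((hu _).1 hd.2.1).2, had,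
        fun c hc h1 h2 => ?_⟩
      · exact (dist_le_iff_of_row hσ hb.2 e hab (hinv.bound c hc)).1 (hb_min c hc e)
      · exact (abs_sub_le_sign hτ had.le h2.le).1
          (hd_min c hc ((hu _).2 ⟨hinv.bound c hc, h1⟩) ((hah _ _).2 h2))
    rw [cutBox_eq hσ hτ hab had.le] at ih
    exact SignedRun.cut A P a b d A' P' ha step (ih (step.next hτ))

theorem SignedRun.cornerRun {ahead : ℝ → ℝ → Prop} {σ τ : ℝ} (hσ : IsSign σ) (hτ : IsSign τ)
    (hah : ∀ y y', ahead y y' ↔ τ * y < τ * y') {A A' : Finset ManhattanPlane}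
    {P P' : Set ManhattanPlane} {a : ManhattanPlane} (h : SignedRun σ τ A P a A' P') :
    CornerRun ahead A P a A' P' := by
  induction h with
  | done A P a ha => exact CornerRun.done A P a ha
  | cut A P a b d A' P' ha h hrun ih =>
    have hab := h.bound b h.b_mem
    have hu : ∀ x, x ∈ Set.uIcc a.fst b.fst ↔ _ := fun x => mem_uIcc_sign hσ hab
    rw [← cutBox_eq hσ hτ hab h.d_lt.le] at ih
    refine CornerRun.cut A P a b d A' P' ha ⟨h.b_mem, h.b_row⟩ (fun c hc e => ?_)
      ⟨h.d_mem, (hu _).2 ⟨h.bound d h.d_mem, h.d_le⟩, (hah _ _).2 h.d_lt⟩ (fun c hc h1 h2 => ?_) ih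
    · exact (dist_le_iff_of_row hσ h.b_row e hab (h.bound c hc)).2 (h.b_min c hc e)
    · have h2 := (hah _ _).1 h2
      exact (abs_sub_le_sign hτ h.d_lt.le h2.le).2 (h.d_min c hc ((hu _).1 h1).2 h2)

/-- A step depends on `b` and `d` only through `b.fst` and `d.snd`, and both are determined as
minima. -/
theorem SignedRun.unique {σ τ : ℝ} (hσ : IsSign σ) (hτ : IsSign τ)
    {A A₁ A₂ : Finset ManhattanPlane} {P P₁ P₂ : Set ManhattanPlane} {a : ManhattanPlane}
    (h₁ : SignedRun σ τ A P a A₁ P₁) (h₂ : SignedRun σ τ A P a A₂ P₂) : A₁ = A₂ ∧ P₁ = P₂ := by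
  induction h₁ with
  | done A P a ha =>
    cases h₂ with
    | done => exact ⟨rfl, rfl⟩
    | cut _ _ _ b d _ _ ha' => exact absurd ha ha'
  | cut A P a b d A' P' ha h hrun ih =>
    cases h₂ with
    | done _ _ _ ha' => exact absurd ha' ha
    | cut _ _ _ b' d' _ _ _ h' hrun' =>
      have eb : b.fst = b'.fst := hσ.eq_of_mul (le_antisymm (h.b_min b' h'.b_mem h'.b_row)
        (h'.b_min b h.b_mem h.b_row))
      have ed : d.snd = d'.snd := hτ.eq_of_mul (le_antisymm
        (h.d_min d' h'.d_mem (eb ▸ h'.d_le) h'.d_lt) (h'.d_min d h.d_mem (eb ▸ h.d_le) h.d_lt))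
      refine ih ?_
      have e : signedBox σ τ a b d = signedBox σ τ a b' d' := by
        rw [signedBox, signedBox, eb, ed]
      rw [e, eb, ed]
      exact hrun'

/-- The number of points strictly beyond the current row decreases: `d` drops out, and the added
point lies on the new row. The point `l` in the corner column is always a candidate for `d` until
the corner reaches `A`. -/
theorem SignedRun.exists {σ τ : ℝ} (hτ : IsSign τ) (n : ℕ)
    {A : Finset ManhattanPlane} (P : Set ManhattanPlane) {a : ManhattanPlane}
    (hn : (A.filter fun c => τ * a.snd < τ * c.snd).card = n) (hinv : CornerInv σ τ A a)
    (hl : ∃ l ∈ A, l.fst = a.fst ∧ τ * a.snd ≤ τ * l.snd) (hr : ∃ r ∈ A, r.snd = a.snd) :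
    ∃ A' P', SignedRun σ τ A P a A' P' := by
  induction n using Nat.strong_induction_on generalizing A P a with
  | _ n ih =>
  by_cases ha : a ∈ A
  · exact ⟨A, P, SignedRun.done A P a ha⟩
  obtain ⟨l, hl, hla, hly⟩ := hl
  obtain ⟨r, hr, hra⟩ := hr
  obtain ⟨b, hb, hbmin⟩ := (A.filter fun c => c.snd = a.snd).exists_min_image
    (fun c => σ * c.fst) ⟨r, Finset.mem_filter.2 ⟨hr, hra⟩⟩
  rw [Finset.mem_filter] at hb
  have hly' : τ * a.snd < τ * l.snd := lt_of_le_of_ne hly fun e =>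
    ha (plane_ext hla (hτ.eq_of_mul e.symm) ▸ hl)
  have hlb : σ * l.fst ≤ σ * b.fst := hla ▸ hinv.bound b hb.1
  obtain ⟨d, hd, hdmin⟩ := (A.filter fun c => σ * c.fst ≤ σ * b.fst ∧
    τ * a.snd < τ * c.snd).exists_min_image (fun c => τ * c.snd)
    ⟨l, Finset.mem_filter.2 ⟨hl, hlb, hly'⟩⟩
  rw [Finset.mem_filter] at hd
  have step : CutStep σ τ A a b d := ⟨hinv, hb.1, hb.2,
    fun c hc e => hbmin c (Finset.mem_filter.2 ⟨hc, e⟩), hd.1, hd.2.1, hd.2.2,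
    fun c hc h1 h2 => hdmin c (Finset.mem_filter.2 ⟨hc, h1, h2⟩)⟩
  have hlt : ((insert (mkPoint b.fst d.snd) A).filter fun c =>
      τ * (mkPoint a.fst d.snd).snd < τ * c.snd).card < n := by
    rw [← hn]
    refine Finset.card_lt_card (Finset.ssubset_iff_of_subset (fun c hc => ?_) |>.2
      ⟨d, Finset.mem_filter.2 ⟨hd.1, hd.2.2⟩, fun h => ?_⟩)
    · rw [Finset.mem_filter, mkPoint_snd] at hc
      rcases Finset.mem_insert.1 hc.1 with rfl | hcA
      · exact absurd hc.2 (lt_irrefl _)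
      · exact Finset.mem_filter.2 ⟨hcA, hd.2.2.trans hc.2⟩
    · exact absurd (Finset.mem_filter.1 h).2 (lt_irrefl _)
  obtain ⟨A', P', hrun⟩ := ih _ hlt (P \ signedBox σ τ a b d) rfl (step.next hτ)
    ⟨l, Finset.mem_insert_of_mem hl, hla, step.d_min l hl hlb hly'⟩
    ⟨_, Finset.mem_insert_self _ _, rfl⟩
  exact ⟨A', P', SignedRun.cut A P a b d A' P' ha step hrun⟩

theorem SignedRun.subset {σ τ : ℝ} {A A' : Finset ManhattanPlane} {P P' : Set ManhattanPlane}
    {a : ManhattanPlane} (h : SignedRun σ τ A P a A' P') : A ⊆ A' := by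
  induction h with
  | done => exact Finset.Subset.refl _
  | cut A P a b d A' P' ha h hrun ih => exact (Finset.subset_insert _ _).trans ih

theorem SignedRun.region_subset {σ τ : ℝ} {A A' : Finset ManhattanPlane}
    {P P' : Set ManhattanPlane} {a : ManhattanPlane} (h : SignedRun σ τ A P a A' P') : P' ⊆ P := by
  induction h with
  | done => exact Set.Subset.refl _
  | cut A P a b d A' P' ha h hrun ih => exact ih.trans Set.sdiff_subset

/-- The region that is left by the corner procedure. -/
theorem SignedRun.mem_iff {σ τ : ℝ} {A A' : Finset ManhattanPlane}
    {P P' : Set ManhattanPlane} {a : ManhattanPlane} (h : SignedRun σ τ A P a A' P')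
    {p : ManhattanPlane} (hp : σ * a.fst ≤ σ * p.fst) :
    p ∈ P' ↔ p ∈ P ∧ (τ * a.snd ≤ τ * p.snd → p ∈ quadHull σ τ A) := by
  induction h with
  | done A P a ha =>
    exact ⟨fun h => ⟨h, fun h' => ⟨a, ha, hp, h'⟩⟩, fun h => h.1⟩
  | cut A P a b d A' P' ha h hrun ih =>
    -- The added point lies in the quadrant of `b`, so it does not enlarge the hull of this type.
    have hQ : quadHull σ τ (insert (mkPoint b.fst d.snd) A) ⊆ quadHull σ τ A := by
      refine quadHull_trans fun c hc => ?_
      rcases Finset.mem_insert.1 hc with rfl | hc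
      · exact ⟨b, h.b_mem, le_rfl, by rw [h.b_row]; exact h.d_lt.le⟩
      · exact subset_quadHull σ τ A hc
    rw [ih hp, mkPoint_snd, Set.mem_sdiff]
    constructor
    · rintro ⟨⟨h1, h2⟩, h3⟩
      refine ⟨h1, fun hpa => ?_⟩
      rcases le_or_gt (τ * d.snd) (τ * p.snd) with k | k
      · exact hQ (h3 k)
      · have : σ * b.fst ≤ σ * p.fst := by
          by_contra hno
          exact h2 ⟨hp, not_le.1 hno, hpa, k⟩
        exact ⟨b, h.b_mem, this, by rw [h.b_row]; exact hpa⟩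
    · rintro ⟨h1, h2⟩
      refine ⟨⟨h1, ?_⟩, fun k => quadHull_mono (Finset.subset_insert _ _) (h2 (h.d_lt.le.trans k))⟩
      rintro ⟨-, h4, h5, h6⟩
      obtain ⟨c, hc, hc1, hc2⟩ := h2 h5
      have := h.empty c hc (lt_of_le_of_lt hc2 h6)
      linarith

/-- Induction over the points that are added in the corner procedure. -/
theorem SignedRun.induction_points {σ τ : ℝ} {A A' : Finset ManhattanPlane}
    {P P' : Set ManhattanPlane} {a : ManhattanPlane} (h : SignedRun σ τ A P a A' P')
    (Φ : Finset ManhattanPlane → Prop) (h0 : Φ A)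
    (h1 : ∀ S a b d, CutStep σ τ S a b d → (∀ p ∈ P', p ∉ signedBox σ τ a b d) → Φ S →
      Φ (insert (mkPoint b.fst d.snd) S)) : Φ A' := by
  induction h with
  | done => exact h0
  | cut A P a b d A' P' ha h hrun ih =>
    exact ih (h1 A a b d h (fun p hp => (hrun.region_subset hp).2) h0) h1

theorem SignedRun.not_splits {σ τ ε : ℝ} {A A' : Finset ManhattanPlane}
    {P P' : Set ManhattanPlane} {a : ManhattanPlane} (h : SignedRun σ τ A P a A' P')
    (hA : ¬ Splits ε A) : ¬ Splits ε A' :=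
  h.induction_points (fun S => ¬ Splits ε S) hA fun _ _ _ _ hS _ hn hs =>
    hn (hs.of_insert hS.b_mem (by rfl))

/-- The staircase of added points links `r` to `l` by shared rows and columns, and neither a row nor
a column can be divided by a splitting. -/
theorem SignedRun.side_iff {σ τ ε : ℝ} {A A' : Finset ManhattanPlane}
    {P P' : Set ManhattanPlane} {a : ManhattanPlane} (h : SignedRun σ τ A P a A' P')
    {side : ManhattanPlane → Prop} (hs : SplitBy ε side A') {l r : ManhattanPlane} (hl : l ∈ A)
    (hla : l.fst = a.fst) (hr : r ∈ A) (hra : r.snd = a.snd) : side l ↔ side r := by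
  induction h generalizing r with
  | done A P a ha => exact (hs.iff_of_fst hl ha hla).trans (hs.iff_of_snd ha hr hra.symm)
  | cut A P a b d A' P' ha h hrun ih =>
    have hsub := hrun.subset
    have hA : ∀ {s}, s ∈ A → s ∈ A' := fun hs => hsub (Finset.mem_insert_of_mem hs)
    have hw := Finset.mem_insert_self (mkPoint b.fst d.snd) A
    refine (ih hs (Finset.mem_insert_of_mem hl) hla hw rfl).trans ?_
    exact (hs.iff_of_fst (t := b) (hsub hw) (hA h.b_mem) rfl).trans
      (hs.iff_of_snd (hA h.b_mem) (hA hr) (h.b_row.trans hra.symm))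

/-- `a` is the corner of type `(σ, τ)` of the bounding box of `A`. -/
structure IsBoxCorner (σ τ : ℝ) (A : Finset ManhattanPlane) (a : ManhattanPlane) : Prop where
  fst_le : ∀ c ∈ A, σ * a.fst ≤ σ * c.fst
  snd_le : ∀ c ∈ A, τ * a.snd ≤ τ * c.snd
  exists_fst : ∃ l ∈ A, l.fst = a.fst
  exists_snd : ∃ r ∈ A, r.snd = a.snd

theorem IsBoxCorner.cornerInv {σ τ : ℝ} (hτ : IsSign τ) {A : Finset ManhattanPlane}
    {a : ManhattanPlane} (h : IsBoxCorner σ τ A a) : CornerInv σ τ A a :=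
  ⟨h.fst_le, fun c hc k => ⟨c, hc, hτ.eq_of_mul (le_antisymm k (h.snd_le c hc)), le_rfl⟩⟩

theorem le_of_inBox {σ : ℝ} (hσ : IsSign σ) {A : Finset ManhattanPlane} {p : ManhattanPlane} {x : ℝ}
    (h : ∀ c ∈ A, σ * x ≤ σ * c.fst) (hp : InBox A p) : σ * x ≤ σ * p.fst := by
  obtain ⟨⟨l, hl, hl'⟩, ⟨r, hr, hr'⟩, -⟩ := hp
  have h1 := h l hl
  have h2 := h r hr
  rcases hσ with rfl | rfl <;> linarith

theorem le_of_inBox_snd {σ : ℝ} (hσ : IsSign σ) {A : Finset ManhattanPlane} {p : ManhattanPlane}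
    {y : ℝ} (h : ∀ c ∈ A, σ * y ≤ σ * c.snd) (hp : InBox A p) : σ * y ≤ σ * p.snd := by
  obtain ⟨-, -, ⟨l, hl, hl'⟩, ⟨r, hr, hr'⟩⟩ := hp
  have h1 := h l hl
  have h2 := h r hr
  rcases hσ with rfl | rfl <;> linarith

theorem IsBoxCorner.mono {σ τ : ℝ} (hσ : IsSign σ) (hτ : IsSign τ) {A A' : Finset ManhattanPlane}
    {a : ManhattanPlane} (h : IsBoxCorner σ τ A a) (hA : A ⊆ A')
    (hA' : ∀ p ∈ A', InBox A p) : IsBoxCorner σ τ A' a :=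
  ⟨fun c hc => le_of_inBox hσ h.fst_le (hA' c hc), fun c hc => le_of_inBox_snd hτ h.snd_le (hA' c hc),
    let ⟨l, hl, e⟩ := h.exists_fst; ⟨l, hA hl, e⟩, let ⟨r, hr, e⟩ := h.exists_snd; ⟨r, hA hr, e⟩⟩

theorem SignedRun.inBox {σ τ : ℝ} {A A' : Finset ManhattanPlane}
    {P P' : Set ManhattanPlane} {a : ManhattanPlane} (h : SignedRun σ τ A P a A' P') :
    ∀ p ∈ A', InBox A p := by
  refine h.induction_points (fun S => ∀ p ∈ S, InBox (A : Set ManhattanPlane) p)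
    (fun p hp => InBox.of_mem hp) fun S a b d hS _ ih p hp => ?_
  rcases Finset.mem_insert.1 hp with rfl | hp
  · exact ⟨(ih b hS.b_mem).1, (ih b hS.b_mem).2.1, (ih d hS.d_mem).2.2⟩
  · exact ih p hp

/-- The procedure at a left corner leaves no splitting of the opposite type. -/
theorem SignedRun.not_splits_corner {τ : ℝ} (hτ : IsSign τ) {A A' : Finset ManhattanPlane}
    {P P' : Set ManhattanPlane} {a : ManhattanPlane} (h : SignedRun 1 τ A P a A' P')
    (ha : IsBoxCorner 1 τ A a) : ¬ Splits (-τ) A' := by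
  rintro ⟨side, ⟨s, hs, hs'⟩, ⟨t, ht, ht'⟩, hsp⟩
  have hc := ha.mono isSign_one hτ h.subset h.inBox
  obtain ⟨l, hl, hla⟩ := ha.exists_fst
  obtain ⟨r, hr, hra⟩ := ha.exists_snd
  -- In a splitting of sign `-τ`, the extreme column forces `l` into the left part and the extreme
  -- row forces `r` into the right part, although the staircase puts them on the same side.
  have hlr := h.side_iff hsp hl hla hr hra
  have hl' : side l := by
    by_contra hno
    have := (hsp s hs l (h.subset hl) hs' hno).1
    have := hc.fst_le s hs
    linarith
  have hr' : ¬ side r := by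
    intro hno
    have := (hsp r (h.subset hr) t ht hno ht').2
    have := hc.snd_le t ht
    rw [hra] at *
    linarith
  exact hr' (hlr.1 hl')

/-- The added point is already in the hull: `b` witnesses this for quadrants with the same vertical
sign, `d` for those with the same horizontal sign. For the opposite type, a missing witness would
make the row of `d` a splitting of sign `τ`. That type is needed only for the right corners, which
come after both left corners. -/
theorem SignedRun.quadHull_eq {σ τ σ' τ' : ℝ} {A A' : Finset ManhattanPlane}
    {P P' : Set ManhattanPlane} {a : ManhattanPlane} (h : SignedRun σ τ A P a A' P')
    (hq : τ' = τ ∨ σ' = σ ∨ (σ = -1 ∧ σ' = -σ ∧ τ' = -τ ∧ ¬ Splits τ A)) :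
    quadHull σ' τ' A' = quadHull σ' τ' A := by
  refine Set.Subset.antisymm (quadHull_trans ?_) (quadHull_mono h.subset)
  have key : (A' : Set ManhattanPlane) ⊆ quadHull σ' τ' A ∧
      (¬ Splits τ A → ¬ Splits τ A') := by
    refine h.induction_points (fun S => (S : Set ManhattanPlane) ⊆ quadHull σ' τ' A ∧
      (¬ Splits τ A → ¬ Splits τ S)) ⟨subset_quadHull _ _ _, id⟩ fun S a b d hS _ ih => ⟨?_, ?_⟩
    · intro p hp
      rcases Finset.mem_insert.1 hp with rfl | hp
      · refine quadHull_trans ih.1 ?_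
        rcases hq with rfl | rfl | ⟨rfl, rfl, rfl, hn⟩
        · exact ⟨b, hS.b_mem, le_rfl, by rw [hS.b_row]; exact hS.d_lt.le⟩
        · exact ⟨d, hS.d_mem, hS.d_le, le_rfl⟩
        · by_contra hno
          refine ih.2 hn ⟨fun s => τ * s.snd < τ * d.snd, ⟨b, hS.b_mem, ?_⟩,
            ⟨d, hS.d_mem, lt_irrefl _⟩, fun s hs t ht h1 h2 => ⟨?_, ?_⟩⟩
          · simp only [hS.b_row]
            exact hS.d_lt
          · have h3 := hS.empty s hs h1
            by_contra h4
            refine hno ⟨t, ht, ?_, ?_⟩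
            · simp only [mkPoint_fst]
              linarith
            · simp only [mkPoint_snd]
              linarith
          · linarith
      · exact ih.1 hp
    · exact fun hn hs => ih.2 hn (hs.of_insert hS.b_mem (by rfl))
  exact key.1

/-- A geodesic in `C` from `d` to `b` stays in the box of its ends and avoids the removed part, so
it runs along the two remaining sides and passes through the added point. -/
theorem SignedRun.subset_of_convex {σ τ : ℝ} (hσ : IsSign σ) (hτ : IsSign τ)
    {A A' : Finset ManhattanPlane} {P P' : Set ManhattanPlane} {a : ManhattanPlane}
    (h : SignedRun σ τ A P a A' P') {C : Set ManhattanPlane} (hC : GeodesicallyConvex C)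
    (hA : (A : Set ManhattanPlane) ⊆ C) (hCP : C ⊆ P') : (A' : Set ManhattanPlane) ⊆ C := by
  refine h.induction_points (fun S => (S : Set ManhattanPlane) ⊆ C) hA fun S a b d hS hbox ih => ?_
  intro p hp
  rcases Finset.mem_insert.1 hp with rfl | hp
  · obtain ⟨γ, hγ, hγC⟩ := hC d (ih hS.d_mem) b (ih hS.b_mem)
    have hdb := plane_dist d b
    -- The parameter at which the geodesic must be at the added point.
    have ht : |d.fst - b.fst| ∈ Set.Icc 0 (dist d b) :=
      ⟨abs_nonneg _, by linarith [abs_nonneg (d.snd - b.snd)]⟩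
    have hz := hγC _ ht
    have hzd := hγ.dist_left ht
    have hzb := btw_plane.1 (hγ.btw ht)
    have hnb := hbox _ (hCP hz)
    set z := γ |d.fst - b.fst| with hzdef
    rw [plane_dist] at hzd
    have hab := hS.bound d hS.d_mem
    have hdb' := hS.d_le
    have had := hS.d_lt
    rw [← hS.b_row] at had
    have hor : z.fst = b.fst ∨ z.snd = d.snd := by
      by_contra hno
      push Not at hno
      refine hnb ⟨?_, ?_, ?_, ?_⟩
      · rcases hσ with rfl | rfl <;> rcases hzb.1 with k | k <;> linarith [k.1, k.2]
      · have : σ * z.fst ≤ σ * b.fst := by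
          rcases hσ with rfl | rfl <;> rcases hzb.1 with k | k <;> linarith [k.1, k.2]
        exact lt_of_le_of_ne this fun e => hno.1 (hσ.eq_of_mul e)
      · rw [← hS.b_row]
        rcases hτ with rfl | rfl <;> rcases hzb.2 with k | k <;> linarith [k.1, k.2]
      · have : τ * z.snd ≤ τ * d.snd := by
          rcases hτ with rfl | rfl <;> rcases hzb.2 with k | k <;> linarith [k.1, k.2]
        exact lt_of_le_of_ne this fun e => hno.2 (hτ.eq_of_mul e)
    have hw : z = mkPoint b.fst d.snd := by
      rcases hor with e | e
      · rw [e] at hzd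
        have h0 : |d.snd - z.snd| = 0 := by linarith
        exact plane_ext e (sub_eq_zero.1 (abs_eq_zero.1 h0)).symm
      · rw [e, sub_self, abs_zero, add_zero] at hzd
        refine plane_ext ?_ e
        have := mid_iff_abs.1 hzb.1
        have h0 : |z.fst - b.fst| = 0 := by linarith
        exact sub_eq_zero.1 (abs_eq_zero.1 h0)
    rw [← hw]
    exact hz
  · exact ih hp

/-! ## The corner-cutting algorithm -/

section Extremes
variable {A : Finset ManhattanPlane}

theorem exists_fst_eq_xMin (hA : A.Nonempty) : ∃ l ∈ A, l.fst = xMin A :=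
  ((A.finite_toSet.image _).isCompact.sInf_mem (Set.Nonempty.image _ hA))

theorem exists_fst_eq_xMax (hA : A.Nonempty) : ∃ l ∈ A, l.fst = xMax A :=
  ((A.finite_toSet.image _).isCompact.sSup_mem (Set.Nonempty.image _ hA))

theorem exists_snd_eq_yMin (hA : A.Nonempty) : ∃ l ∈ A, l.snd = yMin A :=
  ((A.finite_toSet.image _).isCompact.sInf_mem (Set.Nonempty.image _ hA))

theorem exists_snd_eq_yMax (hA : A.Nonempty) : ∃ l ∈ A, l.snd = yMax A :=
  ((A.finite_toSet.image _).isCompact.sSup_mem (Set.Nonempty.image _ hA))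

theorem xMin_le {c : ManhattanPlane} (hc : c ∈ A) : xMin A ≤ c.fst :=
  csInf_le (A.finite_toSet.image _).bddBelow (Set.mem_image_of_mem _ hc)

theorem le_xMax {c : ManhattanPlane} (hc : c ∈ A) : c.fst ≤ xMax A :=
  le_csSup (A.finite_toSet.image _).bddAbove (Set.mem_image_of_mem _ hc)

theorem yMin_le {c : ManhattanPlane} (hc : c ∈ A) : yMin A ≤ c.snd :=
  csInf_le (A.finite_toSet.image _).bddBelow (Set.mem_image_of_mem _ hc)

theorem le_yMax {c : ManhattanPlane} (hc : c ∈ A) : c.snd ≤ yMax A :=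
  le_csSup (A.finite_toSet.image _).bddAbove (Set.mem_image_of_mem _ hc)

theorem boundingRect_eq (hA : A.Nonempty) :
    boundingRect A = {p | InBox (A : Set ManhattanPlane) p} := by
  ext p
  constructor
  · rintro ⟨⟨h1, h2⟩, h3, h4⟩
    obtain ⟨l, hl, e1⟩ := exists_fst_eq_xMin hA
    obtain ⟨r, hr, e2⟩ := exists_fst_eq_xMax hA
    obtain ⟨s, hs, e3⟩ := exists_snd_eq_yMin hA
    obtain ⟨t, ht, e4⟩ := exists_snd_eq_yMax hA
    exact ⟨⟨l, hl, by rw [e1]; exact h1⟩, ⟨r, hr, by rw [e2]; exact h2⟩,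
      ⟨s, hs, by rw [e3]; exact h3⟩, ⟨t, ht, by rw [e4]; exact h4⟩⟩
  · rintro ⟨⟨l, hl, e1⟩, ⟨r, hr, e2⟩, ⟨s, hs, e3⟩, ⟨t, ht, e4⟩⟩
    exact ⟨⟨(xMin_le hl).trans e1, e2.trans (le_xMax hr)⟩, (yMin_le hs).trans e3,
      e4.trans (le_yMax ht)⟩

theorem isCorner_bottomLeft (hA : A.Nonempty) : IsBoxCorner 1 1 A (mkPoint (xMin A) (yMin A)) :=
  ⟨fun c hc => by simpa using xMin_le hc, fun c hc => by simpa using yMin_le hc,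
    exists_fst_eq_xMin hA, exists_snd_eq_yMin hA⟩

theorem isCorner_topLeft (hA : A.Nonempty) : IsBoxCorner 1 (-1) A (mkPoint (xMin A) (yMax A)) :=
  ⟨fun c hc => by simpa using xMin_le hc, fun c hc => by simpa using le_yMax hc,
    exists_fst_eq_xMin hA, exists_snd_eq_yMax hA⟩

theorem isCorner_topRight (hA : A.Nonempty) : IsBoxCorner (-1) (-1) A (mkPoint (xMax A) (yMax A)) :=
  ⟨fun c hc => by simpa using le_xMax hc, fun c hc => by simpa using le_yMax hc,
    exists_fst_eq_xMax hA, exists_snd_eq_yMax hA⟩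

theorem isCorner_bottomRight (hA : A.Nonempty) : IsBoxCorner (-1) 1 A (mkPoint (xMax A) (yMin A)) :=
  ⟨fun c hc => by simpa using le_xMax hc, fun c hc => by simpa using yMin_le hc,
    exists_fst_eq_xMax hA, exists_snd_eq_yMin hA⟩

end Extremes

theorem IsBoxCorner.exists_run {σ τ : ℝ} (hτ : IsSign τ) {A : Finset ManhattanPlane}
    {a : ManhattanPlane} (h : IsBoxCorner σ τ A a) (P : Set ManhattanPlane) :
    ∃ A' P', SignedRun σ τ A P a A' P' :=
  SignedRun.exists hτ _ P rfl (h.cornerInv hτ)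
    (let ⟨l, hl, e⟩ := h.exists_fst; ⟨l, hl, e, h.snd_le l hl⟩) h.exists_snd

/-- The four corner procedures in signed coordinates. -/
structure SignedCutting (A A₁ A₂ A₃ A₄ : Finset ManhattanPlane)
    (P₁ P₂ P₃ B : Set ManhattanPlane) : Prop where
  run₁ : SignedRun 1 1 A (boundingRect A) (mkPoint (xMin A) (yMin A)) A₁ P₁
  run₂ : SignedRun 1 (-1) A₁ P₁ (mkPoint (xMin A) (yMax A)) A₂ P₂
  run₃ : SignedRun (-1) (-1) A₂ P₂ (mkPoint (xMax A) (yMax A)) A₃ P₃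
  run₄ : SignedRun (-1) 1 A₃ P₃ (mkPoint (xMax A) (yMin A)) A₄ B

theorem cornerCutting_iff {A : Finset ManhattanPlane} (hA : A.Nonempty) {B : Set ManhattanPlane} :
    CornerCutting A B ↔ ∃ A₁ A₂ A₃ A₄ P₁ P₂ P₃, SignedCutting A A₁ A₂ A₃ A₄ P₁ P₂ P₃ B := by
  have s1 := isSign_one
  have s2 := isSign_neg_one
  have up : ∀ y y' : ℝ, y < y' ↔ 1 * y < 1 * y' := by simp
  have down : ∀ y y' : ℝ, y' < y ↔ -1 * y < -1 * y' := by simp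
  constructor
  · rintro ⟨A₁, A₂, A₃, A₄, P₁, P₂, P₃, h₁, h₂, h₃, h₄⟩
    have r₁ := h₁.signedRun s1 s1 up ((isCorner_bottomLeft hA).cornerInv s1)
    have r₂ := h₂.signedRun s1 s2 down
      (((isCorner_topLeft hA).mono s1 s2 r₁.subset r₁.inBox).cornerInv s2)
    have hs₂ := r₁.subset.trans r₂.subset
    have hb₂ : ∀ p ∈ A₂, InBox (A : Set ManhattanPlane) p := fun p hp =>
      (r₂.inBox p hp).trans r₁.inBox
    have r₃ := h₃.signedRun s2 s2 down
      (((isCorner_topRight hA).mono s2 s2 hs₂ hb₂).cornerInv s2)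
    have hb₃ : ∀ p ∈ A₃, InBox (A : Set ManhattanPlane) p := fun p hp =>
      (r₃.inBox p hp).trans hb₂
    have r₄ := h₄.signedRun s2 s1 up
      (((isCorner_bottomRight hA).mono s2 s1 (hs₂.trans r₃.subset) hb₃).cornerInv s1)
    exact ⟨A₁, A₂, A₃, A₄, P₁, P₂, P₃, r₁, r₂, r₃, r₄⟩
  · rintro ⟨A₁, A₂, A₃, A₄, P₁, P₂, P₃, r₁, r₂, r₃, r₄⟩
    exact ⟨A₁, A₂, A₃, A₄, P₁, P₂, P₃, r₁.cornerRun s1 s1 up, r₂.cornerRun s1 s2 down,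
      r₃.cornerRun s2 s2 down, r₄.cornerRun s2 s1 up⟩

theorem exists_signedCutting {A : Finset ManhattanPlane} (hA : A.Nonempty) :
    ∃ A₁ A₂ A₃ A₄ P₁ P₂ P₃ B, SignedCutting A A₁ A₂ A₃ A₄ P₁ P₂ P₃ B := by
  have s1 := isSign_one
  have s2 := isSign_neg_one
  obtain ⟨A₁, P₁, r₁⟩ := (isCorner_bottomLeft hA).exists_run s1 (boundingRect A)
  obtain ⟨A₂, P₂, r₂⟩ := ((isCorner_topLeft hA).mono s1 s2 r₁.subset r₁.inBox).exists_run s2 P₁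
  have hs₂ := r₁.subset.trans r₂.subset
  have hb₂ : ∀ p ∈ A₂, InBox (A : Set ManhattanPlane) p := fun p hp =>
    (r₂.inBox p hp).trans r₁.inBox
  obtain ⟨A₃, P₃, r₃⟩ := ((isCorner_topRight hA).mono s2 s2 hs₂ hb₂).exists_run s2 P₂
  have hb₃ : ∀ p ∈ A₃, InBox (A : Set ManhattanPlane) p := fun p hp =>
    (r₃.inBox p hp).trans hb₂
  obtain ⟨A₄, B, r₄⟩ :=
    ((isCorner_bottomRight hA).mono s2 s1 (hs₂.trans r₃.subset) hb₃).exists_run s1 P₃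
  exact ⟨A₁, A₂, A₃, A₄, P₁, P₂, P₃, B, r₁, r₂, r₃, r₄⟩

theorem SignedCutting.unique {A A₁ A₂ A₃ A₄ A₁' A₂' A₃' A₄' : Finset ManhattanPlane}
    {P₁ P₂ P₃ B P₁' P₂' P₃' B' : Set ManhattanPlane} (h : SignedCutting A A₁ A₂ A₃ A₄ P₁ P₂ P₃ B)
    (h' : SignedCutting A A₁' A₂' A₃' A₄' P₁' P₂' P₃' B') : B' = B := by
  obtain ⟨r₁, r₂, r₃, r₄⟩ := h
  obtain ⟨r₁', r₂', r₃', r₄'⟩ := h'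
  obtain ⟨rfl, rfl⟩ := r₁.unique isSign_one isSign_one r₁'
  obtain ⟨rfl, rfl⟩ := r₂.unique isSign_one isSign_neg_one r₂'
  obtain ⟨rfl, rfl⟩ := r₃.unique isSign_neg_one isSign_neg_one r₃'
  exact (r₄.unique isSign_neg_one isSign_one r₄').2.symm

/-- The output of the corner-cutting algorithm is the orthogonal hull of the enlarged set. -/
theorem SignedCutting.eq_orthHull {A A₁ A₂ A₃ A₄ : Finset ManhattanPlane} (hA : A.Nonempty)
    {P₁ P₂ P₃ B : Set ManhattanPlane} (h : SignedCutting A A₁ A₂ A₃ A₄ P₁ P₂ P₃ B) :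
    B = orthHull A₄ ∧ ¬ Splits 1 A₄ ∧ ¬ Splits (-1) A₄ := by
  obtain ⟨r₁, r₂, r₃, r₄⟩ := h
  have c₁ := isCorner_bottomLeft hA
  have c₂ := isCorner_topLeft hA
  have c₃ := isCorner_topRight hA
  have c₄ := isCorner_bottomRight hA
  have hn₁ : ¬ Splits (-1) A₁ := r₁.not_splits_corner isSign_one c₁
  have hn₂ : ¬ Splits (-1) A₂ := r₂.not_splits hn₁
  have hm₂ : ¬ Splits 1 A₂ := by
    have := r₂.not_splits_corner isSign_neg_one
      (c₂.mono isSign_one isSign_neg_one r₁.subset r₁.inBox)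
    rwa [neg_neg] at this
  have hm₃ := r₃.not_splits hm₂
  -- Each procedure cuts with the hull of its own type for the set it starts from. These equalities
  -- replace that set by the final `A₄`, so the four cuts together give the orthogonal hull of `A₄`.
  have e₁ : quadHull 1 1 A₄ = quadHull 1 1 A := by
    rw [r₄.quadHull_eq (Or.inl rfl), r₃.quadHull_eq (Or.inr (Or.inr ⟨rfl, by simp, by simp, hn₂⟩)),
      r₂.quadHull_eq (Or.inr (Or.inl rfl)), r₁.quadHull_eq (Or.inl rfl)]
  have e₂ : quadHull 1 (-1) A₄ = quadHull 1 (-1) A₁ := by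
    rw [r₄.quadHull_eq (Or.inr (Or.inr ⟨rfl, by simp, by simp, hm₃⟩)), r₃.quadHull_eq (Or.inl rfl),
      r₂.quadHull_eq (Or.inl rfl)]
  have e₃ : quadHull (-1) (-1) A₄ = quadHull (-1) (-1) A₂ := by
    rw [r₄.quadHull_eq (Or.inr (Or.inl rfl)), r₃.quadHull_eq (Or.inl rfl)]
  have e₄ : quadHull (-1) 1 A₄ = quadHull (-1) 1 A₃ := r₄.quadHull_eq (Or.inl rfl)
  refine ⟨?_, r₄.not_splits hm₃, r₄.not_splits (r₃.not_splits hn₂)⟩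
  have hbox : ∀ p ∈ A₄, InBox (A : Set ManhattanPlane) p := fun p hp =>
    (((r₄.inBox p hp).trans r₃.inBox).trans r₂.inBox).trans r₁.inBox
  have hmem : ∀ p, InBox (A : Set ManhattanPlane) p → (p ∈ B ↔ p ∈ orthHull A₄) := by
    intro p hp
    have hR : p ∈ boundingRect A := by
      rw [boundingRect_eq hA]
      exact hp
    rw [mem_orthHull_iff isSign_one isSign_one, e₁, e₂, e₃, e₄,
      r₄.mem_iff (le_of_inBox isSign_neg_one c₄.fst_le hp),
      r₃.mem_iff (le_of_inBox isSign_neg_one c₃.fst_le hp),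
      r₂.mem_iff (le_of_inBox isSign_one c₂.fst_le hp),
      r₁.mem_iff (le_of_inBox isSign_one c₁.fst_le hp)]
    simp only [le_of_inBox_snd isSign_one c₁.snd_le hp, le_of_inBox_snd isSign_neg_one c₂.snd_le hp,
      le_of_inBox_snd isSign_neg_one c₃.snd_le hp, le_of_inBox_snd isSign_one c₄.snd_le hp, hR,
      true_and, true_imp_iff]
    tauto
  ext p
  constructor
  · intro hp
    have : p ∈ boundingRect A :=
      r₁.region_subset (r₂.region_subset (r₃.region_subset (r₄.region_subset hp)))
    rw [boundingRect_eq hA] at this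
    exact (hmem p this).1 hp
  · intro hp
    exact (hmem p ((inBox_of_mem_orthHull hp).trans hbox)).2 hp

/-- A competitor inside the output lies in all the intermediate regions, so it collects the points
added in each procedure and finally contains the orthogonal hull of `A₄`. -/
theorem SignedCutting.isMinimalConvex {A A₁ A₂ A₃ A₄ : Finset ManhattanPlane} (hA : A.Nonempty)
    {P₁ P₂ P₃ B : Set ManhattanPlane} (h : SignedCutting A A₁ A₂ A₃ A₄ P₁ P₂ P₃ B) :
    IsMinimalConvex A B := by
  obtain ⟨hB, hs, hs'⟩ := h.eq_orthHull hA
  obtain ⟨r₁, r₂, r₃, r₄⟩ := h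
  have hsub : A ⊆ A₄ := ((r₁.subset.trans r₂.subset).trans r₃.subset).trans r₄.subset
  refine ⟨⟨?_, ?_, ?_⟩, ?_⟩
  · rw [hB]
    exact fun a ha => subset_orthHull A₄ (hsub ha)
  · rw [hB]
    exact isClosed_orthHull A₄
  · rw [hB]
    exact geodesicallyConvex_orthHull hs hs'
  · rintro C ⟨hAC, -, hC⟩ hCB
    have h3 : C ⊆ P₃ := hCB.trans r₄.region_subset
    have h2 : C ⊆ P₂ := h3.trans r₃.region_subset
    have h1 : C ⊆ P₁ := h2.trans r₂.region_subset
    have k1 := r₁.subset_of_convex isSign_one isSign_one hC hAC h1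
    have k2 := r₂.subset_of_convex isSign_one isSign_neg_one hC k1 h2
    have k3 := r₃.subset_of_convex isSign_neg_one isSign_neg_one hC k2 h3
    have k4 := r₄.subset_of_convex isSign_neg_one isSign_one hC k3 hCB
    rw [hB]
    exact hC.orthHull_subset k4

/-- The corner-cutting algorithm terminates with a unique output, a minimal convex set. -/
theorem exists_cornerCutting {A : Finset ManhattanPlane} (hA : A.Nonempty) :
    ∃ B, CornerCutting A B ∧ (∀ B', CornerCutting A B' → B' = B) ∧ IsMinimalConvex A B := by
  obtain ⟨A₁, A₂, A₃, A₄, P₁, P₂, P₃, B, h⟩ := exists_signedCutting hA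
  refine ⟨B, (cornerCutting_iff hA).2 ⟨_, _, _, _, _, _, _, h⟩, fun B' h' => ?_,
    h.isMinimalConvex hA⟩
  obtain ⟨_, _, _, _, _, _, _, h'⟩ := (cornerCutting_iff hA).1 h'
  exact h.unique h'

/-! ## Metric trees and the four-point condition -/

section FourPoint
variable {α : Type*} [MetricSpace α]

/-- The four-point condition for four given points. -/
def FourPt (p q r s : α) : Prop :=
  dist p q + dist r s ≤ max (dist p r + dist q s) (dist p s + dist q r)

/-- The four-point condition for all points of a set. -/
def FourPointOn (S : Set α) : Prop := ∀ p ∈ S, ∀ q ∈ S, ∀ r ∈ S, ∀ s ∈ S, FourPt p q r s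

theorem FourPt.swap {p q r s : α} (h : FourPt p q r s) : FourPt q p r s := by
  unfold FourPt at *
  rw [dist_comm q p, max_comm, add_comm (dist q s), add_comm (dist q r)]
  exact h

theorem FourPt.flip {p q r s : α} (h : FourPt p q r s) : FourPt r s p q := by
  unfold FourPt at *
  rw [dist_comm r p, dist_comm s q, dist_comm r q, dist_comm s p, add_comm, add_comm (dist q r)]
  exact h

theorem FourPt.of_mbtw {x f g h k : α} (hb : MBtw x f g) (hx : FourPt x g h k) :
    FourPt f g h k := by
  unfold FourPt at *
  have e : _ = _ := hb
  have h1 := dist_triangle x f h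
  have h2 := dist_triangle x f k
  rcases le_max_iff.1 hx with hx | hx
  · exact le_max_iff.2 (Or.inl (by linarith))
  · exact le_max_iff.2 (Or.inr (by linarith))

/-- The four-point condition passes from `Z` to `B` if any point of `B` lies between any other point
of `B` and some point of `Z`. -/
theorem FourPointOn.extend {Z B : Set α} (hZ : FourPointOn Z) (hZB : Z ⊆ B)
    (h : ∀ p ∈ B, ∀ q ∈ B, ∃ x ∈ Z, MBtw x p q) : FourPointOn B := by
  -- Replaces one point of `Z` by a point of `B`; the four positions are treated in turn by means of
  -- the symmetries of `FourPt`.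
  have step : ∀ f ∈ B, ∀ g ∈ B, ∀ r s, (∀ x ∈ Z, FourPt x g r s) → FourPt f g r s := by
    intro f hf g hg r s hx
    obtain ⟨x, hxZ, hb⟩ := h f hf g hg
    exact FourPt.of_mbtw hb (hx x hxZ)
  have h1 : ∀ f ∈ B, ∀ x ∈ Z, ∀ y ∈ Z, ∀ z ∈ Z, FourPt f x y z := fun f hf x hx y hy z hz =>
    step f hf x (hZB hx) y z fun w hw => hZ w hw x hx y hy z hz
  have h2 : ∀ f ∈ B, ∀ g ∈ B, ∀ y ∈ Z, ∀ z ∈ Z, FourPt f g y z := fun f hf g hg y hy z hz =>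
    (step g hg f hf y z fun w hw => (h1 f hf w hw y hy z hz).swap).swap
  have h3 : ∀ f ∈ B, ∀ g ∈ B, ∀ r ∈ B, ∀ z ∈ Z, FourPt f g r z := fun f hf g hg r hr z hz =>
    (step r hr z (hZB hz) f g fun w hw => (h2 f hf g hg w hw z hz).flip).flip
  exact fun f hf g hg r hr s hs =>
    (step s hs r hr f g fun w hw => (h3 f hf g hg r hr w hw).flip.swap).swap.flip

theorem fourPt_of_eq {p q r s : α} (h : p = q ∨ p = r ∨ p = s ∨ q = r ∨ q = s ∨ r = s) :
    FourPt p q r s := by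
  unfold FourPt
  rcases h with rfl | rfl | rfl | rfl | rfl | rfl
  · exact le_max_iff.2 (Or.inl (by rw [dist_self, zero_add]; exact dist_triangle_left _ _ _))
  · exact le_max_iff.2 (Or.inr (by rw [dist_comm q p]; linarith))
  · exact le_max_iff.2 (Or.inl (by rw [dist_comm q p, dist_comm r p]; linarith))
  · exact le_max_iff.2 (Or.inl (by linarith))
  · exact le_max_iff.2 (Or.inr (by rw [dist_comm r q]))
  · exact le_max_iff.2 (Or.inl (by
      rw [dist_self, add_zero, dist_comm q]
      exact dist_triangle _ _ _))

/-- In a space with the four-point condition, a connected set contains all points between any two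
of its points. -/
theorem mem_of_isPreconnected (h4 : ∀ p q r s : α, FourPt p q r s) {K : Set α}
    (hK : IsPreconnected K) {x y p : α} (hx : x ∈ K) (hy : y ∈ K) (hb : MBtw x p y) : p ∈ K := by
  by_contra hp
  have hxp : 0 < dist x p := dist_pos.2 fun e => hp (e ▸ hx)
  have hyp : 0 < dist y p := dist_pos.2 fun e => hp (e ▸ hy)
  -- `O u` consists of the points not separated from `u` by `p`. By the four-point condition
  -- non-separation is transitive, so the open sets `O x` and `V` would disconnect `K`.
  let O : α → Set α := fun u => {v | dist u v < dist u p + dist v p}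
  have hO : ∀ u, IsOpen (O u) := fun u => isOpen_lt (by fun_prop) (by fun_prop)
  have htrans : ∀ u v w, v ∈ O u → v ∈ O w → w ∈ O u := by
    intro u v w h1 h2
    have h1' : dist u v < dist u p + dist v p := h1
    have h2' : dist w v < dist w p + dist v p := h2
    have h := h4 u w v p
    unfold FourPt at h
    rw [dist_comm w v] at h2'
    change dist u w < dist u p + dist w p
    rcases le_max_iff.1 h with k | k
    · linarith
    · rw [dist_comm w v] at k
      linarith
  let V : Set α := ⋃ u ∈ {u | u ∈ K ∧ u ∉ O x}, O u
  have hV : IsOpen V := isOpen_biUnion fun u _ => hO u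
  obtain ⟨v, hvK, hvx, hvV⟩ := hK (O x) V (hO x) hV
    (fun u hu => by
      by_cases hux : u ∈ O x
      · exact Or.inl hux
      · refine Or.inr (Set.mem_biUnion (show u ∈ {u | u ∈ K ∧ u ∉ O x} from ⟨hu, hux⟩) ?_)
        have : 0 < dist u p := dist_pos.2 fun e => hp (e ▸ hu)
        change dist u u < _
        rw [dist_self]
        linarith)
    ⟨x, hx, by
      change dist x x < _
      rw [dist_self]
      linarith⟩
    ⟨y, hy, Set.mem_biUnion (show y ∈ {u | u ∈ K ∧ u ∉ O x} from ⟨hy, fun k => by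
      have k' : dist x y < dist x p + dist y p := k
      have e : _ = _ := hb
      rw [dist_comm p y] at e
      linarith⟩) (by
      change dist y y < _
      rw [dist_self]
      linarith)⟩
  simp only [V, Set.mem_iUnion] at hvV
  obtain ⟨u, ⟨-, hu⟩, huv⟩ := hvV
  exact hu (htrans x v u hvx huv)

/-- The projection `w` of a point `u` of the arc to the geodesic is between `u` and either end, so
both the part of the arc before `u` and the part after it contain `w`. Injectivity gives `u = w`.
Conversely, the arc is connected and hence contains the geodesic. -/
theorem isMetricTree_of_fourPt (hg : ∀ x y : α, ∃ γ : ℝ → α, IsGeodesic γ x y)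
    (h4 : ∀ p q r s : α, FourPt p q r s) : IsMetricTree α := by
  intro x y
  obtain ⟨γ, hγ⟩ := hg x y
  refine ⟨γ, hγ, fun c hc hinj h0 h1 => ?_⟩
  have hpre : ∀ a b, 0 ≤ a → b ≤ 1 → IsPreconnected (c '' Set.Icc a b) := fun a b ha hb =>
    isPreconnected_Icc.image c (hc.mono (Set.Icc_subset_Icc ha hb))
  have m0 : (0 : ℝ) ∈ Set.Icc (0 : ℝ) 1 := ⟨le_rfl, zero_le_one⟩
  have m1 : (1 : ℝ) ∈ Set.Icc (0 : ℝ) 1 := ⟨zero_le_one, le_rfl⟩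
  apply Set.Subset.antisymm
  · rintro _ ⟨s, hs, rfl⟩
    set u := c s with hu
    -- The Gromov product at `x` of `u` and `y`: the place where the branch to `u` leaves the
    -- geodesic.
    set t := (dist x u + dist x y - dist y u) / 2 with htdef
    have ht : t ∈ Set.Icc 0 (dist x y) := by
      have := dist_triangle_right y u x
      have := dist_triangle x y u
      have := dist_triangle y x u
      rw [dist_comm y x] at *
      exact ⟨by linarith, by linarith⟩
    have hxw := hγ.dist_left ht
    have hwy := hγ.dist_right ht
    set w := γ t with hw
    have huw : dist u w ≤ (dist x u + dist y u - dist x y) / 2 := by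
      have h := h4 x y u w
      unfold FourPt at h
      rw [dist_comm y w] at h
      rcases le_max_iff.1 h with k | k <;> linarith
    have b1 : MBtw x w u := btw_of_le (by rw [dist_comm w u]; linarith)
    have b2 : MBtw u w y := btw_of_le (by rw [dist_comm u y]; linarith)
    obtain ⟨s₁, hs₁, e₁⟩ := mem_of_isPreconnected h4 (hpre 0 s le_rfl hs.2)
      ⟨0, ⟨le_rfl, hs.1⟩, h0⟩ ⟨s, ⟨hs.1, le_rfl⟩, rfl⟩ b1
    obtain ⟨s₂, hs₂, e₂⟩ := mem_of_isPreconnected h4 (hpre s 1 hs.1 le_rfl)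
      ⟨s, ⟨le_rfl, hs.2⟩, rfl⟩ ⟨1, ⟨hs.2, le_rfl⟩, h1⟩ b2
    have e := hinj ⟨hs₁.1, hs₁.2.trans hs.2⟩ ⟨hs.1.trans hs₂.1, hs₂.2⟩ (e₁.trans e₂.symm)
    have es : s = s₁ := le_antisymm (e ▸ hs₂.1) hs₁.2
    refine ⟨t, ht, ?_⟩
    rw [← hw, ← e₁, hu, es]
  · rintro _ ⟨t, ht, rfl⟩
    exact mem_of_isPreconnected h4 (hpre 0 1 le_rfl le_rfl) ⟨0, m0, h0⟩ ⟨1, m1, h1⟩ (hγ.btw ht)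

/-- In a metric tree, two geodesics from `a` to `b` and `o` have a common initial segment unless `a`
lies between `o` and `b`. -/
theorem IsMetricTree.exists_common (hT : IsMetricTree α) {a b o : α} {γ δ : ℝ → α}
    (hγ : IsGeodesic γ a b) (hδ : IsGeodesic δ a o) (hno : ¬ MBtw o a b) :
    ∃ s > 0, s ≤ dist a b ∧ s ≤ dist a o ∧ ∀ t ∈ Set.Icc 0 s, γ t = δ t := by
  have hab : 0 < dist a b := dist_pos.2 fun e => hno (e ▸ btw_right _ _)
  have hao : 0 < dist a o := dist_pos.2 fun e => hno (e ▸ btw_left _ _)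
  by_cases hmeet : ∃ s ∈ Set.Ioc 0 (dist a b), ∃ t ∈ Set.Ioc 0 (dist a o), γ s = δ t
  · obtain ⟨s, hs, t, ht, e⟩ := hmeet
    have hst : s = t := by
      rw [← hγ.dist_left ⟨hs.1.le, hs.2⟩, ← hδ.dist_left ⟨ht.1.le, ht.2⟩, e]
    subst hst
    refine ⟨s, hs.1, hs.2, ht.2, ?_⟩
    obtain ⟨η, -, hη⟩ := hT a (γ s)
    -- Up to the meeting point both geodesics are arcs with the same ends, hence have the same
    -- image; the distance from `a` then identifies the parameters.
    have arc : ∀ {z : α} {κ : ℝ → α}, IsGeodesic κ a z → s ≤ dist a z → κ s = γ s →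
        (fun u => κ (u * s)) '' Set.Icc 0 1 = η '' Set.Icc 0 (dist a (γ s)) := by
      intro z κ hκ hsz hks
      have hmap : ∀ u ∈ Set.Icc (0 : ℝ) 1, u * s ∈ Set.Icc 0 (dist a z) := fun u hu =>
        ⟨mul_nonneg hu.1 hs.1.le, (mul_le_of_le_one_left hs.1.le hu.2).trans hsz⟩
      refine hη _ (hκ.continuousOn.comp (by fun_prop) hmap) (fun u hu v hv e => ?_) ?_ ?_
      · exact mul_right_cancel₀ hs.1.ne' (hκ.injOn (hmap u hu) (hmap v hv) e)
      · simp only [zero_mul]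
        exact hκ.1
      · simp only [one_mul]
        exact hks
    have key := (arc hγ hs.2 rfl).trans (arc hδ ht.2 e.symm).symm
    intro t ht'
    have hmem : γ t ∈ (fun u => γ (u * s)) '' Set.Icc 0 1 :=
      ⟨t / s, ⟨div_nonneg ht'.1 hs.1.le, (div_le_one hs.1).2 ht'.2⟩, by
        simp only [div_mul_cancel₀ _ hs.1.ne']⟩
    rw [key] at hmem
    obtain ⟨u, hu, eu⟩ := hmem
    simp only at eu
    have hus : u * s ∈ Set.Icc 0 (dist a o) :=
      ⟨mul_nonneg hu.1 hs.1.le, (mul_le_of_le_one_left hs.1.le hu.2).trans ht.2⟩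
    have : t = u * s := by
      rw [← hγ.dist_left ⟨ht'.1, ht'.2.trans hs.2⟩, ← hδ.dist_left hus, eu]
    rw [← eu, this]
  · exfalso
    push Not at hmeet
    -- Without a meeting point, the reversed `γ` followed by `δ` is an arc from `b` to `o` through
    -- `a`. It must be the geodesic, so `a` would be between `o` and `b`.
    let c : ℝ → α := fun u =>
      if u ≤ 1 / 2 then γ ((1 - 2 * u) * dist a b) else δ ((2 * u - 1) * dist a o)
    have hγm : ∀ u ∈ Set.Icc (0 : ℝ) (1 / 2), (1 - 2 * u) * dist a b ∈ Set.Icc 0 (dist a b) :=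
      fun u hu => ⟨mul_nonneg (by linarith [hu.2]) hab.le,
        mul_le_of_le_one_left hab.le (by linarith [hu.1])⟩
    have hδm : ∀ u ∈ Set.Icc (1 / 2 : ℝ) 1, (2 * u - 1) * dist a o ∈ Set.Icc 0 (dist a o) :=
      fun u hu => ⟨mul_nonneg (by linarith [hu.1]) hao.le,
        mul_le_of_le_one_left hao.le (by linarith [hu.2])⟩
    have hc1 : ∀ u ∈ Set.Icc (0 : ℝ) (1 / 2), c u = γ ((1 - 2 * u) * dist a b) :=
      fun u hu => if_pos hu.2
    have hc2 : ∀ u ∈ Set.Icc (1 / 2 : ℝ) 1, c u = δ ((2 * u - 1) * dist a o) := by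
      intro u hu
      by_cases h : u ≤ 1 / 2
      · obtain rfl : u = 1 / 2 := le_antisymm h hu.1
        rw [hc1 _ ⟨by norm_num, le_rfl⟩]
        norm_num
        rw [hγ.1, hδ.1]
      · exact if_neg h
    have hcont : ContinuousOn c (Set.Icc 0 1) := by
      rw [← Set.Icc_union_Icc_eq_Icc (b := 1 / 2) (by norm_num) (by norm_num)]
      refine ContinuousOn.union_of_isClosed ?_ ?_ isClosed_Icc isClosed_Icc
      · exact (hγ.continuousOn.comp (by fun_prop) hγm).congr hc1
      · exact (hδ.continuousOn.comp (by fun_prop) hδm).congr hc2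
    have hsplit : ∀ u ∈ Set.Icc (0 : ℝ) 1, u ∈ Set.Icc (0 : ℝ) (1 / 2) ∨ u ∈ Set.Ioc (1 / 2 : ℝ) 1 :=
      fun u hu => by
        rcases le_or_gt u (1 / 2) with h | h
        · exact Or.inl ⟨hu.1, h⟩
        · exact Or.inr ⟨h, hu.2⟩
    have hcross : ∀ u ∈ Set.Icc (0 : ℝ) (1 / 2), ∀ v ∈ Set.Ioc (1 / 2 : ℝ) 1, c u ≠ c v := by
      intro u hu v hv e
      have hv' : v ∈ Set.Icc (1 / 2 : ℝ) 1 := ⟨hv.1.le, hv.2⟩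
      rw [hc1 u hu, hc2 v hv'] at e
      have hpos : 0 < (2 * v - 1) * dist a o := mul_pos (by linarith [hv.1]) hao
      have hd : (1 - 2 * u) * dist a b = (2 * v - 1) * dist a o := by
        rw [← hγ.dist_left (hγm u hu), ← hδ.dist_left (hδm v hv'), e]
      exact hmeet _ ⟨hd ▸ hpos, (hγm u hu).2⟩ _ ⟨hpos, (hδm v hv').2⟩ e
    have hinj : Set.InjOn c (Set.Icc 0 1) := by
      intro u hu v hv e
      rcases hsplit u hu with hu' | hu' <;> rcases hsplit v hv with hv' | hv'
      · rw [hc1 u hu', hc1 v hv'] at e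
        have := mul_right_cancel₀ hab.ne' (hγ.injOn (hγm u hu') (hγm v hv') e)
        linarith
      · exact absurd e (hcross u hu' v hv')
      · exact absurd e.symm (hcross v hv' u hu')
      · have hu'' : u ∈ Set.Icc (1 / 2 : ℝ) 1 := ⟨hu'.1.le, hu'.2⟩
        have hv'' : v ∈ Set.Icc (1 / 2 : ℝ) 1 := ⟨hv'.1.le, hv'.2⟩
        rw [hc2 u hu'', hc2 v hv''] at e
        have := mul_right_cancel₀ hao.ne' (hδ.injOn (hδm u hu'') (hδm v hv'') e)
        linarith
    obtain ⟨η, hη, harc⟩ := hT b o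
    have himg := harc c hcont hinj
      (by rw [hc1 0 ⟨le_rfl, by norm_num⟩]; norm_num; exact hγ.2.1)
      (by rw [hc2 1 ⟨by norm_num, le_rfl⟩]; norm_num; exact hδ.2.1)
    have ha : a ∈ c '' Set.Icc 0 1 :=
      ⟨1 / 2, ⟨by norm_num, by norm_num⟩, by
        rw [hc1 _ ⟨by norm_num, le_rfl⟩]
        norm_num
        exact hγ.1⟩
    rw [himg] at ha
    obtain ⟨t, ht, e⟩ := ha
    have := hη.btw ht
    rw [e] at this
    exact hno this.symm

/-- Otherwise the geodesics from `a` to `b` and to `c` both begin along the one to `o`. They share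
an initial piece, and `b` and `c` can be joined by a shortcut that avoids `a`. -/
theorem IsMetricTree.mbtw_or (hT : IsMetricTree α) {o a b c : α} (h : MBtw b a c) :
    MBtw o a b ∨ MBtw o a c := by
  by_contra hno
  push Not at hno
  obtain ⟨β, hβ, -⟩ := hT a b
  obtain ⟨γ, hγ, -⟩ := hT a c
  obtain ⟨δ, hδ, -⟩ := hT a o
  obtain ⟨s, hs, hsb, -, h1⟩ := hT.exists_common hβ hδ hno.1
  obtain ⟨t, ht, htc, -, h2⟩ := hT.exists_common hγ hδ hno.2
  have hm : 0 < min s t := lt_min hs ht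
  have e : β (min s t) = γ (min s t) :=
    (h1 _ ⟨hm.le, min_le_left _ _⟩).trans (h2 _ ⟨hm.le, min_le_right _ _⟩).symm
  have d1 := hβ.dist_right ⟨hm.le, (min_le_left _ _).trans hsb⟩
  have d2 := hγ.dist_right ⟨hm.le, (min_le_right _ _).trans htc⟩
  rw [e] at d1
  have h' : _ = _ := h
  have := dist_triangle_left b c (γ (min s t))
  rw [dist_comm b a] at h'
  linarith

end FourPoint

/-! ## When the tight span is a tree -/

/-- If the geodesic from `x` meets `q` before `p`, the partner of `x` with respect to `p` lies on
the far side and serves instead. -/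
theorem SpanModel.exists_mbtw {Z : Finset ManhattanPlane} {B : Set ManhattanPlane}
    (h : SpanModel Z B) {p q : ManhattanPlane} (hp : p ∈ B) (hq : q ∈ B) : ∃ x ∈ Z, MBtw x p q := by
  obtain ⟨x, hx, hb | hb⟩ := h.mbtw p hp q hq
  · exact ⟨x, hx, hb⟩
  · have hmem : distTo Z p ∈ tightSpan Z := h.image ▸ Set.mem_image_of_mem _ hp
    obtain ⟨y, hy, hy'⟩ := exists_mbtw_of_mem_tightSpan hmem hx
    exact ⟨y, hy, (hy'.trans_right hb).symm⟩

/-- For distinct points, all three sums of opposite distances exceed those of the centers by the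
same amount, the sum of the four pendant lengths. -/
theorem fourPointOn_of_centerSet {Z : Finset ManhattanPlane}
    (h : FourPointOn (centerSet Z : Set ManhattanPlane)) :
    FourPointOn (Z : Set ManhattanPlane) := by
  intro p hp q hq r hr s hs
  by_cases hne : p = q ∨ p = r ∨ p = s ∨ q = r ∨ q = s ∨ r = s
  · exact fourPt_of_eq hne
  push Not at hne
  obtain ⟨h1, h2, h3, h4, h5, h6⟩ := hne
  have key := h _ (centerOf_mem hp) _ (centerOf_mem hq) _ (centerOf_mem hr) _ (centerOf_mem hs)
  unfold FourPt at *
  rw [dist_eq_add_centerOf hp hq h1, dist_eq_add_centerOf hp hr h2, dist_eq_add_centerOf hp hs h3,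
    dist_eq_add_centerOf hq hr h4, dist_eq_add_centerOf hq hs h5, dist_eq_add_centerOf hr hs h6]
  rcases le_max_iff.1 key with k | k
  · exact le_max_iff.2 (Or.inl (by linarith))
  · exact le_max_iff.2 (Or.inr (by linarith))

theorem fourPointOn_of_centerSeq {X : Finset ManhattanPlane} {N : ℕ}
    (h : (centerSeq X N).card = 1) : FourPointOn (X : Set ManhattanPlane) := by
  have h0 : FourPointOn (centerSeq X N : Set ManhattanPlane) := by
    obtain ⟨a, ha⟩ := Finset.card_eq_one.1 h
    rw [ha]
    intro p hp q hq r hr s hs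
    rw [Finset.coe_singleton, Set.mem_singleton_iff] at hp hq
    exact fourPt_of_eq (Or.inl (hp.trans hq.symm))
  clear h
  induction N with
  | zero => exact h0
  | succ N ih => exact ih (fourPointOn_of_centerSet h0)

theorem SpanModel.isMetricTree {Z : Finset ManhattanPlane} {B : Set ManhattanPlane}
    (h : SpanModel Z B) (h4 : FourPointOn (Z : Set ManhattanPlane)) :
    IsMetricTree (tightSpan Z) := by
  classical
  obtain ⟨φ, -⟩ := h.exists_isometryEquiv
  have hB := h4.extend h.subset fun p hp q hq => h.exists_mbtw hp hq
  refine isMetricTree_of_fourPt (fun f g => ?_) fun f g r s => ?_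
  · obtain ⟨γ, hγ, hγB⟩ := h.convex _ (φ.symm f).2 _ (φ.symm g).2
    have hd : dist ((φ.symm f : B) : ManhattanPlane) (φ.symm g : B) = dist f g :=
      φ.symm.dist_eq f g
    rw [hd] at hγB
    refine ⟨fun t => if ht : γ t ∈ B then φ ⟨γ t, ht⟩ else f, ?_, ?_, fun s hs t ht => ?_⟩
    · have h0 : γ 0 ∈ B := hγB 0 ⟨le_rfl, dist_nonneg⟩
      have e : (⟨γ 0, h0⟩ : B) = φ.symm f := Subtype.ext hγ.1
      simp only [dif_pos h0, e, φ.apply_symm_apply]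
    · have h1 : γ (dist f g) ∈ B := hγB _ ⟨dist_nonneg, le_rfl⟩
      have e : (⟨γ (dist f g), h1⟩ : B) = φ.symm g := by
        have := hγ.2.1
        rw [hd] at this
        exact Subtype.ext this
      simp only [dif_pos h1, e, φ.apply_symm_apply]
    · simp only [dif_pos (hγB s hs), dif_pos (hγB t ht)]
      rw [φ.dist_eq, Subtype.dist_eq]
      exact hγ.2.2 s (hd.symm ▸ hs) t (hd.symm ▸ ht)
  · have := hB _ (φ.symm f).2 _ (φ.symm g).2 _ (φ.symm r).2 _ (φ.symm s).2
    unfold FourPt at *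
    simp only [← Subtype.dist_eq, φ.symm.dist_eq] at this
    exact this

/-- In a trim set with more than one point, a point `a` farthest from `o` lies between two others,
and the alternative puts one of these beyond `a` as seen from `o`. -/
theorem card_eq_one_of_mbtw_or {A : Finset ManhattanPlane} (hA : A.Nonempty) (htrim : IsTrim A)
    (h : ∀ o ∈ A, ∀ a ∈ A, ∀ b ∈ A, ∀ c ∈ A, MBtw b a c → MBtw o a b ∨ MBtw o a c) :
    A.card = 1 := by
  obtain ⟨o, ho⟩ := hA
  obtain ⟨a, ha, hmax⟩ := A.exists_max_image (fun a => dist o a) ⟨o, ho⟩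
  have hfix := isTrim_iff.1 htrim a ha
  rcases card_cases ha with rfl | ⟨b, hba, hb⟩ | h3
  · simp
  · rw [centerOf_pair hba hb, midpoint_eq_left_iff] at hfix
    exact absurd hfix hba.symm
  · exfalso
    obtain ⟨b, hb, c, hc, hba, hca, hbc, e⟩ := exists_gromovProduct_eq h3 ha
    rw [hfix, dist_self, gromovProduct] at e
    have hbac : MBtw b a c := by
      refine (?_ : _ = _)
      rw [dist_comm b a]
      linarith
    rcases h o ho a ha b hb c hc hbac with k | k
    · have k' : _ = _ := k
      have := dist_pos.2 hba.symm
      linarith [hmax b hb]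
    · have k' : _ = _ := k
      have := dist_pos.2 hca.symm
      linarith [hmax c hc]

theorem isMetricTree_tightSpan_iff {X : Finset ManhattanPlane} (hX : X.Nonempty) {N : ℕ}
    (htrim : IsTrim (centerSeq X N)) :
    IsMetricTree (tightSpan X) ↔ (centerSeq X N).card = 1 := by
  have hA := centerSeq_nonempty hX N
  obtain ⟨B, -, -, hB⟩ := exists_cornerCutting hA
  have hM := (hB.spanModel hA).union_centerCylinder
  constructor
  · intro hT
    obtain ⟨φ, -⟩ := hM.exists_isometryEquiv
    have hmem : ∀ a ∈ centerSeq X N, a ∈ B ∪ centerCylinder X N := fun a ha =>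
      Or.inr (centerSeq_subset_centerCylinder X N a ha)
    refine card_eq_one_of_mbtw_or hA htrim fun o ho a ha b hb c hc h => ?_
    have key := hT.mbtw_or (o := φ ⟨o, hmem o ho⟩) (a := φ ⟨a, hmem a ha⟩)
      (b := φ ⟨b, hmem b hb⟩) (c := φ ⟨c, hmem c hc⟩)
    unfold MBtw at *
    simp only [φ.dist_eq, Subtype.dist_eq] at key
    exact key h
  · exact fun h => hM.isMetricTree (fourPointOn_of_centerSeq h)

/-! ## Trimming and metric centers -/

theorem pendant_isometryEquiv {α β : Type*} [MetricSpace α] [MetricSpace β] (e : α ≃ᵢ β) (x : α) :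
    pendant (e x) = pendant x := by
  have h1 : (⨆ y : β, dist (e x) y) = ⨆ y : α, dist x y := by
    rw [← e.toEquiv.iSup_comp]
    exact iSup_congr fun y => e.dist_eq x y
  have h2 : {r | ∃ y z : β, y ≠ e x ∧ z ≠ e x ∧ y ≠ z ∧ r = gromovProduct (e x) y z} =
      {r | ∃ y z : α, y ≠ x ∧ z ≠ x ∧ y ≠ z ∧ r = gromovProduct x y z} := by
    ext r
    simp only [Set.mem_ofPred_eq, gromovProduct]
    rw [e.surjective.exists]
    refine exists_congr fun y => ?_
    rw [e.surjective.exists]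
    simp only [ne_eq, e.injective.eq_iff, e.dist_eq]
  rw [pendant, pendant, h1, h2, Nat.card_congr e.toEquiv]

/-- Pendant lengths are the distances to the centers, so subtracting them leaves the distance of the
centers; the trimming relation holds exactly when the centers agree. -/
theorem trimDist_eq_dist_centerOf {α : Type*} [MetricSpace α] {Z : Finset ManhattanPlane}
    (e : α ≃ᵢ Z) (x y : α) : trimDist x y = dist (centerOf Z (e x)) (centerOf Z (e y)) := by
  by_cases hxy : x = y
  · subst hxy
    rw [dist_self]
    exact if_pos (Or.inl rfl)
  have hne : (e x : ManhattanPlane) ≠ e y := fun h => hxy (e.injective (Subtype.ext h))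
  have h := dist_eq_add_centerOf (e x).2 (e y).2 hne
  have hd : dist (e x : ManhattanPlane) (e y) = dist x y := e.dist_eq x y
  rw [hd, ← pendant_eq_dist, ← pendant_eq_dist,
    pendant_isometryEquiv, pendant_isometryEquiv] at h
  by_cases ht : TrimRel x y
  · rw [trimDist, if_pos ht]
    have := ht.resolve_left hxy
    linarith
  · rw [trimDist, if_neg ht]
    linarith

theorem exists_isometryEquiv_centerSet {α : Type*} [Fintype α] [MetricSpace α]
    {Z : Finset ManhattanPlane} (e : α ≃ᵢ Z) :
    letI := trimMetric α
    Nonempty (Quotient (trimSetoid α) ≃ᵢ centerSet Z) := by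
  let := trimMetric α
  let F : Quotient (trimSetoid α) → centerSet Z :=
    Quotient.lift (fun x => ⟨centerOf Z (e x), centerOf_mem (e x).2⟩) fun x y h => by
      refine Subtype.ext (dist_eq_zero.1 ?_)
      rw [← trimDist_eq_dist_centerOf e]
      exact if_pos h
  have hF : Isometry F := Isometry.of_dist_eq <| by
    rintro ⟨x⟩ ⟨y⟩
    exact (trimDist_eq_dist_centerOf e x y).symm
  have hs : Function.Surjective F := by
    rintro ⟨p, hp⟩
    obtain ⟨a, ha, rfl⟩ := mem_centerSet.1 hp
    refine ⟨Quotient.mk _ (e.symm ⟨a, ha⟩), Subtype.ext ?_⟩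
    change centerOf Z (e (e.symm ⟨a, ha⟩)) = centerOf Z a
    rw [e.apply_symm_apply]
  exact ⟨⟨Equiv.ofBijective F ⟨hF.injective, hs⟩, hF⟩⟩

theorem exists_isometryEquiv_centerSeq (X : Finset ManhattanPlane) (k : ℕ) :
    letI := (FinMetric.trim^[k] ⟨X⟩).metric
    Nonempty ((FinMetric.trim^[k] ⟨X⟩).carrier ≃ᵢ centerSeq X k) := by
  induction k with
  | zero => exact ⟨IsometryEquiv.refl X⟩
  | succ k ih =>
    rw [Function.iterate_succ_apply']
    -- Only the isometry with the previous center set matters from here on, not how the space arose.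
    generalize FinMetric.trim^[k] ⟨X⟩ = S at ih ⊢
    let := S.fintype
    let := S.metric
    obtain ⟨e⟩ := ih
    exact exists_isometryEquiv_centerSet e

theorem natCard_trim_iterate (X : Finset ManhattanPlane) (k : ℕ) :
    Nat.card (FinMetric.trim^[k] ⟨X⟩).carrier = (centerSeq X k).card := by
  let := (FinMetric.trim^[k] ⟨X⟩).metric
  obtain ⟨e⟩ := exists_isometryEquiv_centerSeq X k
  rw [Nat.card_congr e.toEquiv, Nat.card_eq_fintype_card, Fintype.card_coe]

theorem isTrim_of_card_eq_one {Z : Finset ManhattanPlane} (h : Z.card = 1) : IsTrim Z := by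
  obtain ⟨a, rfl⟩ := Finset.card_eq_one.1 h
  refine isTrim_iff.2 fun b hb => ?_
  rw [Finset.mem_singleton.1 hb, centerOf_singleton]

/-- A singleton is trim, so any level at which trimming reaches one point can serve as the level `N`
of the tree criterion. -/
theorem isMetricTree_tightSpan_iff_trim {X : Finset ManhattanPlane} (hX : X.Nonempty) :
    IsMetricTree (tightSpan X) ↔
      ∃ k : ℕ, Nat.card (FinMetric.trim^[k] ⟨X⟩).carrier = 1 := by
  simp only [natCard_trim_iterate]
  obtain ⟨N, hN⟩ := exists_isTrim_centerSeq X
  exact ⟨fun h => ⟨N, (isMetricTree_tightSpan_iff hX hN).1 h⟩,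
    fun ⟨k, hk⟩ => (isMetricTree_tightSpan_iff hX (isTrim_of_card_eq_one hk)).2 hk⟩

theorem mainTheorem4 (X : Finset ManhattanPlane) (hX : X.Nonempty) :
    -- the metric center sequence reaches a trim set
    (∃ N : ℕ, IsTrim (centerSeq X N)) ∧
    (∀ N : ℕ, IsTrim (centerSeq X N) →
      -- it is stationary from there on
      (∀ i, N ≤ i → centerSeq X i = centerSeq X N) ∧
      -- T(X) is the union of T(m^N(X)) and the cylinder, which meet in the roots m^N(X)
      tightSpan X = pullBack X N '' tightSpan (centerSeq X N) ∪ distTo X '' centerCylinder X N ∧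
      pullBack X N '' tightSpan (centerSeq X N) ∩ distTo X '' centerCylinder X N =
        distTo X '' (centerSeq X N : Set ManhattanPlane) ∧
      -- the algorithm terminates with a unique output, a minimal closed geodesically convex set
      (∃ B : Set ManhattanPlane, CornerCutting (centerSeq X N) B ∧
        (∀ B', CornerCutting (centerSeq X N) B' → B' = B) ∧
        IsMinimalConvex (centerSeq X N) B) ∧
      -- the same decomposition inside the plane, for every such set B
      (∀ B : Set ManhattanPlane, IsMinimalConvex (centerSeq X N) B →
        (∃ φ : B ≃ᵢ tightSpan (centerSeq X N),
          ∀ p : B, (φ p : centerSeq X N → ℝ) = distTo (centerSeq X N) p) ∧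
        (∃ φ : (B ∪ centerCylinder X N : Set ManhattanPlane) ≃ᵢ tightSpan X,
          ∀ p : (B ∪ centerCylinder X N : Set ManhattanPlane), (φ p : X → ℝ) = distTo X p) ∧
        B ∩ centerCylinder X N = centerSeq X N) ∧
      (IsMetricTree (tightSpan X) ↔ (centerSeq X N).card = 1)) ∧
    (IsMetricTree (tightSpan X) ↔
      ∃ k : ℕ, Nat.card (FinMetric.trim^[k] ⟨X⟩).carrier = 1) := by
  refine ⟨exists_isTrim_centerSeq X, fun N hN => ?_, isMetricTree_tightSpan_iff_trim hX⟩
  have hA := centerSeq_nonempty hX N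
  obtain ⟨B₀, h₀, h₁, h₂⟩ := exists_cornerCutting hA
  have hu := (h₂.spanModel hA).tightSpan_eq
  refine ⟨fun i hi => centerSeq_eq_of_le hN hi, hu.1, hu.2, ⟨B₀, h₀, h₁, h₂⟩, fun B hB => ?_,
    isMetricTree_tightSpan_iff hX hN⟩
  have hm := hB.spanModel hA
  exact ⟨hm.exists_isometryEquiv, hm.union_centerCylinder.exists_isometryEquiv,
    inter_centerCylinder hm.subset hm.inBox⟩
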